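/- Let $N\ge 3$, $p_N=\frac{N}{N-2}$, $1<p<p_N$ and $\beta\in(0,1)$. Let $\omega_N$ be the volume of the unit ball $B_1\subset\mathbb R^N$, and let $\mathbb D_N\subset\mathbb R^N$ be the open ball of unit volume centred at the origin, with radius $R_N=\omega_N^{-1/N}$. Write $[t]_+=\max(t,0)$. For $I>0$, a solution of $(FB_I)$ is a pair $(\gamma,v)\in\mathbb R\times C^{2,\beta}(\overline{\mathbb D_N})$ with $$-\Delta v=[v]_+^p\ \text{ in }\mathbb D_N,\qquad v=\gamma\ \text{ on }\partial\mathbb D_N,\qquad \int_{\mathbb D_N}[v]_+^p=I .$$ For $\lambda>0$, a solution of $(P_\lambda)$ is a pair $(\alpha,\psi)\in\mathbb R\times C^{2,\beta}(\overline{\mathbb D_N})$ with $$-\Delta \psi=[\alpha+\lambda\psi]_+^p\ \text{ in }\mathbb D_N,\qquad \psi=0\ \text{ on }\partial\mathbb D_N,\qquad \int_{\mathbb D_N}[\alpha+\lambda\psi]_+^p=1 .$$ The solution $(\alpha,\psi)$ is called positive if $\alpha>0$. The free boundary of $(\gamma,v)$ is $\mathbb D_N\cap\partial\{x\in\mathbb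 D_N: v(x)>0\}$. Then the following hold. (1) For every $I>0$ there is exactly one solution $(\gamma,v)$ of $(FB_I)$, and for every $\lambda>0$ there is exactly one solution $(\alpha_\lambda,\psi_\lambda)$ of $(P_\lambda)$. (2) There is exactly one $u\in C^2(B_1)\cap C^1(\overline{B_1})$ with $-\Delta u=u^p$ and $u>0$ in $B_1$ and $u=0$ on $\partial B_1$. Set $$I_p=\int_{B_1}u^p,\qquad I^*=\frac{I_p}{R_N^{\frac{N}{p-1}\left(1-\frac{p}{p_N}\right)}},\qquad \lambda^*=(I^*)^{\frac{p-1}{p}} .$$ (3) Let $\lambda>0$ and $I=\lambda^{\frac{p}{p-1}}$ (equivalently, $I>0$ and $\lambda=I^{\frac{p-1}{p}}$), and let $(\gamma,v)$ and $(\alpha_\lambda,\psi_\lambda)$ be the solutions of $(FB_I)$ and $(P_\lambda)$. Then $\gamma=\lambda^{\frac1{p-1}}\alpha_\lambda$ and $v=\lambda^{\frac1{p-1}}(\alpha_\lambda+\lambda\psi_\lambda)$ on $\overline{\mathbb D_N}$. Moreover $$(\alpha_\lambda,\psi_\lambda)\text{ is positive}\iff v>0\text{ on }\overline{\mathbb D_N}\iff\gamma>0\iff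 I<I^*\iff\lambda<\lambda^*,$$ $$\text{the free boundary is nonempty}\iff\alpha_\lambda<0\iff\gamma<0\iff I>I^*\iff\lambda>\lambda^*,$$ and $$\alpha_\lambda=c_N\lambda\left(1-\left(\frac{\lambda}{\lambda^*}\right)^{\frac{p}{p_N-p}}\right)\quad\text{for all }\lambda>\lambda^*,\qquad c_N=\frac{1}{N(N-2)\,\omega_N R_N^{N-2}} .$$ -/

import Mathlib

open MeasureTheory Metric Set
open scoped NNReal

namespace PlasmaBall

/-- Euclidean space of dimension `N`. -/
abbrev E (N : ℕ) : Type := EuclideanSpace ℝ (Fin N)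

/-- The exponent `p_N = N / (N - 2)`, for `N ≥ 3`. -/
noncomputable def criticalExponent (N : ℕ) : ℝ := (N : ℝ) / ((N : ℝ) - 2)

/-- The volume `ω_N` of the unit ball. -/
noncomputable def omega (N : ℕ) : ℝ := (volume : Measure (E N)).real (ball 0 1)

/-- The radius `R_N = ω_N ^ (-1/N)` of the ball of unit volume. -/
noncomputable def unitRadius (N : ℕ) : ℝ := omega N ^ (-(1 / (N : ℝ)))

/-- The open ball of unit volume centred at the origin. -/
def unitVolumeBall (N : ℕ) : Set (E N) := ball 0 (unitRadius N)

theorem omega_pos (N : ℕ) : 0 < omega N := by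
  unfold omega
  exact ENNReal.toReal_pos (measure_ball_pos _ _ one_pos).ne' measure_ball_lt_top.ne

theorem unitRadius_pos (N : ℕ) : 0 < unitRadius N :=
  Real.rpow_pos_of_pos (omega_pos N) _

/-- The ball `unitVolumeBall N` does have unit volume. -/
theorem volume_unitVolumeBall (N : ℕ) (hN : N ≠ 0) :
    (volume : Measure (E N)) (unitVolumeBall N) = 1 := by
  have h1 : unitRadius N ^ N = (omega N)⁻¹ := by
    rw [unitRadius, ← Real.rpow_natCast, ← Real.rpow_mul (omega_pos N).le]
    have : -(1 / (N : ℝ)) * (N : ℝ) = -1 := by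
      have : (N : ℝ) ≠ 0 := by exact_mod_cast hN
      field_simp
    rw [this, Real.rpow_neg_one]
  have h2 : (volume : Measure (E N)) (ball 0 1) = ENNReal.ofReal (omega N) := by
    rw [omega, Measure.real, ENNReal.ofReal_toReal measure_ball_lt_top.ne]
  rw [unitVolumeBall, Measure.addHaar_ball_of_pos _ _ (unitRadius_pos N),
    finrank_euclideanSpace_fin, h1, h2,
    ← ENNReal.ofReal_mul (inv_nonneg.2 (omega_pos N).le), inv_mul_cancel₀ (omega_pos N).ne',
    ENNReal.ofReal_one]

/-- `f ∈ C^{2,β}` on the closure of the (regular, bounded, open) domain `Ω`: all derivatives up to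
order two exist and are continuous up to the boundary, and the second derivative is `β`-Hölder. -/
def IsC2Holder {N : ℕ} (β : ℝ≥0) (Ω : Set (E N)) (f : E N → ℝ) : Prop :=
  ContDiffOn ℝ 2 f (closure Ω) ∧
    ∃ C : ℝ≥0, HolderOnWith C β (iteratedFDerivWithin ℝ 2 f (closure Ω)) (closure Ω)

/-- `(γ, v)` solves the free boundary problem `(FB_I)` on `Ω`; only the values of `v` on the closure
of `Ω` are meaningful. -/
structure IsSolutionFB {N : ℕ} (Ω : Set (E N)) (p : ℝ) (β : ℝ≥0) (I γ : ℝ) (v : E N → ℝ) :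
    Prop where
  regular : IsC2Holder β Ω v
  equation : ∀ x ∈ Ω, -(Laplacian.laplacian v x) = (max (v x) 0) ^ p
  boundary : ∀ x ∈ frontier Ω, v x = γ
  mass : ∫ x in Ω, (max (v x) 0) ^ p = I

/-- `(α, ψ)` solves the problem `(P_λ)` on `Ω`; only the values of `ψ` on the closure of `Ω` are
meaningful. -/
structure IsSolutionP {N : ℕ} (Ω : Set (E N)) (p : ℝ) (β : ℝ≥0) (lam α : ℝ) (ψ : E N → ℝ) :
    Prop where
  regular : IsC2Holder β Ω ψ
  equation : ∀ x ∈ Ω, -(Laplacian.laplacian ψ x) = (max (α + lam * ψ x) 0) ^ p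
  boundary : ∀ x ∈ frontier Ω, ψ x = 0
  mass : ∫ x in Ω, (max (α + lam * ψ x) 0) ^ p = 1

/-- The free boundary: the part inside `Ω` of the boundary of the plasma region
`{x ∈ Ω | v x > 0}`. -/
def freeBoundary {N : ℕ} (Ω : Set (E N)) (v : E N → ℝ) : Set (E N) :=
  frontier {x ∈ Ω | 0 < v x} ∩ Ω

/-- `u ∈ C²(B₁) ∩ C¹₀(closure of B₁)` is a positive solution of the Emden equation `-Δu = u ^ p` in
the unit ball with zero boundary values. -/
structure IsEmdenSolution (N : ℕ) (p : ℝ) (u : E N → ℝ) : Prop where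
  regular : ContDiffOn ℝ 2 u (ball 0 1)
  regular_closure : ContDiffOn ℝ 1 u (closedBall 0 1)
  equation : ∀ x ∈ ball (0 : E N) 1, -(Laplacian.laplacian u x) = u x ^ p
  pos : ∀ x ∈ ball (0 : E N) 1, 0 < u x
  boundary : ∀ x ∈ sphere (0 : E N) 1, u x = 0

/-- `I_p = ∫_{B₁} u ^ p`. -/
noncomputable def emdenMass (N : ℕ) (p : ℝ) (u : E N → ℝ) : ℝ :=
  ∫ x in ball (0 : E N) 1, u x ^ p

/-- `I^* = I_p / R_N ^ ((N / (p - 1)) (1 - p / p_N))`, where `I_p` is computed from `u`. -/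
noncomputable def massThreshold (N : ℕ) (p : ℝ) (u : E N → ℝ) : ℝ :=
  emdenMass N p u / unitRadius N ^ ((N : ℝ) / (p - 1) * (1 - p / criticalExponent N))

/-- `λ^* = (I^*) ^ ((p - 1) / p)`. -/
noncomputable def lambdaThreshold (N : ℕ) (p : ℝ) (u : E N → ℝ) : ℝ :=
  massThreshold N p u ^ ((p - 1) / p)

/-- `c_N = (N (N - 2) ω_N R_N ^ (N - 2))⁻¹`. -/
noncomputable def greenConstant (N : ℕ) : ℝ :=
  ((N : ℝ) * ((N : ℝ) - 2) * omega N * unitRadius N ^ ((N : ℝ) - 2))⁻¹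

end PlasmaBall

/-! Both problems are one equation, $-\Delta v=f(v)$ with $f(t)=[t]_+^p$ in a ball, with an
unprescribed constant boundary value $\gamma$: a solution of $(P_\lambda)$ turns into one of
$(FB_I)$ through $v=s(\alpha+\lambda\psi)$, $s=\lambda^{1/(p-1)}$. Since $f$ is nonnegative,
nondecreasing and locally Lipschitz, $v\ge\gamma$ and the moving plane method makes $v$ radial,
whatever the sign of $\gamma$ (`IsPoissonSolution.radial`). A radial solution is determined by its
value at the centre (`IsPoissonSolution.eqOn_of_eq_center`), and positive mass forces that value to
be positive (`IsPoissonSolution.center_pos`). By scaling, the solutions of positive mass are the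
bubbles $k^{2/(p-1)}Y((k|x|)^2)$, $k>0$, built on a single profile with $Y(0)=1$
(`exists_isProfile`, `IsPoissonSolution.exists_bubble`). The profile is a function of $\tau=r^2$
because $|x|^2$, unlike $|x|$, is smooth at the origin.

The mass of a bubble in the ball of radius $R$ is $N\omega_N k^qM(kR)$ with $q=\frac{2p}{p-1}-N$ and
$M(r)=\int_0^r s^{N-1}f(Y(s^2))\,ds$. The condition $p<p_N$ says $q>0$, so the mass increases
strictly from $0$ to $\infty$ with $k$, and each mass belongs to exactly one $k$. This gives
existence and uniqueness for both problems.

The same condition makes $Y(r^2)$ vanish at some $r=r_0$ (`IsProfile.exists_zero`). The bubble with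
$k=r_0$ is the Emden solution, and $I^*$ is the mass for $k=r_0/R_N$. As $\gamma$ has the sign of
$Y((kR_N)^2)$, each of the equivalences compares $kR_N$ with $r_0$. Beyond $r_0$ the profile is
harmonic: $M$ is constant there and $Y(r^2)$ is explicit, so the mass is a pure power of $k$ and the
formula for $\alpha_\lambda$ follows. -/

namespace PlasmaBall

/-! ### The Laplacian along lines, of radial functions, and under rigid motions. -/

section LaplacianTools

open Filter Topology

variable {F : Type*} [NormedAddCommGroup F] [InnerProductSpace ℝ F]

/-- The second derivative along a line. -/
theorem iteratedFDeriv_two_eq_deriv_deriv_line {w : F → ℝ} {x : F} (hw : ContDiffAt ℝ 2 w x)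
    (e : F) :
    iteratedFDeriv ℝ 2 w x ![e, e] = deriv (deriv fun t : ℝ => w (x + t • e)) 0 := by
  have hline : ∀ t : ℝ, HasDerivAt (fun t : ℝ => x + t • e) e t := fun t => by
    simpa using ((hasDerivAt_id t).smul_const e).const_add x
  have hcont : Tendsto (fun t : ℝ => x + t • e) (𝓝 0) (𝓝 x) := by
    simpa using (hline 0).continuousAt.tendsto
  have h1 : (deriv fun t : ℝ => w (x + t • e)) =ᶠ[𝓝 0] fun t => fderiv ℝ w (x + t • e) e := by
    have := hcont.eventually (hw.eventually (by simp))
    filter_upwards [this] with t ht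
    exact ((ht.differentiableAt (by simp)).hasFDerivAt.comp_hasDerivAt t (hline t)).deriv
  rw [h1.deriv_eq, iteratedFDeriv_two_apply]
  have h2 : DifferentiableAt ℝ (fderiv ℝ w) x :=
    (hw.fderiv_right (m := 1) (by norm_num)).differentiableAt (by simp)
  have h3 : HasFDerivAt (fderiv ℝ w) (fderiv ℝ (fderiv ℝ w) x) (x + (0 : ℝ) • e) := by
    simpa using h2.hasFDerivAt
  have h4 : HasDerivAt (fun t : ℝ => fderiv ℝ w (x + t • e) e)
      (fderiv ℝ (fderiv ℝ w) x e e) 0 :=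
    ((ContinuousLinearMap.apply ℝ ℝ e).hasFDerivAt.comp_hasDerivAt (0 : ℝ)
      (h3.comp_hasDerivAt (0 : ℝ) (hline 0)))
  exact h4.deriv.symm

/-- A negative second derivative would make the point a local maximum too, so $g$ would be locally
constant and its second derivative zero. -/
theorem deriv_deriv_nonneg_of_isLocalMin {g : ℝ → ℝ} {a : ℝ} (h : IsLocalMin g a)
    (hc : ContinuousAt g a) : 0 ≤ deriv (deriv g) a := by
  by_contra! hneg
  have hmax := isLocalMax_of_deriv_deriv_neg hneg h.deriv_eq_zero hc
  have heq : g =ᶠ[𝓝 a] fun _ => g a := by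
    filter_upwards [h, hmax] with y h1 h2 using le_antisymm h2 h1
  have : deriv (deriv g) a = 0 := by
    rw [heq.deriv.deriv_eq]
    simp
  exact hneg.ne this

theorem contDiff_strip (e : F) (A c : ℝ) :
    ContDiff ℝ 2 fun z : F => A - (inner ℝ z e - c) ^ 2 :=
  contDiff_const.sub (((contDiff_id.inner ℝ contDiff_const).sub contDiff_const).pow 2)

variable [FiniteDimensional ℝ F]

theorem laplacian_eq_sum_deriv_deriv {ι : Type*} [Fintype ι] (b : OrthonormalBasis ι ℝ F)
    {w : F → ℝ} {x : F} (hw : ContDiffAt ℝ 2 w x) :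
    Laplacian.laplacian w x = ∑ i, deriv (deriv fun t : ℝ => w (x + t • b i)) 0 := by
  rw [InnerProductSpace.laplacian_eq_iteratedFDeriv_orthonormalBasis w b]
  exact Finset.sum_congr rfl fun i _ => iteratedFDeriv_two_eq_deriv_deriv_line hw (b i)

theorem laplacian_nonneg_of_isLocalMin {w : F → ℝ} {x : F} (hw : ContDiffAt ℝ 2 w x)
    (hmin : IsLocalMin w x) : 0 ≤ Laplacian.laplacian w x := by
  rw [laplacian_eq_sum_deriv_deriv (stdOrthonormalBasis ℝ F) hw]
  refine Finset.sum_nonneg fun i _ => ?_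
  have hc : Continuous fun t : ℝ => x + t • stdOrthonormalBasis ℝ F i := by fun_prop
  have hc0 : Tendsto (fun t : ℝ => x + t • stdOrthonormalBasis ℝ F i) (𝓝 0) (𝓝 x) := by
    simpa using hc.tendsto 0
  refine deriv_deriv_nonneg_of_isLocalMin ?_ ?_
  · have := hc0.eventually hmin
    filter_upwards [this] with t ht
    simpa using ht
  · have : ContinuousAt w (x + (0 : ℝ) • stdOrthonormalBasis ℝ F i) := by
      simpa using hw.continuousAt
    exact ContinuousAt.comp (f := fun t : ℝ => x + t • stdOrthonormalBasis ℝ F i) this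
      hc.continuousAt

/-- Along a line with unit direction, $|x-y|^2$ is a monic quadratic in the parameter; summing this
formula over an orthonormal basis gives the Laplacian of $Y(|x-y|^2)$. -/
theorem deriv_deriv_comp_quadratic {Y : ℝ → ℝ} {a : ℝ} (b : ℝ) (hY : ContDiffAt ℝ 2 Y a) :
    deriv (deriv fun t : ℝ => Y (a + b * t + t ^ 2)) 0
      = b ^ 2 * deriv (deriv Y) a + 2 * deriv Y a := by
  have hq : ∀ t : ℝ, HasDerivAt (fun t : ℝ => a + b * t + t ^ 2) (b + 2 * t) t := fun t => by
    have h := (((hasDerivAt_id' t).const_mul b).const_add a).add (hasDerivAt_pow 2 t)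
    exact h.congr_deriv (by simp)
  have hcont : Tendsto (fun t : ℝ => a + b * t + t ^ 2) (𝓝 0) (𝓝 a) := by
    simpa using (hq 0).continuousAt.tendsto
  have h1 : (deriv fun t : ℝ => Y (a + b * t + t ^ 2)) =ᶠ[𝓝 0]
      fun t => deriv Y (a + b * t + t ^ 2) * (b + 2 * t) := by
    filter_upwards [hcont.eventually (hY.eventually (by simp))] with t ht
    exact ((ht.differentiableAt (by simp)).hasDerivAt.comp t (hq t)).deriv
  rw [h1.deriv_eq]
  have hd : ContDiffAt ℝ 1 (deriv Y) a := by
    have := hY.fderiv_right (m := 1) (by norm_num)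
    exact this.clm_apply contDiffAt_const
  have h3 : HasDerivAt (deriv Y) (deriv (deriv Y) a) (a + b * 0 + 0 ^ 2) := by
    simpa using (hd.differentiableAt (by simp)).hasDerivAt
  have h4 := (h3.comp (0 : ℝ) (hq 0)).mul (((hasDerivAt_id (0 : ℝ)).const_mul 2).const_add b)
  have h5 := h4.deriv
  simp only [id, mul_zero, add_zero, mul_one] at h5
  have h6 : deriv (fun t => deriv Y (a + b * t + t ^ 2) * (b + 2 * t)) 0 = _ := h5
  rw [h6]
  simp
  ring

/-- The Laplacian of a function of the squared distance to a point. -/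
theorem laplacian_comp_norm_sub_sq {Y : ℝ → ℝ} (x y : F) (hY : ContDiffAt ℝ 2 Y (‖x - y‖ ^ 2)) :
    Laplacian.laplacian (fun z : F => Y (‖z - y‖ ^ 2)) x
      = 4 * ‖x - y‖ ^ 2 * deriv (deriv Y) (‖x - y‖ ^ 2)
        + 2 * Module.finrank ℝ F * deriv Y (‖x - y‖ ^ 2) := by
  have hn : ContDiff ℝ 2 fun z : F => ‖z - y‖ ^ 2 :=
    (contDiff_norm_sq ℝ).comp (contDiff_id.sub contDiff_const)
  have hw : ContDiffAt ℝ 2 (fun z : F => Y (‖z - y‖ ^ 2)) x :=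
    ContDiffAt.comp (f := fun z : F => ‖z - y‖ ^ 2) x hY hn.contDiffAt
  set b := stdOrthonormalBasis ℝ F
  rw [laplacian_eq_sum_deriv_deriv b hw]
  have key : ∀ i, (deriv (deriv fun t : ℝ => Y (‖x + t • b i - y‖ ^ 2)) 0)
      = 4 * inner ℝ (b i) (x - y) ^ 2 * deriv (deriv Y) (‖x - y‖ ^ 2)
        + 2 * deriv Y (‖x - y‖ ^ 2) := by
    intro i
    have : (fun t : ℝ => Y (‖x + t • b i - y‖ ^ 2))
        = fun t => Y (‖x - y‖ ^ 2 + (2 * inner ℝ (b i) (x - y)) * t + t ^ 2) := by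
      funext t
      congr 1
      rw [show x + t • b i - y = (x - y) + t • b i by abel, norm_add_sq_real, inner_smul_right,
        norm_smul, b.norm_eq_one, real_inner_comm]
      simp
      ring
    rw [this, deriv_deriv_comp_quadratic _ hY]
    ring
  simp_rw [key]
  rw [Finset.sum_add_distrib, ← Finset.sum_mul, ← Finset.mul_sum]
  have hs : ∑ i, inner ℝ (b i) (x - y) ^ 2 = ‖x - y‖ ^ 2 := by
    rw [← b.sum_sq_norm_inner_right (x - y)]
    simp
  rw [hs]
  simp
  ring

theorem laplacian_comp_norm_sq {Y : ℝ → ℝ} (x : F) (hY : ContDiffAt ℝ 2 Y (‖x‖ ^ 2)) :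
    Laplacian.laplacian (fun z : F => Y (‖z‖ ^ 2)) x
      = 4 * ‖x‖ ^ 2 * deriv (deriv Y) (‖x‖ ^ 2)
        + 2 * Module.finrank ℝ F * deriv Y (‖x‖ ^ 2) := by
  simpa using laplacian_comp_norm_sub_sq (Y := Y) x 0 (by simpa using hY)

/-- The Laplacian of a concave quadratic function of one coordinate. -/
theorem laplacian_strip {e : F} (he : ‖e‖ = 1) (A c : ℝ) (x : F) :
    Laplacian.laplacian (fun z : F => A - (inner ℝ z e - c) ^ 2) x = -2 := by
  set b := stdOrthonormalBasis ℝ F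
  rw [laplacian_eq_sum_deriv_deriv b (contDiff_strip e A c).contDiffAt]
  have key : ∀ i, (deriv (deriv fun t : ℝ => A - (inner ℝ (x + t • b i) e - c) ^ 2) 0)
      = -2 * inner ℝ (b i) e ^ 2 := by
    intro i
    set s := inner ℝ (b i) e
    set r := inner ℝ x e
    have h0 : (fun t : ℝ => A - (inner ℝ (x + t • b i) e - c) ^ 2)
        = fun t => A - (r + t * s - c) ^ 2 := by
      funext t
      rw [inner_add_left, real_inner_smul_left]
    have hl : ∀ t : ℝ, HasDerivAt (fun t : ℝ => r + t * s - c) s t := fun t => by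
      simpa using (((hasDerivAt_id t).mul_const s).const_add r).sub_const c
    have h1 : (deriv fun t : ℝ => A - (r + t * s - c) ^ 2)
        = fun t => -(2 * (r + t * s - c) * s) := by
      funext t
      simp
    rw [h0, h1]
    have h2 := (((hl 0).const_mul 2).mul_const s).neg.deriv
    have h3 : deriv (fun t => -(2 * (r + t * s - c) * s)) 0 = _ := h2
    rw [h3]
    ring
  simp_rw [key]
  rw [← Finset.mul_sum]
  have hs : ∑ i, inner ℝ (b i) e ^ 2 = ‖e‖ ^ 2 := by
    rw [← b.sum_sq_norm_inner_right e]
    simp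
  rw [hs, he]
  norm_num

/-- The Laplacian is invariant under rigid motions. -/
theorem laplacian_comp_rigid (ρ : F ≃ₗᵢ[ℝ] F) (a : F) {v : F → ℝ} {x : F}
    (hv : ContDiffAt ℝ 2 v (ρ x + a)) :
    Laplacian.laplacian (fun z => v (ρ z + a)) x = Laplacian.laplacian v (ρ x + a) := by
  have hρ : ContDiff ℝ 2 fun z : F => ρ z + a := ρ.contDiff.add contDiff_const
  have hw : ContDiffAt ℝ 2 (fun z => v (ρ z + a)) x :=
    ContDiffAt.comp (f := fun z : F => ρ z + a) x hv hρ.contDiffAt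
  set b := stdOrthonormalBasis ℝ F
  rw [laplacian_eq_sum_deriv_deriv b hw, laplacian_eq_sum_deriv_deriv (b.map ρ) hv]
  refine Finset.sum_congr rfl fun i _ => ?_
  congr 2
  funext t
  congr 1
  simp only [map_add, map_smul, OrthonormalBasis.map_apply]
  abel

end LaplacianTools

/-! ### Minimum principles: Hopf barrier, strong form, narrow sets. -/

section MaximumPrinciples

open Filter Topology

variable {F : Type*} [NormedAddCommGroup F] [InnerProductSpace ℝ F] [FiniteDimensional ℝ F]

theorem ContDiffAt.laplacian_sub_const_mul {w h : F → ℝ} {x : F} (hw : ContDiffAt ℝ 2 w x)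
    (hh : ContDiffAt ℝ 2 h x) (c : ℝ) :
    ContDiffAt ℝ 2 (fun z => w z - c * h z) x ∧
    Laplacian.laplacian (fun z => w z - c * h z) x
      = Laplacian.laplacian w x - c * Laplacian.laplacian h x := by
  have hch : ContDiffAt ℝ 2 (c • h) x := hh.const_smul c
  refine ⟨hw.sub hch, ?_⟩
  have h1 := hw.laplacian_sub hch
  rw [InnerProductSpace.laplacian_smul c hh] at h1
  exact h1

/-- Hopf's barrier argument: a nonnegative superharmonic function on a ball which is positive at the
centre is positive. -/
theorem pos_on_ball_of_superharmonic {w : F → ℝ} {y : F} {r : ℝ}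
    (hc : ContinuousOn w (closedBall y r)) (hd : ∀ x ∈ ball y r, ContDiffAt ℝ 2 w x)
    (hΔ : ∀ x ∈ ball y r, Laplacian.laplacian w x ≤ 0) (h0 : ∀ x ∈ closedBall y r, 0 ≤ w x)
    (hy : 0 < w y) : ∀ x ∈ ball y r, 0 < w x := by
  intro x1 hx1
  have hr : 0 < r := dist_nonneg.trans_lt hx1
  -- The barrier `h` below is at most $1$, so $w-\eta h\ge0$ on the small ball where $w\ge\eta$.
  set η := w y / 2 with hη
  have hη0 : 0 < η := by positivity
  obtain ⟨s, hs0, hsr, hsw⟩ : ∃ s, 0 < s ∧ s < r ∧ ∀ x ∈ closedBall y s, η ≤ w x := by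
    have h1 := Metric.continuousAt_iff.1
      ((hc y (mem_closedBall_self hr.le)).continuousAt (closedBall_mem_nhds y hr)) η hη0
    obtain ⟨δ, hδ, h⟩ := h1
    refine ⟨min δ r / 2, by positivity, by linarith [min_le_right δ r], fun x hx => ?_⟩
    have : dist x y < δ := lt_of_le_of_lt hx (by linarith [min_le_left δ r, lt_min hδ hr])
    have := h this
    rw [Real.dist_eq] at this
    have := (abs_lt.1 this).1
    rw [hη]
    linarith
  set n : ℝ := ((Module.finrank ℝ F : ℕ) : ℝ) with hn
  have hn0 : 0 ≤ n := Nat.cast_nonneg _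
  -- With $\tau=|x-y|^2$ the barrier has $\Delta h=2ae^{-a\tau}(2a\tau-n)$; this $a$ makes
  -- $2as^2=n+1$, so `h` is strictly subharmonic outside radius $s$.
  set a : ℝ := (n + 1) / (2 * s ^ 2) with ha
  have ha0 : 0 < a := by positivity
  set Y : ℝ → ℝ := fun τ => Real.exp (-a * τ) - Real.exp (-a * r ^ 2) with hY
  have hYs : ContDiff ℝ 2 Y := by fun_prop
  have hexp : ∀ τ, HasDerivAt (fun τ => Real.exp (-a * τ)) (Real.exp (-a * τ) * -a) τ := fun τ => by
    simpa using ((hasDerivAt_id τ).const_mul (-a)).exp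
  have hY1 : deriv Y = fun τ => Real.exp (-a * τ) * -a := by
    funext τ
    exact ((hexp τ).sub_const _).deriv
  have hY2 : deriv (deriv Y) = fun τ => Real.exp (-a * τ) * -a * -a := by
    rw [hY1]
    funext τ
    exact ((hexp τ).mul_const _).deriv
  set h : F → ℝ := fun z => Y (‖z - y‖ ^ 2) with hh
  have hhs : ContDiff ℝ 2 h :=
    hYs.comp ((contDiff_norm_sq ℝ).comp (contDiff_id.sub contDiff_const))
  have hpos : 0 < h x1 := by
    simp only [hh, hY, sub_pos, Real.exp_lt_exp]
    have : ‖x1 - y‖ < r := by simpa [dist_eq_norm] using hx1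
    have : ‖x1 - y‖ ^ 2 < r ^ 2 := by gcongr
    nlinarith
  by_contra! hneg
  -- A negative minimum of $w-\eta h$ lies neither in the small ball nor on the outer sphere, where
  -- $h=0$. In the annulus between them $\Delta(w-\eta h)<0$, which excludes a minimum.
  obtain ⟨x0, hx0, hmin⟩ := (isCompact_closedBall y r).exists_isMinOn
    ⟨x1, ball_subset_closedBall hx1⟩ (hc.sub (hhs.continuous.const_smul η).continuousOn)
  have hlt : w x0 - η * h x0 < 0 := by
    have : w x0 - η * h x0 ≤ w x1 - η * h x1 := hmin (ball_subset_closedBall hx1)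
    nlinarith
  have hx0s : s < ‖x0 - y‖ := by
    by_contra! hle
    have h1 := hsw x0 (by simpa [dist_eq_norm] using hle)
    have h2 : h x0 ≤ 1 := by
      have : Real.exp (-a * ‖x0 - y‖ ^ 2) ≤ 1 :=
        Real.exp_le_one_iff.2 (by nlinarith [sq_nonneg ‖x0 - y‖])
      simp only [hh, hY]
      linarith [Real.exp_pos (-a * r ^ 2)]
    nlinarith
  have hx0r : ‖x0 - y‖ < r := by
    refine lt_of_le_of_ne (by simpa [dist_eq_norm] using hx0) fun heq => ?_
    have : h x0 = 0 := by simp [hh, hY, heq]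
    rw [this] at hlt
    linarith [h0 x0 hx0]
  have hx0b : x0 ∈ ball y r := by simpa [dist_eq_norm] using hx0r
  obtain ⟨hg, hgΔ⟩ :=
    ContDiffAt.laplacian_sub_const_mul (hd x0 hx0b) (hhs.contDiffAt (x := x0)) η
  have hloc : IsLocalMin (fun z => w z - η * h z) x0 := by
    filter_upwards [closedBall_mem_nhds_of_mem hx0b] with z hz using hmin hz
  have h1 := laplacian_nonneg_of_isLocalMin hg hloc
  rw [hgΔ] at h1
  have h2 : Laplacian.laplacian h x0
      = 4 * ‖x0 - y‖ ^ 2 * deriv (deriv Y) (‖x0 - y‖ ^ 2) + 2 * n * deriv Y (‖x0 - y‖ ^ 2) :=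
    laplacian_comp_norm_sub_sq x0 y hYs.contDiffAt
  rw [hY2, hY1] at h2
  have h3 : 0 < Laplacian.laplacian h x0 := by
    have h4 : n + 1 ≤ 2 * a * ‖x0 - y‖ ^ 2 := by
      have : s ^ 2 ≤ ‖x0 - y‖ ^ 2 := by gcongr
      calc n + 1 = 2 * a * s ^ 2 := by rw [ha]; field_simp
        _ ≤ _ := by gcongr
    have h5 : Laplacian.laplacian h x0
        = Real.exp (-a * ‖x0 - y‖ ^ 2) * (2 * a) * (2 * a * ‖x0 - y‖ ^ 2 - n) := by
      rw [h2]; ring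
    rw [h5]
    have : 0 < 2 * a * ‖x0 - y‖ ^ 2 - n := by linarith
    positivity
  nlinarith [hΔ x0 hx0b]

/-- The strong minimum principle. -/
theorem pos_of_superharmonic {w : F → ℝ} {Ω : Set F} (hΩ : IsOpen Ω) (hpre : IsPreconnected Ω)
    (hd : ∀ x ∈ Ω, ContDiffAt ℝ 2 w x) (hΔ : ∀ x ∈ Ω, Laplacian.laplacian w x ≤ 0)
    (h0 : ∀ x ∈ Ω, 0 ≤ w x) (hpos : ∃ x ∈ Ω, 0 < w x) : ∀ x ∈ Ω, 0 < w x := by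
  have hcont : ContinuousOn w Ω := fun x hx => (hd x hx).continuousAt.continuousWithinAt
  have hopen : IsOpen (Ω ∩ w ⁻¹' Ioi 0) := hcont.isOpen_inter_preimage hΩ isOpen_Ioi
  obtain ⟨x2, hx2, hwx2⟩ := hpos
  -- By connectedness it is enough that the open positivity set is relatively closed in `Ω`.
  refine fun x hx => (hpre.subset_of_closure_inter_subset hopen ⟨x2, hx2, hx2, hwx2⟩ ?_ hx).2
  rintro x ⟨hxc, hxΩ⟩
  obtain ⟨d, hd0, hdΩ⟩ := Metric.isOpen_iff.1 hΩ x hxΩ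
  -- The ball is centred at a nearby point of positivity, with a radius that reaches `x` and stays
  -- inside `Ω`.
  obtain ⟨y, hy, hxy⟩ := Metric.mem_closure_iff.1 hxc (d / 2) (by positivity)
  have hsub : closedBall y (d / 2) ⊆ Ω := fun z hz => hdΩ (by
    have h1 : dist z y ≤ d / 2 := hz
    have h2 := dist_triangle z y x
    rw [dist_comm y x] at h2
    exact mem_ball.2 (by linarith))
  have hsub' := ball_subset_closedBall.trans hsub
  exact ⟨hxΩ, pos_on_ball_of_superharmonic (hcont.mono hsub) (fun z hz => hd z (hsub' hz))
    (fun z hz => hΔ z (hsub' hz)) (fun z hz => h0 z (hsub hz)) hy.2 x hxy⟩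

/-- The minimum principle for `Δ w + M w ≤ 0` in narrow sets. -/
theorem nonneg_of_narrow {K : Set F} (hK : IsCompact K) {w : F → ℝ} (hc : ContinuousOn w K)
    {e : F} (he : ‖e‖ = 1) {c d M : ℝ} (hM : 0 < M) (hd : ∀ x ∈ K, |inner ℝ x e - c| ≤ d)
    (hMd : M * d ^ 2 < 1)
    (hint : ∀ x ∈ K, w x < 0 →
      K ∈ 𝓝 x ∧ ContDiffAt ℝ 2 w x ∧ Laplacian.laplacian w x ≤ -(M * w x)) :
    ∀ x ∈ K, 0 ≤ w x := by
  intro x1 hx1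
  by_contra! hneg
  -- A strict positive supersolution: $g>0$ because $Md^2<1$, and $\Delta g+Mg\le-2+1<0$.
  set g : F → ℝ := fun z => 1 / M - (inner ℝ z e - c) ^ 2 with hg
  have hgs : ContDiff ℝ 2 g := contDiff_strip e _ c
  have hMg : ∀ x, M * g x = 1 - M * (inner ℝ x e - c) ^ 2 := fun x => by
    simp only [hg]
    field_simp
  have hgpos : ∀ x ∈ K, 0 < g x := fun x hx => by
    have h1 : (inner ℝ x e - c) ^ 2 ≤ d ^ 2 :=
      sq_le_sq' (abs_le.1 (hd x hx)).1 (abs_le.1 (hd x hx)).2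
    have h2 := hMg x
    have : 0 < M * g x := by nlinarith
    exact pos_of_mul_pos_right this hM.le
  -- At a negative minimum $q$ of $w/g$ the function $w-qg\ge0$ touches zero, yet its Laplacian is
  -- at most $-Mqg+2q=q(2-Mg)<0$.
  obtain ⟨x0, hx0, hmin⟩ := hK.exists_isMinOn ⟨x1, hx1⟩
    (hc.div hgs.continuous.continuousOn fun x hx => (hgpos x hx).ne')
  set q := w x0 / g x0 with hq
  have hqneg : q < 0 := lt_of_le_of_lt (hmin hx1) (div_neg_of_neg_of_pos hneg (hgpos x1 hx1))
  have hwq : w x0 = q * g x0 := by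
    rw [hq, div_mul_cancel₀ _ (hgpos x0 hx0).ne']
  have hge : ∀ x ∈ K, 0 ≤ w x - q * g x := fun x hx => by
    have h1 : q ≤ w x / g x := hmin hx
    rw [le_div_iff₀ (hgpos x hx)] at h1
    linarith
  obtain ⟨hKn, hws, hΔ⟩ := hint x0 hx0 (hwq ▸ mul_neg_of_neg_of_pos hqneg (hgpos x0 hx0))
  obtain ⟨hs, hsΔ⟩ := ContDiffAt.laplacian_sub_const_mul hws (hgs.contDiffAt (x := x0)) q
  have hloc : IsLocalMin (fun z => w z - q * g z) x0 := by
    filter_upwards [hKn] with z hz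
    have := hge z hz
    linarith
  have h1 := laplacian_nonneg_of_isLocalMin hs hloc
  rw [hsΔ, laplacian_strip he] at h1
  have h2 : M * w x0 = q * (1 - M * (inner ℝ x0 e - c) ^ 2) := by
    rw [← hMg, hwq]; ring
  nlinarith [mul_nonneg hM.le (sq_nonneg (inner ℝ x0 e - c))]

end MaximumPrinciples

/-! ### Moving planes and radial symmetry. -/

section MovingPlanes

open Filter Topology

variable {F : Type*} [NormedAddCommGroup F] [InnerProductSpace ℝ F]

/-- The reflection in the hyperplane `{x | ⟪x, e⟫ = l}`. -/
noncomputable def planeReflection (e : F) (l : ℝ) (x : F) : F :=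
  x - (2 * (inner ℝ x e - l)) • e

theorem planeReflection_of_inner_eq {e : F} {l : ℝ} {x : F} (h : inner ℝ x e = l) :
    planeReflection e l x = x := by
  simp [planeReflection, h]

theorem continuous_planeReflection (e : F) (l : ℝ) : Continuous (planeReflection e l) := by
  unfold planeReflection
  fun_prop

theorem norm_sq_planeReflection {e : F} (he : ‖e‖ = 1) (l : ℝ) (x : F) :
    ‖planeReflection e l x‖ ^ 2 = ‖x‖ ^ 2 - 4 * l * (inner ℝ x e - l) := by
  rw [planeReflection, norm_sub_sq_real, inner_smul_right, norm_smul, he, mul_one, Real.norm_eq_abs,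
    sq_abs]
  ring

theorem norm_planeReflection_le {e : F} (he : ‖e‖ = 1) {l : ℝ} (hl : 0 ≤ l) {x : F}
    (hx : l ≤ inner ℝ x e) : ‖planeReflection e l x‖ ≤ ‖x‖ := by
  refine le_of_sq_le_sq ?_ (norm_nonneg x)
  rw [norm_sq_planeReflection he]
  nlinarith [mul_nonneg hl (sub_nonneg.2 hx)]

theorem norm_planeReflection_lt {e : F} (he : ‖e‖ = 1) {l : ℝ} (hl : 0 < l) {x : F}
    (hx : l < inner ℝ x e) : ‖planeReflection e l x‖ < ‖x‖ := by
  refine lt_of_pow_lt_pow_left₀ 2 (norm_nonneg x) ?_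
  rw [norm_sq_planeReflection he]
  nlinarith [mul_pos hl (sub_pos.2 hx)]

/-- A linear isometry followed by a translation, the form to which `laplacian_comp_rigid` applies.
-/
theorem planeReflection_eq_reflection_add {e : F} (he : ‖e‖ = 1) (l : ℝ) (x : F) :
    planeReflection e l x = (ℝ ∙ e)ᗮ.reflection x + (2 * l) • e := by
  rw [Submodule.reflection_orthogonal_apply, Submodule.reflection_singleton_apply, planeReflection,
    real_inner_comm]
  simp only [he]
  module

/-- The bisecting hyperplane of two points of equal norm passes through the origin; this is how
reflection inequalities yield radial symmetry. -/
theorem planeReflection_of_norm_eq {x y : F} (hne : x ≠ y) (h : ‖x‖ = ‖y‖) :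
    planeReflection (‖x - y‖⁻¹ • (x - y)) 0 x = y := by
  have hn : ‖x - y‖ ≠ 0 := norm_ne_zero_iff.2 (sub_ne_zero.2 hne)
  have h1 : 2 * inner ℝ x (x - y) = ‖x - y‖ ^ 2 := by
    rw [norm_sub_sq_real, inner_sub_right, real_inner_self_eq_norm_sq, ← h]
    ring
  have h2 : (2 * (inner ℝ x (‖x - y‖⁻¹ • (x - y)) - 0)) * ‖x - y‖⁻¹ = 1 := by
    rw [inner_smul_right, sub_zero]
    field_simp
    linarith
  rw [planeReflection, smul_smul, h2]
  simp

variable [FiniteDimensional ℝ F]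

/-- Solutions of `-Δ v = f(v)` in the ball of radius `R` with constant boundary value `γ`. -/
structure IsPoissonSolution (f : ℝ → ℝ) (R γ : ℝ) (v : F → ℝ) : Prop where
  continuousOn : ContinuousOn v (closedBall 0 R)
  contDiffAt : ∀ x ∈ ball 0 R, ContDiffAt ℝ 2 v x
  equation : ∀ x ∈ ball 0 R, -(Laplacian.laplacian v x) = f (v x)
  boundary : ∀ x ∈ sphere 0 R, v x = γ

variable {f : ℝ → ℝ} {R γ : ℝ} {v : F → ℝ} {e : F}

theorem IsPoissonSolution.laplacian_reflection (hv : IsPoissonSolution f R γ v) (he : ‖e‖ = 1)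
    {l : ℝ} {x : F} (hx : x ∈ ball 0 R) (hσ : planeReflection e l x ∈ ball 0 R) :
    ContDiffAt ℝ 2 (fun z => v (planeReflection e l z) - v z) x ∧
    Laplacian.laplacian (fun z => v (planeReflection e l z) - v z) x
      = f (v x) - f (v (planeReflection e l x)) := by
  have h1 : (fun z => v (planeReflection e l z))
      = fun z => v ((ℝ ∙ e)ᗮ.reflection z + (2 * l) • e) := by
    funext z
    rw [planeReflection_eq_reflection_add he]
  have hvσ := hv.contDiffAt _ hσ
  rw [planeReflection_eq_reflection_add he] at hvσ
  have hs : ContDiffAt ℝ 2 (fun z => v (planeReflection e l z)) x := by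
    rw [h1]
    exact ContDiffAt.comp (f := fun z : F => (ℝ ∙ e)ᗮ.reflection z + (2 * l) • e) x hvσ
      ((LinearIsometryEquiv.contDiff _).add contDiff_const).contDiffAt
  refine ⟨hs.sub (hv.contDiffAt x hx), ?_⟩
  have h2 := hs.laplacian_sub (hv.contDiffAt x hx)
  have h3 : Laplacian.laplacian (fun z => v (planeReflection e l z)) x
      = Laplacian.laplacian v (planeReflection e l x) := by
    rw [h1, laplacian_comp_rigid _ _ hvσ, planeReflection_eq_reflection_add he]
  have h4 := hv.equation x hx
  have h5 := hv.equation _ hσ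
  have h6 : Laplacian.laplacian (fun z => v (planeReflection e l z) - v z) x = _ := h2
  rw [h6, h3]
  linarith

theorem IsPoissonSolution.boundary_le (hv : IsPoissonSolution f R γ v) (hf0 : ∀ t, 0 ≤ f t)
    (he : ‖e‖ = 1) (x : F) (hx : x ∈ closedBall 0 R) : γ ≤ v x := by
  -- Any $M>0$ with $MR^2<1$ makes the whole ball narrow. Where $v<\gamma$, superharmonicity gives
  -- $\Delta v\le0\le-M(v-\gamma)$, so `M` need not be related to `f`.
  have hM : (0 : ℝ) < 1 / (R ^ 2 + 1) := by positivity
  have key := nonneg_of_narrow (isCompact_closedBall (0 : F) R) (w := fun z => v z - γ)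
    (hv.continuousOn.sub continuousOn_const) he hM (c := 0) (d := R)
    (fun z hz => ?_) ?_ (fun z hz hneg => ?_) x hx
  · linarith
  · rw [sub_zero]
    calc |inner ℝ z e| ≤ ‖z‖ * ‖e‖ := abs_real_inner_le_norm z e
      _ ≤ R := by simpa [he] using hz
  · rw [div_mul_eq_mul_div, div_lt_one (by positivity)]
    linarith
  · have hzb : z ∈ ball (0 : F) R := by
      rcases (mem_closedBall.1 hz).lt_or_eq with h | h
      · exact h
      · exact absurd (hv.boundary z h) (by intro h; rw [h] at hneg; simp at hneg)
    refine ⟨closedBall_mem_nhds_of_mem hzb, (hv.contDiffAt z hzb).sub contDiffAt_const, ?_⟩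
    have h1 := (hv.contDiffAt z hzb).laplacian_sub (contDiffAt_const (c := γ) (n := 2))
    have h2 : Laplacian.laplacian (fun z => v z - γ) z = Laplacian.laplacian v z := by
      have h3 : Laplacian.laplacian (fun z => v z - γ) z = _ := h1
      rw [h3]
      simp
    rw [h2]
    have := hv.equation z hzb
    have := hf0 (v z)
    have := mul_neg_of_pos_of_neg hM hneg
    linarith

theorem IsPoissonSolution.boundary_lt (hv : IsPoissonSolution f R γ v) (hf0 : ∀ t, 0 ≤ f t)
    (he : ‖e‖ = 1) (hne : ∃ x ∈ ball (0 : F) R, v x ≠ γ) (x : F) (hx : x ∈ ball 0 R) :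
    γ < v x := by
  have key := pos_of_superharmonic (w := v - fun _ => γ) isOpen_ball
    (convex_ball (0 : F) R).isPreconnected
    (fun z hz => (hv.contDiffAt z hz).sub contDiffAt_const) (fun z hz => ?_)
    (fun z hz => sub_nonneg.2 (hv.boundary_le hf0 he z (ball_subset_closedBall hz))) ?_ x hx
  · exact sub_pos.1 key
  · rw [(hv.contDiffAt z hz).laplacian_sub contDiffAt_const]
    have := hv.equation z hz
    have := hf0 (v z)
    simp
    linarith
  · obtain ⟨z, hz, hzγ⟩ := hne
    exact ⟨z, hz, sub_pos.2 (lt_of_le_of_ne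
      (hv.boundary_le hf0 he z (ball_subset_closedBall hz)) hzγ.symm)⟩

/-- The moving plane inequality at position `l`, given it at distance `δ` from the plane. -/
theorem IsPoissonSolution.le_reflection_of_narrow (hv : IsPoissonSolution f R γ v)
    (hf0 : ∀ t, 0 ≤ f t) (he : ‖e‖ = 1) {M : ℝ} (hM : 0 < M)
    (hLip : ∀ x ∈ closedBall (0 : F) R, ∀ y ∈ closedBall (0 : F) R, v x ≤ v y →
      f (v y) - f (v x) ≤ M * (v y - v x))
    {l δ : ℝ} (hl : 0 ≤ l) (hMδ : M * δ ^ 2 < 1)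
    (hfar : ∀ x ∈ closedBall (0 : F) R, l + δ ≤ inner ℝ x e → v x ≤ v (planeReflection e l x)) :
    ∀ x ∈ closedBall (0 : F) R, l ≤ inner ℝ x e → v x ≤ v (planeReflection e l x) := by
  intro x hx hxl
  by_cases hxδ : l + δ ≤ inner ℝ x e
  · exact hfar x hx hxδ
  push Not at hxδ
  have hin : Continuous fun z : F => (inner ℝ z e : ℝ) := by fun_prop
  -- In this strip the difference of the reflected $v$ and $v$ is zero on the plane, nonnegative on
  -- the far face by `hfar`, and nonnegative on the sphere since $v=\gamma$ is minimal there. Hence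
  -- it can be negative only at interior points.
  set K : Set F := closedBall 0 R ∩ {z | inner ℝ z e ∈ Icc l (l + δ)} with hK
  have hKc : IsCompact K :=
    (isCompact_closedBall _ _).inter_right (isClosed_Icc.preimage hin)
  have hσK : ∀ z ∈ K, planeReflection e l z ∈ closedBall (0 : F) R := fun z hz => by
    have h1 := norm_planeReflection_le he hl hz.2.1
    have h2 := hz.1
    rw [mem_closedBall_zero_iff] at h2 ⊢
    linarith
  have hcont : ContinuousOn (fun z => v (planeReflection e l z) - v z) K :=
    (hv.continuousOn.comp (continuous_planeReflection e l).continuousOn hσK).sub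
      (hv.continuousOn.mono inter_subset_left)
  refine sub_nonneg.1 (nonneg_of_narrow hKc hcont he hM (c := l) (d := δ) (fun z hz => ?_) hMδ
    (fun z hz hneg => ?_) x ⟨hx, hxl, hxδ.le⟩)
  · rw [abs_le]
    constructor <;> linarith [hz.2.1, hz.2.2]
  · have hlz : l < inner ℝ z e := lt_of_le_of_ne hz.2.1 fun h => by
      rw [planeReflection_of_inner_eq h.symm] at hneg
      simp at hneg
    have hzδ : inner ℝ z e < l + δ := by
      by_contra! h
      linarith [hfar z hz.1 h]
    have hzb : z ∈ ball (0 : F) R := by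
      rcases (mem_closedBall.1 hz.1).lt_or_eq with h | h
      · exact h
      · have h1 := hv.boundary z h
        have h2 := hv.boundary_le hf0 he _ (hσK z hz)
        linarith
    have hσb : planeReflection e l z ∈ ball (0 : F) R := by
      have h1 := norm_planeReflection_le he hl hz.2.1
      rw [mem_ball_zero_iff] at hzb ⊢
      linarith
    obtain ⟨h1, h2⟩ := hv.laplacian_reflection he hzb hσb
    refine ⟨?_, h1, ?_⟩
    · filter_upwards [isOpen_ball.mem_nhds hzb, (isOpen_Ioo.preimage hin).mem_nhds ⟨hlz, hzδ⟩]
        with y hy1 hy2 using ⟨ball_subset_closedBall hy1, hy2.1.le, hy2.2.le⟩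
    · rw [h2]
      have := hLip _ (hσK z hz) z hz.1 (by linarith)
      linarith

/-- As `f` is monotone, the difference is superharmonic on the cap. On the spherical part it is
positive, because for $l>0$ the reflected point is interior, where $v>\gamma$. The strong minimum
principle does the rest. -/
theorem IsPoissonSolution.lt_reflection (hv : IsPoissonSolution f R γ v) (hmono : Monotone f)
    (he : ‖e‖ = 1) (hpos : ∀ x ∈ ball (0 : F) R, γ < v x) {l : ℝ} (hl : 0 < l)
    (hle : ∀ x ∈ closedBall (0 : F) R, l ≤ inner ℝ x e → v x ≤ v (planeReflection e l x)) :
    ∀ x ∈ closedBall (0 : F) R, l < inner ℝ x e → v x < v (planeReflection e l x) := by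
  have hin : Continuous fun z : F => (inner ℝ z e : ℝ) := by fun_prop
  have hsphere : ∀ x ∈ sphere (0 : F) R, l < inner ℝ x e → v x < v (planeReflection e l x) := by
    intro x hx hxl
    rw [hv.boundary x hx]
    refine hpos _ ?_
    have := norm_planeReflection_lt he hl hxl
    rw [mem_sphere_zero_iff_norm] at hx
    rw [mem_ball_zero_iff]
    linarith
  intro x hx hxl
  rcases (mem_closedBall.1 hx).lt_or_eq with hxb | hxs
  swap
  · exact hsphere x hxs hxl
  have hxR : ‖x‖ < R := by simpa using hxb
  have hlR : l < R := by
    have := (le_abs_self _).trans (abs_real_inner_le_norm x e)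
    rw [he, mul_one] at this
    linarith
  have hR : 0 < R := hl.trans hlR
  set Ω : Set F := ball 0 R ∩ {z | l < inner ℝ z e} with hΩ
  have hΩo : IsOpen Ω := isOpen_ball.inter (isOpen_lt continuous_const hin)
  have hΩc : Convex ℝ Ω := (convex_ball _ _).inter
    (convex_halfSpace_gt (IsLinearMap.mk (fun a b => inner_add_left a b e)
      (fun c a => real_inner_smul_left a e c)) l)
  have hσ : ∀ z ∈ Ω, planeReflection e l z ∈ ball (0 : F) R := fun z hz => by
    have h1 := norm_planeReflection_le he hl.le (le_of_lt hz.2)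
    have h2 := hz.1
    rw [mem_ball_zero_iff] at h2 ⊢
    linarith
  refine sub_pos.1 (pos_of_superharmonic (w := fun z => v (planeReflection e l z) - v z) hΩo
    hΩc.isPreconnected
    (fun z hz => (hv.laplacian_reflection he hz.1 (hσ z hz)).1) (fun z hz => ?_)
    (fun z hz => sub_nonneg.2 (hle z (ball_subset_closedBall hz.1) (le_of_lt hz.2))) ?_
    x ⟨hxb, hxl⟩)
  · rw [(hv.laplacian_reflection he hz.1 (hσ z hz)).2]
    exact sub_nonpos.2 (hmono (hle z (ball_subset_closedBall hz.1) (le_of_lt hz.2)))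
  · have hinner : ∀ t : ℝ, inner ℝ (t • e) e = t := fun t => by
      rw [real_inner_smul_left, real_inner_self_eq_norm_sq, he]; ring
    have hnorm : ∀ t : ℝ, 0 ≤ t → ‖t • e‖ = t := fun t ht => by
      rw [norm_smul, he, mul_one, Real.norm_of_nonneg ht]
    -- The strong principle needs an interior point of strict inequality; one is found on the ray of
    -- `e`, close to the pole $Re$, by continuity.
    have hReg : v (R • e) < v (planeReflection e l (R • e)) :=
      hsphere _ (by simp [hnorm R hR.le]) (by rw [hinner]; exact hlR)
    set φ : ℝ → ℝ := fun t => v (planeReflection e l (t • e)) - v (t • e) with hφ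
    have hφc : ContinuousOn φ (Icc l R) := by
      have hmaps : MapsTo (fun t : ℝ => t • e) (Icc l R) (closedBall 0 R) := fun t ht => by
        rw [mem_closedBall_zero_iff, hnorm t (hl.le.trans ht.1)]
        exact ht.2
      have hmaps2 : MapsTo (fun t : ℝ => planeReflection e l (t • e)) (Icc l R)
          (closedBall 0 R) := fun t ht => by
        have h1 := norm_planeReflection_le he hl.le (x := t • e) (by rw [hinner]; exact ht.1)
        have h2 := hmaps ht
        rw [mem_closedBall_zero_iff] at h2 ⊢
        exact h1.trans h2
      have hsm : Continuous fun t : ℝ => t • e := by fun_prop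
      exact (hv.continuousOn.comp ((continuous_planeReflection e l).comp hsm).continuousOn
        hmaps2).sub (hv.continuousOn.comp hsm.continuousOn hmaps)
    have hev : ∀ᶠ t in 𝓝[Ico l R] R, 0 < φ t :=
      ((hφc R ⟨hlR.le, le_rfl⟩).mono Ico_subset_Icc_self).eventually
        (lt_mem_nhds (sub_pos.2 hReg))
    have hbot : (𝓝[Ico l R] R).NeBot := by
      rw [← mem_closure_iff_nhdsWithin_neBot, closure_Ico hlR.ne]
      exact ⟨hlR.le, le_rfl⟩
    have hev2 : ∀ᶠ t in 𝓝[Ico l R] R, l < t :=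
      (lt_mem_nhds hlR).filter_mono nhdsWithin_le_nhds
    obtain ⟨t, h1, h2, h3⟩ := (hev.and (hev2.and self_mem_nhdsWithin)).exists
    refine ⟨t • e, ⟨?_, ?_⟩, h1⟩
    · rw [mem_ball_zero_iff, hnorm t (hl.le.trans h2.le)]
      exact h3.2
    · rw [mem_ofPred_eq, hinner]
      exact h2

/-- Away from the plane the strict inequality has a uniform gap by compactness, which survives a
small shift of the plane. The remaining strip is narrow. -/
theorem IsPoissonSolution.exists_le_reflection (hv : IsPoissonSolution f R γ v)
    (hmono : Monotone f) (hf0 : ∀ t, 0 ≤ f t) (he : ‖e‖ = 1)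
    (hpos : ∀ x ∈ ball (0 : F) R, γ < v x) {M : ℝ} (hM : 0 < M)
    (hLip : ∀ x ∈ closedBall (0 : F) R, ∀ y ∈ closedBall (0 : F) R, v x ≤ v y →
      f (v y) - f (v x) ≤ M * (v y - v x)) {l : ℝ} (hl : 0 < l)
    (hle : ∀ x ∈ closedBall (0 : F) R, l ≤ inner ℝ x e → v x ≤ v (planeReflection e l x)) :
    ∃ ε > 0, ∀ l', 0 ≤ l' → l - ε < l' → l' ≤ l →
      ∀ x ∈ closedBall (0 : F) R, l' ≤ inner ℝ x e → v x ≤ v (planeReflection e l' x) := by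
  have hlt := hv.lt_reflection hmono he hpos hl hle
  have hin : Continuous fun z : F => (inner ℝ z e : ℝ) := by fun_prop
  set δ : ℝ := 1 / (M + 1) with hδ
  have hδ0 : 0 < δ := by positivity
  have hMδ : M * δ ^ 2 < 1 := by
    rw [hδ, div_pow, one_pow, mul_one_div, div_lt_one (by positivity)]
    nlinarith
  set K : Set F := closedBall 0 R ∩ {z | l + δ / 2 ≤ inner ℝ z e} with hK
  have hKc : IsCompact K :=
    (isCompact_closedBall _ _).inter_right (isClosed_le continuous_const hin)
  have hσ : ∀ l', 0 ≤ l' → ∀ z ∈ closedBall (0 : F) R, l' ≤ inner ℝ z e →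
      planeReflection e l' z ∈ closedBall (0 : F) R := fun l' hl' z hz hz' => by
    have h1 := norm_planeReflection_le he hl' hz'
    rw [mem_closedBall_zero_iff] at hz ⊢
    linarith
  have hKl : ∀ z ∈ K, l < inner ℝ z e := fun z hz => by
    have : l + δ / 2 ≤ inner ℝ z e := hz.2
    linarith
  have hcont : ContinuousOn (fun z => v (planeReflection e l z) - v z) K :=
    (hv.continuousOn.comp (continuous_planeReflection e l).continuousOn
      fun z hz => hσ l hl.le z hz.1 (hKl z hz).le).sub (hv.continuousOn.mono inter_subset_left)
  obtain ⟨η, hη, hηK⟩ := hKc.exists_forall_le' hcont (a := 0)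
    fun z hz => sub_pos.2 (hlt z hz.1 (hKl z hz))
  have huc := (isCompact_closedBall (0 : F) R).uniformContinuousOn_of_continuous hv.continuousOn
  obtain ⟨τ, hτ, hτv⟩ := Metric.uniformContinuousOn_iff.1 huc η hη
  -- A shift below $\delta/2$ keeps points at distance $\delta$ from the new plane inside `K`;
  -- reflected points move by twice the shift, hence by less than $\tau$.
  refine ⟨min (δ / 2) (τ / 2), by positivity, fun l' hl'0 hl'1 hl'2 => ?_⟩
  have hε1 := min_le_left (δ / 2) (τ / 2)
  have hε2 := min_le_right (δ / 2) (τ / 2)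
  refine hv.le_reflection_of_narrow hf0 he hM hLip hl'0 hMδ fun x hx hxl => ?_
  have hxK : x ∈ K := ⟨hx, by change l + δ / 2 ≤ inner ℝ x e; linarith⟩
  have h1 := hηK x hxK
  have h2 : dist (planeReflection e l' x) (planeReflection e l x) < τ := by
    have : planeReflection e l' x - planeReflection e l x = (2 * (l' - l)) • e := by
      simp only [planeReflection]
      module
    rw [dist_eq_norm, this, norm_smul, he, mul_one, Real.norm_eq_abs, abs_lt]
    constructor <;> linarith
  have h3 := hτv _ (hσ l' hl'0 x hx (by linarith)) _ (hσ l hl.le x hx (hKl x hxK).le) h2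
  rw [Real.dist_eq] at h3
  have := (abs_lt.1 h3).1
  linarith

theorem IsPoissonSolution.le_reflection_zero (hv : IsPoissonSolution f R γ v) (hR : 0 < R)
    (hmono : Monotone f) (hf0 : ∀ t, 0 ≤ f t) (he : ‖e‖ = 1)
    (hpos : ∀ x ∈ ball (0 : F) R, γ < v x) {M : ℝ} (hM : 0 < M)
    (hLip : ∀ x ∈ closedBall (0 : F) R, ∀ y ∈ closedBall (0 : F) R, v x ≤ v y →
      f (v y) - f (v x) ≤ M * (v y - v x)) :
    ∀ x ∈ closedBall (0 : F) R, 0 ≤ inner ℝ x e → v x ≤ v (planeReflection e 0 x) := by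
  -- The plane moves inwards from $l=R$ to $l=0$; the parameter $t=R-l$ increases, as the continuity
  -- method on an interval requires. At $t=0$ the cap lies in the plane.
  set S : Set ℝ := {t | ∀ x ∈ closedBall (0 : F) R, R - t ≤ inner ℝ x e →
    v x ≤ v (planeReflection e (R - t) x)} with hS
  suffices h : Icc 0 R ⊆ S by
    have h1 : R ∈ S := h ⟨hR.le, le_rfl⟩
    simpa [hS] using h1
  have hσ : ∀ l', 0 ≤ l' → ∀ z ∈ closedBall (0 : F) R, l' ≤ inner ℝ z e →
      planeReflection e l' z ∈ closedBall (0 : F) R := fun l' hl' z hz hz' => by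
    have h1 := norm_planeReflection_le he hl' hz'
    rw [mem_closedBall_zero_iff] at hz ⊢
    linarith
  refine IsClosed.Icc_subset_of_forall_exists_gt ?_ ?_ ?_
  · refine isClosed_of_closure_subset fun t ht => ?_
    have htI : t ∈ Icc 0 R := by
      have := closure_mono (inter_subset_right (s := S) (t := Icc 0 R)) ht
      rwa [isClosed_Icc.closure_eq] at this
    refine ⟨fun x hx hxt => ?_, htI⟩
    rcases hxt.eq_or_lt with h | h
    · rw [planeReflection_of_inner_eq h.symm]
    have hbot := mem_closure_iff_nhdsWithin_neBot.1 ht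
    have hcont : ContinuousWithinAt (fun s => v (planeReflection e (R - s) x))
        (Icc 0 R ∩ {s | R - s ≤ inner ℝ x e}) t := by
      have hin2 : Continuous fun s : ℝ => planeReflection e (R - s) x := by
        unfold planeReflection
        fun_prop
      refine ContinuousOn.comp (t := closedBall (0 : F) R) hv.continuousOn hin2.continuousOn
        (fun s hs => hσ _ (by linarith [hs.1.2]) x hx hs.2) t ⟨htI, h.le⟩
    have hev : ∀ᶠ s in 𝓝[S ∩ Icc 0 R] t, R - s < inner ℝ x e := by
      have : ContinuousAt (fun s : ℝ => R - s) t := by fun_prop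
      exact (this.eventually (gt_mem_nhds h)).filter_mono nhdsWithin_le_nhds
    have hle : 𝓝[S ∩ Icc 0 R] t ≤ 𝓝[Icc 0 R ∩ {s | R - s ≤ inner ℝ x e}] t := by
      refine le_inf nhdsWithin_le_nhds (le_principal_iff.2 ?_)
      filter_upwards [hev, self_mem_nhdsWithin] with s hs1 hs2 using ⟨hs2.2, hs1.le⟩
    refine ge_of_tendsto (hcont.tendsto.mono_left hle) ?_
    filter_upwards [hev, self_mem_nhdsWithin] with s hs1 hs2 using hs2.1 x hx hs1.le
  · intro x hx hxl
    have h1 := (le_abs_self _).trans (abs_real_inner_le_norm x e)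
    rw [he, mul_one] at h1
    rw [mem_closedBall_zero_iff] at hx
    rw [planeReflection_of_inner_eq (by linarith)]
  · rintro t ⟨ht, ht0, htR⟩ y hy
    obtain ⟨ε, hε, h⟩ := hv.exists_le_reflection hmono hf0 he hpos hM hLip
      (sub_pos.2 htR) ht
    set s := min (t + ε / 2) (min R y) with hs
    have hy' : t < y := hy
    have hts : t < s := lt_min (by linarith) (lt_min htR hy')
    have hs1 : s ≤ t + ε / 2 := min_le_left _ _
    have hs2 : s ≤ R := (min_le_right _ _).trans (min_le_left _ _)
    have hs3 : s ≤ y := (min_le_right _ _).trans (min_le_right _ _)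
    exact ⟨s, h (R - s) (by linarith) (by linarith) (by linarith), hts, hs3⟩

/-- **Gidas–Ni–Nirenberg**: solutions in a ball with constant boundary values are radial. -/
theorem IsPoissonSolution.radial (hv : IsPoissonSolution f R γ v) (hR : 0 < R)
    (hmono : Monotone f) (hf0 : ∀ t, 0 ≤ f t)
    (hLip : ∀ A, ∃ M > 0, ∀ a b, a ≤ b → b ≤ A → f b - f a ≤ M * (b - a))
    {x y : F} (hx : x ∈ closedBall 0 R) (hxy : ‖x‖ = ‖y‖) : v x = v y := by
  rcases eq_or_ne x y with rfl | hne
  · rfl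
  have hy : y ∈ closedBall (0 : F) R := by
    rw [mem_closedBall_zero_iff] at hx ⊢
    linarith
  set e := ‖x - y‖⁻¹ • (x - y) with he
  have hn : ‖x - y‖ ≠ 0 := norm_ne_zero_iff.2 (sub_ne_zero.2 hne)
  have he1 : ‖e‖ = 1 := by
    rw [he, norm_smul, norm_inv, norm_norm, inv_mul_cancel₀ hn]
  -- Moving planes need $v>\gamma$ inside; the strong minimum principle gives this unless $v$ is
  -- constant, a trivial case.
  by_cases hcon : ∃ z ∈ ball (0 : F) R, v z ≠ γ
  swap
  · push Not at hcon
    have hall : ∀ z ∈ closedBall (0 : F) R, v z = γ := fun z hz => by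
      rcases (mem_closedBall.1 hz).lt_or_eq with h | h
      · exact hcon z h
      · exact hv.boundary z h
    rw [hall x hx, hall y hy]
  have hpos := hv.boundary_lt hf0 he1 hcon
  obtain ⟨A, hA⟩ := (isCompact_closedBall (0 : F) R).bddAbove_image hv.continuousOn
  obtain ⟨M, hM, hML⟩ := hLip A
  have hML' : ∀ x ∈ closedBall (0 : F) R, ∀ y ∈ closedBall (0 : F) R, v x ≤ v y →
      f (v y) - f (v x) ≤ M * (v y - v x) := fun x _ y hy hxy =>
    hML _ _ hxy (hA (mem_image_of_mem v hy))
  have key : ∀ a ∈ closedBall (0 : F) R, ∀ b ∈ closedBall (0 : F) R, a ≠ b → ‖a‖ = ‖b‖ →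
      v a ≤ v b := by
    intro a ha b hb hab hnab
    have hn : ‖a - b‖ ≠ 0 := norm_ne_zero_iff.2 (sub_ne_zero.2 hab)
    have h1 : inner ℝ a (a - b) = ‖a - b‖ ^ 2 / 2 := by
      rw [norm_sub_sq_real, inner_sub_right, real_inner_self_eq_norm_sq, ← hnab]
      ring
    have h2 := hv.le_reflection_zero hR hmono hf0 (e := ‖a - b‖⁻¹ • (a - b))
      (by rw [norm_smul, norm_inv, norm_norm, inv_mul_cancel₀ hn]) hpos hM hML' a ha
      (by rw [inner_smul_right, h1]; positivity)
    rwa [planeReflection_of_norm_eq hab hnab] at h2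
  exact le_antisymm (key x hx y hy hne hxy) (key y hy x hx hne.symm hxy.symm)

end MovingPlanes

/-! ### Uniqueness for the singular radial equation. -/

section RadialUniqueness

open Filter Topology

/-- Both $B-P$ and $B+P$ are nondecreasing. Derivatives are needed only in the open interval, so the
singular endpoint $0$ is harmless. -/
theorem abs_le_of_abs_deriv_le {P P' B B' : ℝ → ℝ} {s : ℝ} (hs : 0 ≤ s)
    (hPc : ContinuousOn P (Icc 0 s)) (hBc : ContinuousOn B (Icc 0 s))
    (hP : ∀ t ∈ Ioo 0 s, HasDerivAt P (P' t) t) (hB : ∀ t ∈ Ioo 0 s, HasDerivAt B (B' t) t)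
    (hle : ∀ t ∈ Ioo 0 s, |P' t| ≤ B' t) (hP0 : P 0 = 0) (hB0 : B 0 = 0) : |P s| ≤ B s := by
  have hmem0 : (0 : ℝ) ∈ Icc 0 s := ⟨le_rfl, hs⟩
  have hmems : s ∈ Icc 0 s := ⟨hs, le_rfl⟩
  have h1 : MonotoneOn (fun t => B t - P t) (Icc 0 s) := by
    refine monotoneOn_of_deriv_nonneg (convex_Icc 0 s) (hBc.sub hPc) ?_ ?_
    · rw [interior_Icc]
      exact fun t ht => ((hB t ht).sub (hP t ht)).differentiableAt.differentiableWithinAt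
    · rw [interior_Icc]
      intro t ht
      have h := ((hB t ht).sub (hP t ht)).deriv
      have h' : deriv (fun t => B t - P t) t = _ := h
      rw [h']
      linarith [le_abs_self (P' t), hle t ht]
  have h2 : MonotoneOn (fun t => B t + P t) (Icc 0 s) := by
    refine monotoneOn_of_deriv_nonneg (convex_Icc 0 s) (hBc.add hPc) ?_ ?_
    · rw [interior_Icc]
      exact fun t ht => ((hB t ht).add (hP t ht)).differentiableAt.differentiableWithinAt
    · rw [interior_Icc]
      intro t ht
      have h := ((hB t ht).add (hP t ht)).deriv
      have h' : deriv (fun t => B t + P t) t = _ := h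
      rw [h']
      linarith [neg_abs_le (P' t), hle t ht]
  have h3 := h1 hmem0 hmems hs
  have h4 := h2 hmem0 hmems hs
  simp only [hP0, hB0] at h3 h4
  rw [abs_le]
  constructor <;> linarith

/-- Uniqueness for the initial value problem `(t ^ n φ')' = t ^ n c(t) φ`, `φ(0) = 0`, where `c` is
bounded and `P` stands for `t ^ n φ'`. -/
theorem eq_zero_of_singular_ode {φ P P' : ℝ → ℝ} {n : ℕ} {T K : ℝ} (hK : 0 ≤ K)
    (hφc : ContinuousOn φ (Icc 0 T)) (hPc : ContinuousOn P (Icc 0 T)) (hφ0 : φ 0 = 0)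
    (hP0 : P 0 = 0) (hφ : ∀ t ∈ Ioo 0 T, HasDerivAt φ (P t / t ^ n) t)
    (hP : ∀ t ∈ Ioo 0 T, HasDerivAt P (P' t) t)
    (hle : ∀ t ∈ Ioo 0 T, |P' t| ≤ K * t ^ n * |φ t|) : ∀ t ∈ Icc 0 T, φ t = 0 := by
  intro t0 ht0
  have hT : 0 ≤ T := ht0.1.trans ht0.2
  -- Let $C$ be the maximum of $|\varphi|e^{-Lt}$. Two integrations give
  -- $|\varphi(s)|\le\frac{KCT}{L}(e^{Ls}-1)$ at the maximum point, so $LC\le KTC$; any $L>KT$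
  -- forces $C=0$.
  set L : ℝ := 2 * K * T + 1 with hL
  have hL0 : 0 < L := by positivity
  have hec : Continuous fun t : ℝ => Real.exp (-(L * t)) := by fun_prop
  obtain ⟨s, hs, hmax⟩ := isCompact_Icc.exists_isMaxOn (s := Icc 0 T) ⟨t0, ht0⟩
    (hφc.abs.mul hec.continuousOn)
  set C := |φ s| * Real.exp (-(L * s)) with hC
  have hC0 : 0 ≤ C := by positivity
  have hbound : ∀ t ∈ Icc 0 T, |φ t| ≤ C * Real.exp (L * t) := fun t ht => by
    have h : |φ t| * Real.exp (-(L * t)) ≤ C := hmax ht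
    calc |φ t| = |φ t| * Real.exp (-(L * t)) * Real.exp (L * t) := by
          rw [mul_assoc, ← Real.exp_add]; simp
      _ ≤ C * Real.exp (L * t) := by gcongr
  have hPb : ∀ t ∈ Icc 0 T, |P t| ≤ K * C * Real.exp (L * t) * t ^ (n + 1) := by
    intro t ht
    have hsub : Icc 0 t ⊆ Icc 0 T := Icc_subset_Icc_right ht.2
    have hsub' : Ioo 0 t ⊆ Ioo 0 T := Ioo_subset_Ioo_right ht.2
    have hB : ∀ r : ℝ, HasDerivAt (fun r : ℝ => K * C * Real.exp (L * t) * r ^ (n + 1))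
        (K * C * Real.exp (L * t) * (((n + 1 : ℕ) : ℝ) * r ^ n)) r := fun r => by
      simpa using (hasDerivAt_pow (n + 1) r).const_mul (K * C * Real.exp (L * t))
    refine abs_le_of_abs_deriv_le ht.1 (hPc.mono hsub)
      (fun r _ => (hB r).continuousAt.continuousWithinAt) (fun r hr => hP r (hsub' hr))
      (fun r _ => hB r) (fun r hr => ?_) hP0 (by simp)
    have hr0 : 0 ≤ r := hr.1.le
    calc |P' r| ≤ K * r ^ n * |φ r| := hle r (hsub' hr)
      _ ≤ K * r ^ n * (C * Real.exp (L * t)) := by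
          have h1 := hbound r (Ioo_subset_Icc_self (hsub' hr))
          have h2 : Real.exp (L * r) ≤ Real.exp (L * t) := by
            rw [Real.exp_le_exp]
            exact mul_le_mul_of_nonneg_left hr.2.le hL0.le
          have h3 : |φ r| ≤ C * Real.exp (L * t) := h1.trans (by gcongr)
          gcongr
      _ = K * C * Real.exp (L * t) * (1 * r ^ n) := by ring
      _ ≤ _ := by
          have : (1 : ℝ) ≤ ((n + 1 : ℕ) : ℝ) := by
            exact_mod_cast Nat.succ_le_succ (Nat.zero_le n)
          gcongr
  have hB2 : ∀ r : ℝ, HasDerivAt (fun r : ℝ => K * C * T / L * (Real.exp (L * r) - 1))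
      (K * C * T * Real.exp (L * r)) r := fun r => by
    have h := ((((hasDerivAt_id' r).const_mul L).exp).sub_const 1).const_mul (K * C * T / L)
    refine h.congr_deriv ?_
    field_simp
  have hsub : Icc 0 s ⊆ Icc 0 T := Icc_subset_Icc_right hs.2
  have hsub' : Ioo 0 s ⊆ Ioo 0 T := Ioo_subset_Ioo_right hs.2
  have hfin : |φ s| ≤ K * C * T / L * (Real.exp (L * s) - 1) := by
    refine abs_le_of_abs_deriv_le hs.1 (hφc.mono hsub)
      (fun r _ => (hB2 r).continuousAt.continuousWithinAt) (fun r hr => hφ r (hsub' hr))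
      (fun r _ => hB2 r) (fun r hr => ?_) hφ0 (by simp)
    have hr0 : 0 < r := hr.1
    have hrT : r ≤ T := (hsub' hr).2.le
    have h1 := hPb r (Ioo_subset_Icc_self (hsub' hr))
    rw [abs_div, abs_of_pos (pow_pos hr0 n), div_le_iff₀ (pow_pos hr0 n)]
    calc |P r| ≤ K * C * Real.exp (L * r) * r ^ (n + 1) := h1
      _ = K * C * r * Real.exp (L * r) * r ^ n := by ring
      _ ≤ K * C * T * Real.exp (L * r) * r ^ n := by gcongr
  have hφs : |φ s| = C * Real.exp (L * s) := by
    rw [hC, mul_assoc, ← Real.exp_add]; simp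
  have hCz : C = 0 := by
    have h1 : C * Real.exp (L * s) ≤ K * C * T / L * Real.exp (L * s) := by
      rw [← hφs]
      refine hfin.trans ?_
      gcongr
      linarith
    have h2 : C ≤ K * C * T / L := le_of_mul_le_mul_right h1 (Real.exp_pos _)
    rw [le_div_iff₀ hL0, hL] at h2
    nlinarith [mul_nonneg (mul_nonneg hK hC0) hT]
  have := hbound t0 ht0
  rw [hCz, zero_mul] at this
  exact abs_nonpos_iff.1 this

variable {F : Type*} [NormedAddCommGroup F] [InnerProductSpace ℝ F] [FiniteDimensional ℝ F]

/-- A radial `C²` function `w` with `|Δ w| ≤ K |w|` which vanishes at the centre vanishes. -/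
theorem eq_zero_of_radial {w : F → ℝ} {R T K : ℝ} (hdim : 2 ≤ Module.finrank ℝ F)
    (hd : ∀ x ∈ ball 0 R, ContDiffAt ℝ 2 w x)
    (hrad : ∀ x ∈ ball (0 : F) R, ∀ y, ‖x‖ = ‖y‖ → w x = w y) (hTR : T < R)
    (hK : 0 ≤ K) (hΔ : ∀ x, ‖x‖ ≤ T → |Laplacian.laplacian w x| ≤ K * |w x|) (h0 : w 0 = 0)
    {x : F} (hx : ‖x‖ ≤ T) : w x = 0 := by
  have : Nontrivial F := Module.nontrivial_of_finrank_pos (R := ℝ) (by omega)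
  obtain ⟨e, he⟩ := exists_norm_eq F zero_le_one
  have hnorm : ∀ t : ℝ, ‖t • e‖ = |t| := fun t => by rw [norm_smul, he, mul_one, Real.norm_eq_abs]
  have hball : ∀ t : ℝ, |t| < R → t • e ∈ ball (0 : F) R := fun t ht => by
    rwa [mem_ball_zero_iff, hnorm]
  set φ : ℝ → ℝ := fun t => w (t • e) with hφ
  have hsm : ContDiff ℝ 2 fun t : ℝ => t • e := contDiff_id.smul contDiff_const
  have hφs : ∀ t : ℝ, |t| < R → ContDiffAt ℝ 2 φ t := fun t ht =>
    ContDiffAt.comp (f := fun t : ℝ => t • e) t (hd _ (hball t ht)) hsm.contDiffAt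
  have hφ's : ∀ t : ℝ, |t| < R → ContDiffAt ℝ 1 (deriv φ) t := fun t ht =>
    ((hφs t ht).fderiv_right (m := 1) (by norm_num)).clm_apply contDiffAt_const
  -- This writes $w=W(|x|^2)$. As `W` is smooth only for $\tau>0$, the equation
  -- $(t^{N-1}\varphi')'=t^{N-1}\Delta w$ is derived for $t>0$ only.
  set W : ℝ → ℝ := fun τ => φ (√τ) with hW
  have hWs : ∀ t, 0 < t → t < R → ContDiffAt ℝ 2 W (t ^ 2) := fun t ht htR => by
    have hsq : √(t ^ 2) = t := Real.sqrt_sq ht.le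
    refine ContDiffAt.comp (g := φ) (f := Real.sqrt) (t ^ 2) ?_
      (Real.contDiffAt_sqrt (by positivity))
    rw [hsq]
    exact hφs t (by rwa [abs_of_pos ht])
  have hφW : ∀ t, 0 < t → t < R → HasDerivAt φ (2 * t * deriv W (t ^ 2)) t := fun t ht htR => by
    have h1 := HasDerivAt.comp (h := fun s : ℝ => s ^ 2) t
      ((hWs t ht htR).differentiableAt (by simp)).hasDerivAt (hasDerivAt_pow 2 t)
    have h2 : φ =ᶠ[𝓝 t] W ∘ fun t => t ^ 2 := by
      filter_upwards [lt_mem_nhds ht] with s hs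
      simp [hW, Real.sqrt_sq hs.le]
    refine (h1.congr_of_eventuallyEq h2).congr_deriv ?_
    simp
    ring
  set N := Module.finrank ℝ F with hN
  set P : ℝ → ℝ := fun t => t ^ (N - 1) * deriv φ t with hP
  have hpow : ∀ t : ℝ, t ^ (N - 1) * t = t ^ N := fun t => by
    rw [← pow_succ]
    congr 1
    omega
  have hPd : ∀ t, 0 < t → t < R →
      HasDerivAt P (t ^ (N - 1) * Laplacian.laplacian w (t • e)) t := fun t ht htR => by
    have h1 : P =ᶠ[𝓝 t] fun t => 2 * (t ^ N * deriv W (t ^ 2)) := by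
      filter_upwards [Ioo_mem_nhds ht htR] with s hs
      rw [hP]
      simp only
      rw [(hφW s hs.1 hs.2).deriv, ← hpow]
      ring
    have hW1 : ContDiffAt ℝ 1 (deriv W) (t ^ 2) :=
      ((hWs t ht htR).fderiv_right (m := 1) (by norm_num)).clm_apply contDiffAt_const
    have h2 := HasDerivAt.comp (h := fun s : ℝ => s ^ 2) t
      (hW1.differentiableAt (by simp)).hasDerivAt (hasDerivAt_pow 2 t)
    have h3 := ((hasDerivAt_pow N t).mul h2).const_mul 2
    have h4 : Laplacian.laplacian w (t • e)
        = Laplacian.laplacian (fun z : F => W (‖z‖ ^ 2)) (t • e) := by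
      refine (InnerProductSpace.laplacian_congr_nhds ?_).eq_of_nhds
      filter_upwards [isOpen_ball.mem_nhds (hball t (by rwa [abs_of_pos ht]))] with z hz
      simp only [hW, hφ, Real.sqrt_sq (norm_nonneg z)]
      exact hrad z hz _ (by simp [hnorm])
    have h5 : ‖t • e‖ ^ 2 = t ^ 2 := by rw [hnorm, sq_abs]
    rw [h4, laplacian_comp_norm_sq _ (by rw [h5]; exact hWs t ht htR), h5, ← hN]
    refine (h3.congr_of_eventuallyEq h1).congr_deriv ?_
    simp only [Function.comp_apply, Nat.cast_ofNat, Nat.add_one_sub_one, pow_one, ← hpow t]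
    ring
  have hT0 : 0 ≤ T := (norm_nonneg x).trans hx
  have habs : ∀ t ∈ Icc 0 T, |t| < R := fun t ht => by
    rw [abs_of_nonneg ht.1]
    exact ht.2.trans_lt hTR
  have key := eq_zero_of_singular_ode (φ := φ) (P := P)
    (P' := fun t => t ^ (N - 1) * Laplacian.laplacian w (t • e)) (n := N - 1) (T := T) hK
    (fun t ht => (hφs t (habs t ht)).continuousAt.continuousWithinAt)
    (fun t ht => ((continuousAt_id.pow (N - 1)).mul
      (hφ's t (habs t ht)).continuousAt).continuousWithinAt)
    (by simp [hφ, h0]) (by simp [hP, show N - 1 ≠ 0 by omega])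
    (fun t ht => by
      have h1 := ((hφs t (habs t (Ioo_subset_Icc_self ht))).differentiableAt (by simp)).hasDerivAt
      refine h1.congr_deriv ?_
      rw [hP]
      have := (pow_pos ht.1 (N - 1)).ne'
      field_simp)
    (fun t ht => hPd t ht.1 (ht.2.trans hTR))
    (fun t ht => by
      have h1 := hΔ (t • e) (by rw [hnorm, abs_of_pos ht.1]; exact ht.2.le)
      rw [abs_mul, abs_of_pos (pow_pos ht.1 _)]
      calc t ^ (N - 1) * |Laplacian.laplacian w (t • e)|
          ≤ t ^ (N - 1) * (K * |w (t • e)|) :=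
            mul_le_mul_of_nonneg_left h1 (pow_pos ht.1 _).le
        _ = K * t ^ (N - 1) * |φ t| := by rw [hφ]; ring)
    ‖x‖ ⟨norm_nonneg x, hx⟩
  rw [← key]
  exact hrad x (by rw [mem_ball_zero_iff]; linarith) _ (by simp [hnorm])

end RadialUniqueness

/-! ### The integral equation for the profile, by contraction. -/

section ProfileExistence

open Filter Topology intervalIntegral
open scoped BoundedContinuousFunction

/-- The average `∫₀¹ s ^ n h(s² τ) ds`. -/
noncomputable def sqAverage (n : ℕ) (h : ℝ → ℝ) (τ : ℝ) : ℝ :=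
  ∫ s in (0 : ℝ)..1, s ^ n * h (s ^ 2 * τ)

theorem continuous_sqAverage (n : ℕ) {h : ℝ → ℝ} (hh : Continuous h) :
    Continuous (sqAverage n h) := by
  unfold sqAverage
  refine intervalIntegral.continuous_parametric_intervalIntegral_of_continuous' ?_ 0 1
  simp only [Function.uncurry_def]
  fun_prop

theorem sqAverage_sub (n : ℕ) {h k : ℝ → ℝ} (hh : Continuous h) (hk : Continuous k) (τ : ℝ) :
    sqAverage n (fun t => h t - k t) τ = sqAverage n h τ - sqAverage n k τ := by
  unfold sqAverage
  rw [← intervalIntegral.integral_sub]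
  · congr 1
    funext s
    ring
  · exact Continuous.intervalIntegrable (by fun_prop) _ _
  · exact Continuous.intervalIntegrable (by fun_prop) _ _

theorem abs_sqAverage_le (n : ℕ) {h : ℝ → ℝ} {τ C : ℝ}
    (hC : ∀ t, |t| ≤ |τ| → |h t| ≤ C) : |sqAverage n h τ| ≤ C := by
  have hC0 : 0 ≤ C := (abs_nonneg _).trans (hC τ le_rfl)
  have := intervalIntegral.norm_integral_le_of_norm_le_const (a := 0) (b := 1) (C := C)
    (f := fun s => s ^ n * h (s ^ 2 * τ)) fun s hs => by
      rw [uIoc_of_le zero_le_one] at hs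
      have h1 : s ^ n ≤ 1 := pow_le_one₀ hs.1.le hs.2
      have h2 : |h (s ^ 2 * τ)| ≤ C := hC _ (by
        rw [abs_mul, abs_of_nonneg (sq_nonneg s)]
        have : s ^ 2 ≤ 1 := pow_le_one₀ hs.1.le hs.2
        nlinarith [abs_nonneg τ])
      rw [Real.norm_eq_abs, abs_mul, abs_of_nonneg (pow_nonneg hs.1.le n)]
      calc s ^ n * |h (s ^ 2 * τ)| ≤ 1 * C := by gcongr
        _ = C := one_mul C
  simpa [sqAverage] using this

/-- Exponential growth bounds are preserved by the iterated integral. -/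
theorem abs_integral_sqAverage_le (n : ℕ) {h : ℝ → ℝ} {L C : ℝ} (hL : 0 < L)
    (hC : ∀ t, |h t| ≤ C * Real.exp (L * |t|)) (τ : ℝ) :
    |∫ σ in (0 : ℝ)..τ, sqAverage n h σ| ≤ C / L * Real.exp (L * |τ|) := by
  have hC0 : 0 ≤ C := by
    have := (abs_nonneg _).trans (hC 0)
    simpa using this
  have hb : ∀ σ, |sqAverage n h σ| ≤ C * Real.exp (L * |σ|) := fun σ =>
    abs_sqAverage_le n fun t ht => (hC t).trans (by gcongr)
  -- Substituting $\sigma=u\tau$ treats both signs of $\tau$ at once.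
  have hsub : (∫ σ in (0 : ℝ)..τ, sqAverage n h σ)
      = τ * ∫ u in (0 : ℝ)..1, sqAverage n h (u * τ) := by
    have := intervalIntegral.smul_integral_comp_mul_right (a := 0) (b := 1) (sqAverage n h) τ
    simp only [zero_mul, one_mul, smul_eq_mul] at this
    exact this.symm
  have hcont : Continuous fun u : ℝ => C * |τ| * Real.exp (L * |τ| * u) := by fun_prop
  have hint : ∫ u in (0 : ℝ)..1, C * |τ| * Real.exp (L * |τ| * u)
      = C / L * (Real.exp (L * |τ|) - 1) := by
    have hd : ∀ u : ℝ, HasDerivAt (fun u : ℝ => C / L * Real.exp (L * |τ| * u))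
        (C * |τ| * Real.exp (L * |τ| * u)) u := fun u => by
      have h := (((hasDerivAt_id' u).const_mul (L * |τ|)).exp).const_mul (C / L)
      refine h.congr_deriv ?_
      field_simp
    rw [intervalIntegral.integral_eq_sub_of_hasDerivAt (fun u _ => hd u)
      (hcont.intervalIntegrable _ _)]
    simp
    ring
  have hle : ‖∫ u in (0 : ℝ)..1, τ * sqAverage n h (u * τ)‖
      ≤ ∫ u in (0 : ℝ)..1, C * |τ| * Real.exp (L * |τ| * u) := by
    refine intervalIntegral.norm_integral_le_of_norm_le zero_le_one ?_
      (hcont.intervalIntegrable _ _)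
    refine Filter.Eventually.of_forall fun u hu => ?_
    have h1 := hb (u * τ)
    rw [abs_mul, abs_of_pos hu.1] at h1
    rw [Real.norm_eq_abs, abs_mul]
    calc |τ| * |sqAverage n h (u * τ)| ≤ |τ| * (C * Real.exp (L * (u * |τ|))) := by gcongr
      _ = C * |τ| * Real.exp (L * |τ| * u) := by ring_nf
  rw [hsub, ← intervalIntegral.integral_const_mul, ← Real.norm_eq_abs]
  refine hle.trans ?_
  rw [hint]
  have : 0 ≤ C / L := by positivity
  nlinarith

/-- Solvability of `Y' = -½ ∫₀¹ s ^ n g(Y(s² τ)) ds`, `Y(0) = 1`, for Lipschitz `g`. -/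
theorem exists_hasDerivAt_sqAverage (n : ℕ) {g : ℝ → ℝ} {K : ℝ} (hK : 0 < K)
    (hg : ∀ a b, |g a - g b| ≤ K * |a - b|) (hg0 : g 0 = 0) :
    ∃ Y : ℝ → ℝ, Y 0 = 1 ∧
      ∀ τ, HasDerivAt Y (-(1 / 2) * sqAverage n (fun t => g (Y t)) τ) τ := by
  have hgc : Continuous g := by
    refine (LipschitzWith.of_dist_le_mul (K := ⟨K, hK.le⟩) fun a b => ?_).continuous
    rw [Real.dist_eq, Real.dist_eq]
    exact hg a b
  -- Solutions are sought as $e^{K|\tau|}Z$ with `Z` bounded. With this weight the integral gains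
  -- $1/K$, which cancels the Lipschitz constant; the prefactor $\frac12$ is then the contraction
  -- constant, on the whole line.
  set wt : (ℝ → ℝ) → ℝ → ℝ := fun Z t => Real.exp (K * |t|) * Z t with hwt
  have hwc : ∀ Z : ℝ → ℝ, Continuous Z → Continuous (wt Z) := fun Z hZ => by
    simp only [hwt]; fun_prop
  set op : (ℝ → ℝ) → ℝ → ℝ := fun Y τ =>
    1 - 1 / 2 * ∫ σ in (0 : ℝ)..τ, sqAverage n (fun t => g (Y t)) σ with hop
  have hopd : ∀ Y : ℝ → ℝ, Continuous Y → ∀ τ,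
      HasDerivAt (op Y) (-(1 / 2) * sqAverage n (fun t => g (Y t)) τ) τ := fun Y hY τ => by
    have hc := continuous_sqAverage n (hgc.comp hY)
    have h := ((hc.integral_hasStrictDerivAt 0 τ).hasDerivAt.const_mul (1 / 2)).const_sub 1
    exact h.congr_deriv (by simp [Function.comp_def])
  have hopc : ∀ Y : ℝ → ℝ, Continuous Y → Continuous (op Y) := fun Y hY =>
    continuous_iff_continuousAt.2 fun τ => (hopd Y hY τ).continuousAt
  have hexp : ∀ τ : ℝ, 0 < Real.exp (K * |τ|) := fun τ => Real.exp_pos _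
  have hwb : ∀ Z : ℝ →ᵇ ℝ, ∀ τ, |wt Z τ| ≤ ‖Z‖ * Real.exp (K * |τ|) := fun Z τ => by
    rw [hwt]
    simp only
    rw [abs_mul, abs_of_pos (hexp τ), mul_comm]
    exact mul_le_mul_of_nonneg_right (Z.norm_coe_le_norm τ) (hexp τ).le
  have hcont : ∀ Z : ℝ →ᵇ ℝ, Continuous fun τ => Real.exp (-(K * |τ|)) * op (wt Z) τ := fun Z => by
    have := hopc _ (hwc Z Z.continuous)
    fun_prop
  have hbd : ∀ Z : ℝ →ᵇ ℝ, ∀ τ, ‖Real.exp (-(K * |τ|)) * op (wt Z) τ‖ ≤ 1 + 1 / 2 * ‖Z‖ := by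
    intro Z τ
    have h1 := abs_integral_sqAverage_le n (h := g ∘ wt Z) (L := K)
      (C := K * ‖Z‖) hK (fun t => by
        have h2 := hg (wt Z t) 0
        rw [hg0, sub_zero, sub_zero] at h2
        calc |(g ∘ wt Z) t| ≤ K * |wt Z t| := h2
          _ ≤ K * (‖Z‖ * Real.exp (K * |t|)) := by gcongr; exact hwb Z t
          _ = K * ‖Z‖ * Real.exp (K * |t|) := by ring) τ
    rw [mul_div_cancel_left₀ _ hK.ne'] at h1
    have h3 : |op (wt Z) τ| ≤ Real.exp (K * |τ|) * (1 + 1 / 2 * ‖Z‖) := by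
      have h4 : (1 : ℝ) ≤ Real.exp (K * |τ|) := Real.one_le_exp (by positivity)
      calc |op (wt Z) τ| ≤ |1| + |1 / 2 * ∫ σ in (0 : ℝ)..τ, sqAverage n (g ∘ wt Z) σ| :=
            abs_sub _ _
        _ ≤ 1 + 1 / 2 * (‖Z‖ * Real.exp (K * |τ|)) := by
            rw [abs_mul, abs_one, abs_of_pos (by norm_num : (0 : ℝ) < 1 / 2)]
            gcongr
        _ ≤ _ := by linarith
    rw [norm_mul, Real.norm_eq_abs, Real.norm_eq_abs, Real.abs_exp]
    calc Real.exp (-(K * |τ|)) * |op (wt Z) τ|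
        ≤ Real.exp (-(K * |τ|)) * (Real.exp (K * |τ|) * (1 + 1 / 2 * ‖Z‖)) := by gcongr
      _ = 1 + 1 / 2 * ‖Z‖ := by
          rw [← mul_assoc, ← Real.exp_add]; simp
  set T : (ℝ →ᵇ ℝ) → (ℝ →ᵇ ℝ) := fun Z =>
    BoundedContinuousFunction.ofNormedAddCommGroup _ (hcont Z) _ (hbd Z) with hT
  have hTapp : ∀ Z τ, T Z τ = Real.exp (-(K * |τ|)) * op (wt Z) τ := fun Z τ => rfl
  have hcontr : ContractingWith (1 / 2) T := by
    refine ⟨by norm_num, LipschitzWith.of_dist_le_mul fun Z V => ?_⟩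
    rw [BoundedContinuousFunction.dist_le (by positivity)]
    intro τ
    have hcZ := hgc.comp (hwc Z Z.continuous)
    have hcV := hgc.comp (hwc V V.continuous)
    have h1 := abs_integral_sqAverage_le n (h := fun t => (g ∘ wt Z) t - (g ∘ wt V) t)
      (L := K) (C := K * dist Z V) hK
      (fun t => by
        calc |g (wt Z t) - g (wt V t)| ≤ K * |wt Z t - wt V t| := hg _ _
          _ = K * (Real.exp (K * |t|) * |Z t - V t|) := by
              rw [hwt]
              simp only
              rw [← mul_sub, abs_mul, abs_of_pos (hexp t)]
          _ ≤ K * (Real.exp (K * |t|) * dist Z V) := by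
              have := BoundedContinuousFunction.dist_coe_le_dist (f := Z) (g := V) t
              rw [Real.dist_eq] at this
              have := (hexp t).le
              gcongr
          _ = K * dist Z V * Real.exp (K * |t|) := by ring) τ
    rw [mul_div_cancel_left₀ _ hK.ne'] at h1
    have h2 : (∫ σ in (0 : ℝ)..τ, sqAverage n (fun t => (g ∘ wt Z) t - (g ∘ wt V) t) σ)
        = (∫ σ in (0 : ℝ)..τ, sqAverage n (g ∘ wt Z) σ)
          - ∫ σ in (0 : ℝ)..τ, sqAverage n (g ∘ wt V) σ := by
      rw [← intervalIntegral.integral_sub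
        ((continuous_sqAverage n hcZ).intervalIntegrable _ _)
        ((continuous_sqAverage n hcV).intervalIntegrable _ _)]
      congr 1
      funext σ
      exact sqAverage_sub n hcZ hcV σ
    rw [h2] at h1
    rw [Real.dist_eq, hTapp, hTapp, ← mul_sub, abs_mul, Real.abs_exp]
    have h3 : op (wt Z) τ - op (wt V) τ = -(1 / 2 * ((∫ σ in (0 : ℝ)..τ, sqAverage n (g ∘ wt Z) σ)
          - ∫ σ in (0 : ℝ)..τ, sqAverage n (g ∘ wt V) σ)) := by
      simp only [hop, Function.comp_def]
      ring
    rw [h3, abs_neg, abs_mul, abs_of_pos (by norm_num : (0 : ℝ) < 1 / 2)]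
    calc _ ≤ Real.exp (-(K * |τ|)) * (1 / 2 * (dist Z V * Real.exp (K * |τ|))) := by gcongr
      _ = 1 / 2 * dist Z V * (Real.exp (-(K * |τ|)) * Real.exp (K * |τ|)) := by ring
      _ = ((1 / 2 : ℝ≥0) : ℝ) * dist Z V := by rw [← Real.exp_add]; simp
  set Z := hcontr.fixedPoint with hZ
  have hfix : T Z = Z := hcontr.fixedPoint_isFixedPt
  have hY : op (wt Z) = wt Z := by
    funext τ
    have h1 : Real.exp (-(K * |τ|)) * op (wt Z) τ = Z τ := by rw [← hTapp, hfix]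
    have h2 : wt Z τ = Real.exp (K * |τ|) * Z τ := rfl
    rw [h2, ← h1, ← mul_assoc, ← Real.exp_add]
    simp
  refine ⟨wt Z, ?_, fun τ => ?_⟩
  · rw [← hY]
    simp [hop]
  · have := hopd (wt Z) (hwc Z Z.continuous) τ
    rwa [hY] at this

end ProfileExistence

/-! ### Smoothness of averages, the nonlinearity, and the profile. -/

section ProfileRegularity

open Filter Topology intervalIntegral

theorem sq_mul_mem_Ioo {a b τ s : ℝ} (ha : a < 0) (hb : 0 < b) (hτ : τ ∈ Ioo a b)
    (hs : s ∈ Icc (0 : ℝ) 1) : s ^ 2 * τ ∈ Ioo a b := by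
  have h0 : 0 ≤ s ^ 2 := sq_nonneg s
  have h1 : s ^ 2 ≤ 1 := pow_le_one₀ hs.1 hs.2
  constructor
  · rcases le_total 0 τ with h | h
    · exact ha.trans_le (mul_nonneg h0 h)
    · nlinarith [hτ.1]
  · rcases le_total 0 τ with h | h
    · nlinarith [hτ.2]
    · exact (mul_nonpos_of_nonneg_of_nonpos h0 h).trans_lt hb

theorem continuousOn_sqAverage_integrand (n : ℕ) {h : ℝ → ℝ} {a b τ : ℝ} (ha : a < 0) (hb : 0 < b)
    (hh : ContinuousOn h (Ioo a b)) (hτ : τ ∈ Ioo a b) :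
    ContinuousOn (fun s : ℝ => s ^ n * h (s ^ 2 * τ)) (uIcc 0 1) := by
  rw [uIcc_of_le zero_le_one]
  refine (continuous_pow n).continuousOn.mul (hh.comp ?_ fun s hs => sq_mul_mem_Ioo ha hb hτ hs)
  fun_prop

/-- An interval around $0$ contains $s^2\tau$ whenever it contains $\tau$, so averaging is local
there; this permits truncations. -/
theorem sqAverage_congr (n : ℕ) {h k : ℝ → ℝ} {a b τ : ℝ} (ha : a < 0) (hb : 0 < b)
    (hhk : EqOn h k (Ioo a b)) (hτ : τ ∈ Ioo a b) : sqAverage n h τ = sqAverage n k τ := by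
  refine intervalIntegral.integral_congr fun s hs => ?_
  rw [uIcc_of_le zero_le_one] at hs
  rw [hhk (sq_mul_mem_Ioo ha hb hτ hs)]

theorem exists_Ioo_between {a b τ : ℝ} (ha : a < 0) (hb : 0 < b) (hτ : τ ∈ Ioo a b) :
    ∃ a' b', a < a' ∧ a' < 0 ∧ 0 < b' ∧ b' < b ∧ τ ∈ Ioo a' b' := by
  obtain ⟨a', h1, h2⟩ := exists_between (lt_min ha hτ.1)
  obtain ⟨b', h3, h4⟩ := exists_between (max_lt hb hτ.2)
  exact ⟨a', b', h1, h2.trans_le (min_le_left _ _), (le_max_left _ _).trans_lt h3, h4,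
    h2.trans_le (min_le_right _ _), (le_max_right _ _).trans_lt h3⟩

theorem continuousOn_sqAverage (n : ℕ) {h : ℝ → ℝ} {a b : ℝ} (ha : a < 0) (hb : 0 < b)
    (hh : ContinuousOn h (Ioo a b)) : ContinuousOn (sqAverage n h) (Ioo a b) := by
  intro τ hτ
  obtain ⟨a', b', h1, h2, h3, h4, h5⟩ := exists_Ioo_between ha hb hτ
  have hab : a' ≤ b' := (h2.trans h3).le
  -- Clamping the argument reduces to a globally continuous function with the same averages near
  -- $\tau$.
  have hk : Continuous fun t => h (max a' (min t b')) := by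
    refine hh.comp_continuous (by fun_prop) fun t => ⟨h1.trans_le (le_max_left _ _), ?_⟩
    exact (max_le hab (min_le_right _ _)).trans_lt h4
  have hE : EqOn h (fun t => h (max a' (min t b'))) (Ioo a' b') := fun t ht => by
    simp only
    rw [min_eq_left ht.2.le, max_eq_right ht.1.le]
  have hev : sqAverage n h =ᶠ[𝓝 τ] sqAverage n fun t => h (max a' (min t b')) := by
    filter_upwards [Ioo_mem_nhds h5.1 h5.2] with t ht using sqAverage_congr n h2 h3 hE ht
  exact ((continuous_sqAverage n hk).continuousAt.congr hev.symm).continuousWithinAt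

theorem hasDerivAt_sqAverage (n : ℕ) {h h' : ℝ → ℝ} {a b : ℝ} (ha : a < 0) (hb : 0 < b)
    (hh : ∀ t ∈ Ioo a b, HasDerivAt h (h' t) t) (hh' : ContinuousOn h' (Ioo a b)) {τ : ℝ}
    (hτ : τ ∈ Ioo a b) : HasDerivAt (sqAverage n h) (sqAverage (n + 2) h' τ) τ := by
  obtain ⟨a', b', h1, h2, h3, h4, h5⟩ := exists_Ioo_between ha hb hτ
  have hsub : Ioo a' b' ⊆ Ioo a b := Ioo_subset_Ioo h1.le h4.le
  have hcont : ContinuousOn h (Ioo a b) := fun t ht => (hh t ht).continuousAt.continuousWithinAt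
  obtain ⟨C, hC⟩ := isCompact_Icc.exists_bound_of_continuousOn
    (hh'.mono (Icc_subset_Ioo (a₁ := a') (b₁ := b') h1 h4))
  refine (intervalIntegral.hasDerivAt_integral_of_dominated_loc_of_deriv_le
    (F := fun x s => s ^ n * h (s ^ 2 * x)) (F' := fun x s => s ^ (n + 2) * h' (s ^ 2 * x))
    (s := Ioo a' b') (bound := fun _ => C) (Ioo_mem_nhds h5.1 h5.2) ?_
    (continuousOn_sqAverage_integrand n ha hb hcont hτ).intervalIntegrable ?_ ?_
    intervalIntegrable_const ?_).2
  · filter_upwards [Ioo_mem_nhds hτ.1 hτ.2] with x hx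
    exact ((continuousOn_sqAverage_integrand n ha hb hcont hx).mono
      uIoc_subset_uIcc).aestronglyMeasurable measurableSet_uIoc
  · exact ((continuousOn_sqAverage_integrand (n + 2) ha hb hh' hτ).mono
      uIoc_subset_uIcc).aestronglyMeasurable measurableSet_uIoc
  · refine Eventually.of_forall fun s hs x hx => ?_
    rw [uIoc_of_le zero_le_one] at hs
    have h6 := hC _ (Ioo_subset_Icc_self (sq_mul_mem_Ioo h2 h3 hx ⟨hs.1.le, hs.2⟩))
    rw [norm_mul, norm_pow, Real.norm_of_nonneg hs.1.le]
    calc s ^ (n + 2) * ‖h' (s ^ 2 * x)‖ ≤ 1 * ‖h' (s ^ 2 * x)‖ := by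
          gcongr
          exact pow_le_one₀ hs.1.le hs.2
      _ ≤ C := by rwa [one_mul]
  · refine Eventually.of_forall fun s hs x hx => ?_
    rw [uIoc_of_le zero_le_one] at hs
    have h6 := hh _ (hsub (sq_mul_mem_Ioo h2 h3 hx ⟨hs.1.le, hs.2⟩))
    have h7 := (HasDerivAt.comp (h := fun x => s ^ 2 * x) x h6
      ((hasDerivAt_id' x).const_mul (s ^ 2))).const_mul (s ^ n)
    exact h7.congr_deriv (by ring)

/-- Differentiation under the integral brings out a factor $s^2$, raising the weight from $n$ to
$n+2$; hence the induction on $m$ is over all $n$. -/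
theorem contDiffOn_sqAverage {a b : ℝ} (ha : a < 0) (hb : 0 < b) (m : ℕ) :
    ∀ (n : ℕ) {h : ℝ → ℝ}, ContDiffOn ℝ m h (Ioo a b) →
      ContDiffOn ℝ m (sqAverage n h) (Ioo a b) := by
  induction m with
  | zero =>
    intro n h hh
    simp only [Nat.cast_zero, contDiffOn_zero] at hh ⊢
    exact continuousOn_sqAverage n ha hb hh
  | succ m ih =>
    intro n h hh
    rw [Nat.cast_succ, contDiffOn_succ_iff_deriv_of_isOpen isOpen_Ioo] at hh ⊢
    obtain ⟨h1, -, h3⟩ := hh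
    have hd : ∀ t ∈ Ioo a b, HasDerivAt h (deriv h t) t := fun t ht =>
      (h1.differentiableAt (Ioo_mem_nhds ht.1 ht.2)).hasDerivAt
    have hd2 := fun t (ht : t ∈ Ioo a b) => hasDerivAt_sqAverage n ha hb hd h3.continuousOn ht
    refine ⟨fun t ht => (hd2 t ht).differentiableAt.differentiableWithinAt, by simp, ?_⟩
    exact (ih (n + 2) h3).congr fun t ht => (hd2 t ht).deriv

/-- Integrate the derivative of $s^{n+1}h(s^2\tau)$ over $[0,1]$. This identity turns the integral
equation into the differential equation. -/
theorem two_mul_sqAverage_deriv (n : ℕ) {h h' : ℝ → ℝ} {a b : ℝ} (ha : a < 0) (hb : 0 < b)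
    (hh : ∀ t ∈ Ioo a b, HasDerivAt h (h' t) t) (hh' : ContinuousOn h' (Ioo a b)) {τ : ℝ}
    (hτ : τ ∈ Ioo a b) :
    2 * τ * sqAverage (n + 2) h' τ = h τ - (n + 1) * sqAverage n h τ := by
  have hcont : ContinuousOn h (Ioo a b) := fun t ht => (hh t ht).continuousAt.continuousWithinAt
  have i1 := (continuousOn_sqAverage_integrand n ha hb hcont hτ).intervalIntegrable (μ := volume)
  have i2 := (continuousOn_sqAverage_integrand (n + 2) ha hb hh' hτ).intervalIntegrable
    (μ := volume)
  have hd : ∀ s ∈ uIcc (0 : ℝ) 1, HasDerivAt (fun s => s ^ (n + 1) * h (s ^ 2 * τ))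
      ((n + 1) * (s ^ n * h (s ^ 2 * τ)) + 2 * τ * (s ^ (n + 2) * h' (s ^ 2 * τ))) s := by
    intro s hs
    rw [uIcc_of_le zero_le_one] at hs
    have h1 := HasDerivAt.comp (h := fun s => s ^ 2 * τ) s (hh _ (sq_mul_mem_Ioo ha hb hτ hs))
      ((hasDerivAt_pow 2 s).mul_const τ)
    refine ((hasDerivAt_pow (n + 1) s).mul h1).congr_deriv ?_
    simp only [Nat.cast_add, Nat.cast_one, Function.comp_apply, Nat.cast_ofNat,
      Nat.add_one_sub_one, pow_one]
    ring
  have h2 := intervalIntegral.integral_eq_sub_of_hasDerivAt hd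
    ((i1.const_mul _).add (i2.const_mul _))
  rw [intervalIntegral.integral_add (i1.const_mul _) (i2.const_mul _),
    intervalIntegral.integral_const_mul, intervalIntegral.integral_const_mul] at h2
  simp only [one_pow, one_mul, ne_eq, Nat.add_eq_zero_iff, one_ne_zero, and_false,
    not_false_eq_true, zero_pow, zero_mul, sub_zero] at h2
  unfold sqAverage
  linarith

/-- The bootstrap: averaging preserves regularity, so `Y` is one derivative better than $f(Y)$. -/
theorem contDiffOn_succ_of_hasDerivAt_sqAverage {a b : ℝ} (ha : a < 0) (hb : 0 < b) {m n : ℕ}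
    {f Y : ℝ → ℝ}
    (hY : ∀ τ ∈ Ioo a b, HasDerivAt Y (-(1 / 2) * sqAverage n (fun t => f (Y t)) τ) τ)
    (hf : ContDiffOn ℝ m (fun t => f (Y t)) (Ioo a b)) :
    ContDiffOn ℝ (m + 1) Y (Ioo a b) := by
  rw [contDiffOn_succ_iff_deriv_of_isOpen isOpen_Ioo]
  refine ⟨fun t ht => (hY t ht).differentiableAt.differentiableWithinAt, by simp, ?_⟩
  exact (contDiffOn_const.mul (contDiffOn_sqAverage ha hb m n hf)).congr
    fun t ht => (hY t ht).deriv

/-- The nonlinearity `[t]₊ ^ p`. -/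
noncomputable def posPow (p t : ℝ) : ℝ := max t 0 ^ p

theorem posPow_nonneg (p t : ℝ) : 0 ≤ posPow p t := Real.rpow_nonneg (le_max_right t 0) p

theorem posPow_of_nonneg {p t : ℝ} (ht : 0 ≤ t) : posPow p t = t ^ p := by
  rw [posPow, max_eq_left ht]

theorem posPow_of_nonpos {p t : ℝ} (hp : p ≠ 0) (ht : t ≤ 0) : posPow p t = 0 := by
  rw [posPow, max_eq_right ht, Real.zero_rpow hp]

theorem posPow_pos {p t : ℝ} (ht : 0 < t) : 0 < posPow p t := by
  rw [posPow_of_nonneg ht.le]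
  exact Real.rpow_pos_of_pos ht p

theorem monotone_posPow {p : ℝ} (hp : 0 ≤ p) : Monotone (posPow p) := fun a _ hab =>
  Real.rpow_le_rpow (le_max_right a 0) (max_le_max_right 0 hab) hp

theorem posPow_mul {p c t : ℝ} (hc : 0 ≤ c) : posPow p (c * t) = c ^ p * posPow p t := by
  rw [posPow, posPow, ← Real.mul_rpow hc (le_max_right t 0), mul_max_of_nonneg _ _ hc, mul_zero]

theorem hasDerivAt_posPow {p : ℝ} (hp : 1 < p) (t : ℝ) :
    HasDerivAt (posPow p) (p * posPow (p - 1) t) t := by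
  rcases lt_trichotomy t 0 with h | rfl | h
  · rw [posPow_of_nonpos (by linarith) h.le, mul_zero]
    refine (hasDerivAt_const t (0 : ℝ)).congr_of_eventuallyEq ?_
    filter_upwards [gt_mem_nhds h] with s hs using posPow_of_nonpos (by linarith) hs.le
  · rw [posPow_of_nonpos (by linarith) le_rfl, mul_zero]
    have h1 := hasDerivAt_abs_rpow 0 hp
    simp only [abs_zero, mul_zero] at h1
    rw [hasDerivAt_iff_isLittleO] at h1 ⊢
    refine (Asymptotics.isBigO_of_le _ fun s => ?_).trans_isLittleO h1
    have h2 : (0 : ℝ) ^ p = 0 := Real.zero_rpow (by linarith)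
    rw [posPow_of_nonpos (by linarith) le_rfl, abs_zero, h2]
    simp only [sub_zero, smul_zero]
    rw [Real.norm_of_nonneg (posPow_nonneg p s),
      Real.norm_of_nonneg (Real.rpow_nonneg (abs_nonneg s) p)]
    exact Real.rpow_le_rpow (le_max_right s 0) (max_le (le_abs_self s) (abs_nonneg s)) (by linarith)
  · rw [posPow_of_nonneg h.le]
    refine (Real.hasDerivAt_rpow_const (Or.inl h.ne')).congr_of_eventuallyEq ?_
    filter_upwards [lt_mem_nhds h] with s hs using posPow_of_nonneg hs.le

theorem continuous_posPow {p : ℝ} (hp : 0 ≤ p) : Continuous (posPow p) :=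
  (continuous_id.max continuous_const).rpow_const fun _ => Or.inr hp

theorem contDiff_posPow {p : ℝ} (hp : 1 < p) : ContDiff ℝ 1 (posPow p) := by
  rw [contDiff_one_iff_deriv]
  refine ⟨fun t => (hasDerivAt_posPow hp t).differentiableAt, ?_⟩
  have : deriv (posPow p) = fun t => p * posPow (p - 1) t :=
    funext fun t => (hasDerivAt_posPow hp t).deriv
  rw [this]
  exact continuous_const.mul (continuous_posPow (by linarith))

theorem contDiffAt_posPow {p t : ℝ} (ht : 0 < t) {n : ℕ} : ContDiffAt ℝ n (posPow p) t := by
  refine (Real.contDiffAt_rpow_const_of_ne (p := p) ht.ne').congr_of_eventuallyEq ?_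
  filter_upwards [lt_mem_nhds ht] with s hs using posPow_of_nonneg hs.le

/-- The derivative $p[t]_+^{p-1}$ is nondecreasing, so an upper bound on the arguments is enough;
the added $1$ keeps `M` positive. -/
theorem posPow_sub_le {p : ℝ} (hp : 1 < p) (A : ℝ) :
    ∃ M > 0, ∀ a b, a ≤ b → b ≤ A → posPow p b - posPow p a ≤ M * (b - a) := by
  have h0 := posPow_nonneg (p - 1) A
  refine ⟨p * posPow (p - 1) A + 1, by positivity, fun a b hab hbA => ?_⟩
  refine (convex_Iic A).image_sub_le_mul_sub_of_deriv_le
    (continuous_posPow (by linarith)).continuousOn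
    (fun t _ => (hasDerivAt_posPow hp t).differentiableAt.differentiableWithinAt)
    (fun t ht => ?_) a (hab.trans hbA) b hbA hab
  rw [interior_Iic] at ht
  rw [(hasDerivAt_posPow hp t).deriv]
  have := monotone_posPow (p := p - 1) (by linarith) (le_of_lt ht)
  have : p * posPow (p - 1) t ≤ p * posPow (p - 1) A := by gcongr
  linarith

/-- The radial profile as a function of the squared radius. -/
structure IsProfile (N : ℕ) (p : ℝ) (Y : ℝ → ℝ) : Prop where
  zero : Y 0 = 1
  smooth : ∀ τ, 0 ≤ τ → ContDiffAt ℝ 3 Y τ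
  ode : ∀ τ, 0 ≤ τ → 4 * τ * deriv (deriv Y) τ + 2 * N * deriv Y τ = -posPow p (Y τ)

/-- Integrating $(r^{N-1}\,\tfrac{d}{dr}Y(r^2))'=-r^{N-1}f(Y(r^2))$ and rescaling to $[0,1]$ gives
$Y'(\tau)=-\frac12\int_0^1s^{N-1}f(Y(s^2\tau))\,ds$. It is solved with $f$ truncated at height $2$
to be globally Lipschitz; since `Y` decreases from $1$, the truncation is inactive for $\tau\ge0$.
-/
theorem exists_isProfile {N : ℕ} (hN : 1 ≤ N) {p : ℝ} (hp : 1 < p) : ∃ Y, IsProfile N p Y := by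
  obtain ⟨n, rfl⟩ : ∃ n, N = n + 1 := ⟨N - 1, by omega⟩
  have hf1 := contDiff_posPow hp
  obtain ⟨M, hM, hML⟩ := posPow_sub_le hp 2
  have hmono := monotone_posPow (p := p) (by linarith)
  have hg : ∀ a b, |posPow p (min a 2) - posPow p (min b 2)| ≤ M * |a - b| := by
    have key : ∀ a b, a ≤ b → |posPow p (min a 2) - posPow p (min b 2)| ≤ M * |a - b| := by
      intro a b hab
      have h1 : min a 2 ≤ min b 2 := min_le_min_right 2 hab
      rw [abs_sub_comm, abs_of_nonneg (sub_nonneg.2 (hmono h1)), abs_sub_comm,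
        abs_of_nonneg (sub_nonneg.2 hab)]
      refine (hML _ _ h1 (min_le_right _ _)).trans (mul_le_mul_of_nonneg_left ?_ hM.le)
      rcases le_total b 2 with h | h
      · rw [min_eq_left h, min_eq_left (hab.trans h)]
      · rw [min_eq_right h]
        rcases le_total a 2 with h' | h'
        · rw [min_eq_left h']; linarith
        · rw [min_eq_right h']; linarith
    intro a b
    rcases le_total a b with h | h
    · exact key a b h
    · rw [abs_sub_comm, abs_sub_comm a b]
      exact key b a h
  obtain ⟨Y, hY0, hY⟩ := exists_hasDerivAt_sqAverage n (g := fun t => posPow p (min t 2)) hM hg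
    (by simp [posPow_of_nonpos (by linarith : p ≠ 0) le_rfl])
  have hYc : Continuous Y := continuous_iff_continuousAt.2 fun τ => (hY τ).continuousAt
  have hanti : Antitone Y := by
    refine antitone_of_deriv_nonpos (fun τ => (hY τ).differentiableAt) fun τ => ?_
    rw [(hY τ).deriv]
    have : 0 ≤ sqAverage n (fun t => posPow p (min (Y t) 2)) τ :=
      intervalIntegral.integral_nonneg zero_le_one fun s hs =>
        mul_nonneg (pow_nonneg hs.1 n) (posPow_nonneg _ _)
    linarith
  -- A margin to the left of $0$ makes differentiability at $0$ two-sided; $Y<2$ keeps the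
  -- truncation inactive there, and $Y>\frac12$ keeps `f` smooth along `Y`.
  obtain ⟨δ, hδ, hδY⟩ : ∃ δ > 0, ∀ t ∈ Ioo (-δ) δ, Y t ∈ Ioo (1 / 2) 2 := by
    have : ∀ᶠ t in 𝓝 (0 : ℝ), Y t ∈ Ioo (1 / 2 : ℝ) 2 :=
      hYc.continuousAt.eventually (Ioo_mem_nhds (by rw [hY0]; norm_num) (by rw [hY0]; norm_num))
    obtain ⟨δ, hδ, h⟩ := Metric.eventually_nhds_iff_ball.1 this
    refine ⟨δ, hδ, fun t ht => h t ?_⟩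
    rw [Real.ball_eq_Ioo, zero_sub, zero_add]
    exact ht
  have hlt : ∀ t, -δ < t → Y t < 2 := fun t ht => by
    rcases lt_or_ge t δ with h | h
    · exact (hδY t ⟨ht, h⟩).2
    · calc Y t ≤ Y 0 := hanti (hδ.le.trans h)
        _ < 2 := by rw [hY0]; norm_num
  have hYf : ∀ b, 0 < b → ∀ τ ∈ Ioo (-δ) b,
      HasDerivAt Y (-(1 / 2) * sqAverage n (fun t => posPow p (Y t)) τ) τ := by
    intro b hb τ hτ
    rw [← sqAverage_congr n (h := fun t => posPow p (min (Y t) 2)) (neg_lt_zero.2 hδ) hb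
      (fun t ht => by simp only; rw [min_eq_left (hlt t ht.1).le]) hτ]
    exact hY τ
  have hC2 : ∀ b, 0 < b → ContDiffOn ℝ 2 Y (Ioo (-δ) b) := by
    intro b hb
    have h1 := contDiffOn_succ_of_hasDerivAt_sqAverage (m := 0) (neg_lt_zero.2 hδ) hb (hYf b hb)
      (by
        rw [Nat.cast_zero, contDiffOn_zero]
        exact ((hf1.continuous).comp hYc).continuousOn)
    rw [Nat.cast_zero, zero_add] at h1
    have h2 := contDiffOn_succ_of_hasDerivAt_sqAverage (m := 1) (neg_lt_zero.2 hδ) hb (hYf b hb)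
      (by rw [Nat.cast_one]; exact hf1.comp_contDiffOn h1)
    rw [Nat.cast_one, one_add_one_eq_two] at h2
    exact h2
  have hode : ∀ τ, -δ < τ → 4 * τ * deriv (deriv Y) τ + 2 * ((n + 1 : ℕ) : ℝ) * deriv Y τ
      = -posPow p (Y τ) := by
    intro τ hτ
    set b := max τ 0 + 1 with hb
    have hb0 : 0 < b := by positivity
    have hτb : τ ∈ Ioo (-δ) b := ⟨hτ, by rw [hb]; linarith [le_max_left τ 0]⟩
    have hh1 : ContDiffOn ℝ 1 (fun t => posPow p (Y t)) (Ioo (-δ) b) :=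
      hf1.comp_contDiffOn ((hC2 b hb0).of_le (by norm_num))
    have hh : ∀ t ∈ Ioo (-δ) b, HasDerivAt (fun t => posPow p (Y t))
        (deriv (fun t => posPow p (Y t)) t) t := fun t ht =>
      ((hh1.differentiableOn (by simp)).differentiableAt (Ioo_mem_nhds ht.1 ht.2)).hasDerivAt
    have hh' : ContinuousOn (deriv fun t => posPow p (Y t)) (Ioo (-δ) b) :=
      hh1.continuousOn_deriv_of_isOpen isOpen_Ioo (by simp)
    have h1 := two_mul_sqAverage_deriv n (neg_lt_zero.2 hδ) hb0 hh hh' hτb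
    have h2 : deriv (deriv Y) τ
        = -(1 / 2) * sqAverage (n + 2) (deriv fun t => posPow p (Y t)) τ := by
      have h3 : deriv Y =ᶠ[𝓝 τ] fun τ => -(1 / 2) * sqAverage n (fun t => posPow p (Y t)) τ := by
        filter_upwards [Ioo_mem_nhds hτb.1 hτb.2] with t ht using (hYf b hb0 t ht).deriv
      rw [h3.deriv_eq]
      exact ((hasDerivAt_sqAverage n (neg_lt_zero.2 hδ) hb0 hh hh' hτb).const_mul _).deriv
    rw [h2, (hYf b hb0 τ hτb).deriv]
    push_cast
    linear_combination -h1
  refine ⟨Y, hY0, fun τ hτ => ?_, fun τ hτ => hode τ (by linarith)⟩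
  -- In general `f` is only $C^1$, so the bootstrap stops at $C^2$. The third derivative comes at
  -- $0$ from the smoothness of `f` near $Y(0)=1$, and at $\tau>0$ from solving the differential
  -- equation for $Y''$.
  rcases hτ.eq_or_lt with rfl | hpos
  · have h1 : ContDiffOn ℝ 2 (fun t => posPow p (Y t)) (Ioo (-δ) δ) := fun t ht => by
      have h2 : ContDiffAt ℝ ((2 : ℕ) : WithTop ℕ∞) (posPow p) (Y t) :=
        contDiffAt_posPow (by linarith [(hδY t ht).1])
      exact (h2.comp t ((hC2 δ hδ).contDiffAt (Ioo_mem_nhds ht.1 ht.2))).contDiffWithinAt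
    have h3 := contDiffOn_succ_of_hasDerivAt_sqAverage (m := 2) (neg_lt_zero.2 hδ) hδ (hYf δ hδ)
      (by exact_mod_cast h1)
    have h4 : ((2 : ℕ) : WithTop ℕ∞) + 1 = 3 := by norm_num
    rw [h4] at h3
    exact h3.contDiffAt (Ioo_mem_nhds (by linarith) hδ)
  · have hb : 0 < τ + 1 := by linarith
    have hC2' : ContDiffOn ℝ 2 Y (Ioo 0 (τ + 1)) :=
      (hC2 _ hb).mono (Ioo_subset_Ioo_left (by linarith))
    have e2 : (2 : WithTop ℕ∞) = 1 + 1 := by norm_num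
    have e3 : (3 : WithTop ℕ∞) = 2 + 1 := by norm_num
    have hd : ContDiffOn ℝ 1 (deriv Y) (Ioo 0 (τ + 1)) := by
      rw [e2, contDiffOn_succ_iff_deriv_of_isOpen isOpen_Ioo] at hC2'
      exact hC2'.2.2
    have hdd : ContDiffOn ℝ 1 (deriv (deriv Y)) (Ioo 0 (τ + 1)) := by
      have h1 : ContDiffOn ℝ 1 (fun t => (-posPow p (Y t) - 2 * ((n + 1 : ℕ) : ℝ) * deriv Y t)
          / (4 * t)) (Ioo 0 (τ + 1)) := by
        refine ContDiffOn.div ?_ ?_ fun t ht => by linarith [ht.1]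
        · exact ((hf1.comp_contDiffOn (hC2'.of_le (by norm_num))).neg).sub
            (contDiffOn_const.mul hd)
        · exact contDiffOn_const.mul contDiffOn_id
      refine h1.congr fun t ht => ?_
      have h2 := hode t (by linarith [ht.1])
      have h3 : (4 * t) ≠ 0 := by linarith [ht.1]
      rw [eq_div_iff h3]
      linarith
    have h5 : ContDiffOn ℝ 2 (deriv Y) (Ioo 0 (τ + 1)) := by
      rw [e2, contDiffOn_succ_iff_deriv_of_isOpen isOpen_Ioo]
      exact ⟨hd.differentiableOn (by simp), by simp, hdd⟩
    have h6 : ContDiffOn ℝ 3 Y (Ioo 0 (τ + 1)) := by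
      rw [e3, contDiffOn_succ_iff_deriv_of_isOpen isOpen_Ioo]
      exact ⟨hC2'.differentiableOn (by simp), by simp, h5⟩
    exact h6.contDiffAt (Ioo_mem_nhds hpos (by linarith))

end ProfileRegularity

/-! ### Monotonicity, decay and the zero of the profile. -/

section ProfileAnalysis

open Filter Topology

variable {N : ℕ} {p : ℝ} {Y : ℝ → ℝ}

/-- Up to a constant, the mass of the profile in the ball of radius `r`. -/
noncomputable def radialMass (N : ℕ) (Y : ℝ → ℝ) (r : ℝ) : ℝ := -2 * (r ^ N * deriv Y (r ^ 2))

theorem radialMass_zero (hN : N ≠ 0) : radialMass N Y 0 = 0 := by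
  simp [radialMass, hN]

theorem IsProfile.hasDerivAt_sq (hY : IsProfile N p Y) (r : ℝ) :
    HasDerivAt (fun r : ℝ => Y (r ^ 2)) (2 * r * deriv Y (r ^ 2)) r := by
  have h1 := ((hY.smooth _ (sq_nonneg r)).differentiableAt (by simp)).hasDerivAt
  refine (HasDerivAt.comp (h := fun r : ℝ => r ^ 2) r h1 (hasDerivAt_pow 2 r)).congr_deriv ?_
  simp
  ring

theorem IsProfile.continuous_sq (hY : IsProfile N p Y) : Continuous fun r : ℝ => Y (r ^ 2) :=
  continuous_iff_continuousAt.2 fun r => (hY.hasDerivAt_sq r).continuousAt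

/-- The equation in divergence form: `radialMass` is $-r^{N-1}\frac{d}{dr}Y(r^2)$, the flux through
a sphere up to a constant. -/
theorem IsProfile.hasDerivAt_radialMass (hY : IsProfile N p Y) (hN : 1 ≤ N) (r : ℝ) :
    HasDerivAt (radialMass N Y) (r ^ (N - 1) * posPow p (Y (r ^ 2))) r := by
  have h0 : ContDiffAt ℝ 2 (deriv Y) (r ^ 2) :=
    ((hY.smooth _ (sq_nonneg r)).fderiv_right (m := 2) (by norm_num)).clm_apply contDiffAt_const
  have h1 := (h0.differentiableAt (by simp)).hasDerivAt
  have h2 := HasDerivAt.comp (h := fun r : ℝ => r ^ 2) r h1 (hasDerivAt_pow 2 r)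
  refine (((hasDerivAt_pow N r).mul h2).const_mul (-2)).congr_deriv ?_
  have h3 := hY.ode _ (sq_nonneg r)
  have h4 : r ^ N = r ^ (N - 1) * r := by
    rw [← pow_succ]
    congr 1
    omega
  simp only [Function.comp_apply, Nat.cast_ofNat, Nat.add_one_sub_one, pow_one, h4]
  linear_combination (-(r ^ (N - 1))) * h3

theorem IsProfile.continuous_radialMass (hY : IsProfile N p Y) (hN : 1 ≤ N) :
    Continuous (radialMass N Y) :=
  continuous_iff_continuousAt.2 fun r => (hY.hasDerivAt_radialMass hN r).continuousAt

theorem IsProfile.monotoneOn_radialMass (hY : IsProfile N p Y) (hN : 1 ≤ N) :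
    MonotoneOn (radialMass N Y) (Ici 0) := by
  refine monotoneOn_of_deriv_nonneg (convex_Ici 0) (hY.continuous_radialMass hN).continuousOn
    (fun r _ => (hY.hasDerivAt_radialMass hN r).differentiableAt.differentiableWithinAt)
    fun r hr => ?_
  rw [interior_Ici] at hr
  rw [(hY.hasDerivAt_radialMass hN r).deriv]
  exact mul_nonneg (pow_nonneg (le_of_lt hr) _) (posPow_nonneg _ _)

theorem IsProfile.radialMass_pos (hY : IsProfile N p Y) (hN : 1 ≤ N) {r : ℝ} (hr : 0 < r) :
    0 < radialMass N Y r := by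
  have hev : ∀ᶠ s in 𝓝 (0 : ℝ), 0 < Y (s ^ 2) :=
    hY.continuous_sq.continuousAt.eventually (lt_mem_nhds (by simp [hY.zero]))
  obtain ⟨δ, hδ, h⟩ := Metric.eventually_nhds_iff_ball.1 hev
  set s := min r (δ / 2) with hs
  have hs0 : 0 < s := by positivity
  have hsδ : s < δ := (min_le_right _ _).trans_lt (by linarith)
  have hstrict : StrictMonoOn (radialMass N Y) (Icc 0 s) := by
    refine strictMonoOn_of_deriv_pos (convex_Icc 0 s)
      (hY.continuous_radialMass hN).continuousOn fun t ht => ?_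
    rw [interior_Icc] at ht
    rw [(hY.hasDerivAt_radialMass hN t).deriv]
    refine mul_pos (pow_pos ht.1 _) (posPow_pos (h t ?_))
    rw [Real.ball_eq_Ioo]
    constructor <;> linarith [ht.1, ht.2]
  have h1 := hstrict ⟨le_rfl, hs0.le⟩ ⟨hs0.le, le_rfl⟩ hs0
  rw [radialMass_zero (by omega)] at h1
  exact h1.trans_le (hY.monotoneOn_radialMass hN hs0.le hr.le (min_le_left _ _))

theorem IsProfile.hasDerivAt_sq' (hY : IsProfile N p Y) (hN : 1 ≤ N) {r : ℝ} (hr : 0 < r) :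
    HasDerivAt (fun r : ℝ => Y (r ^ 2)) (-(radialMass N Y r / r ^ (N - 1))) r := by
  refine (hY.hasDerivAt_sq r).congr_deriv ?_
  have h4 : r ^ N = r ^ (N - 1) * r := by
    rw [← pow_succ]
    congr 1
    omega
  have := (pow_pos hr (N - 1)).ne'
  rw [radialMass, h4]
  field_simp

theorem IsProfile.strictAntiOn (hY : IsProfile N p Y) (hN : 1 ≤ N) :
    StrictAntiOn (fun r : ℝ => Y (r ^ 2)) (Ici 0) := by
  refine strictAntiOn_of_deriv_neg (convex_Ici 0) hY.continuous_sq.continuousOn fun r hr => ?_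
  rw [interior_Ici] at hr
  have hr' : 0 < r := hr
  rw [(hY.hasDerivAt_sq' hN hr').deriv]
  have := hY.radialMass_pos hN hr'
  have := pow_pos hr' (N - 1)
  rw [neg_lt_zero]
  positivity

/-- The profile decreases, so $f(Y(s^2))\ge f(Y(r^2))$ under the integral over $[0,r]$. -/
theorem IsProfile.rpow_le_radialMass (hY : IsProfile N p Y) (hN : 1 ≤ N) (hp : 0 ≤ p) {r : ℝ}
    (hr : 0 ≤ r) (hpos : 0 < Y (r ^ 2)) : Y (r ^ 2) ^ p * r ^ N / N ≤ radialMass N Y r := by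
  have hN0 : (N : ℝ) ≠ 0 := by positivity
  have hd : ∀ s : ℝ, HasDerivAt (fun s => radialMass N Y s - Y (r ^ 2) ^ p * s ^ N / N)
      (s ^ (N - 1) * posPow p (Y (s ^ 2)) - Y (r ^ 2) ^ p * s ^ (N - 1)) s := fun s => by
    refine ((hY.hasDerivAt_radialMass hN s).sub
      (((hasDerivAt_pow N s).const_mul _).div_const (N : ℝ))).congr_deriv ?_
    field_simp
  have hmono : MonotoneOn (fun s => radialMass N Y s - Y (r ^ 2) ^ p * s ^ N / N) (Icc 0 r) := by
    refine monotoneOn_of_deriv_nonneg (convex_Icc 0 r)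
      (fun s _ => (hd s).continuousAt.continuousWithinAt)
      (fun s _ => (hd s).differentiableAt.differentiableWithinAt) fun s hs => ?_
    rw [interior_Icc] at hs
    rw [(hd s).deriv]
    have h1 : Y (r ^ 2) ≤ Y (s ^ 2) := (hY.strictAntiOn hN).antitoneOn hs.1.le hr hs.2.le
    have h2 := monotone_posPow hp h1
    rw [posPow_of_nonneg hpos.le] at h2
    nlinarith [pow_nonneg hs.1.le (N - 1)]
  have h := hmono ⟨le_rfl, hr⟩ ⟨hr, le_rfl⟩ hr
  simp only [radialMass_zero (Y := Y) (show N ≠ 0 by omega), zero_pow (show N ≠ 0 by omega),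
    mul_zero, zero_div, sub_zero] at h
  linarith

/-- Below the exponent `N / (N - 2)` the profile reaches zero. -/
theorem IsProfile.exists_nonpos (hY : IsProfile N p Y) (hN : 3 ≤ N) (hp : 1 < p)
    (hpN : p < criticalExponent N) : ∃ r, 0 < r ∧ Y (r ^ 2) ≤ 0 := by
  -- A positive profile would satisfy $Y(r^2)\le Cr^{-2/(p-1)}$ by the lower bound on its flux, and
  -- $Y(r^2)\ge cr^{-(N-2)}$ for $r\ge1$ because the flux is nondecreasing. For large $r$ these
  -- conflict when $(N-2)(p-1)<2$, which is $p<p_N$.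
  by_contra! hall
  have hN1 : 1 ≤ N := by omega
  obtain ⟨m, rfl⟩ : ∃ m, N = m + 3 := ⟨N - 3, by omega⟩
  have hpos : ∀ r, 0 ≤ r → 0 < Y (r ^ 2) := fun r hr => by
    rcases hr.eq_or_lt with rfl | h
    · simp [hY.zero]
    · exact hall r h
  set n : ℝ := (m : ℝ) + 1 with hn
  have hn0 : 0 < n := by positivity
  have hexp : n * (p - 1) < 2 := by
    rw [criticalExponent, lt_div_iff₀ (by push_cast; linarith)] at hpN
    push_cast at hpN
    rw [hn]
    linarith
  -- decay of the profile from above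
  have hupper : ∀ r, 0 ≤ r → (p - 1) / (2 * (m + 3 : ℕ)) * r ^ 2 ≤ Y (r ^ 2) ^ (1 - p) := by
    intro r hr
    have hd : ∀ s, 0 < s → HasDerivAt (fun s => Y (s ^ 2) ^ (1 - p)
        - (p - 1) / (2 * (m + 3 : ℕ)) * s ^ 2)
        ((p - 1) * (Y (s ^ 2) ^ (-p) * (radialMass (m + 3) Y s / s ^ (m + 3 - 1)))
          - (p - 1) / (m + 3 : ℕ) * s) s := fun s hs => by
      refine (((hY.hasDerivAt_sq' hN1 hs).rpow_const (p := 1 - p)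
        (Or.inl (hpos s hs.le).ne')).sub ((hasDerivAt_pow 2 s).const_mul _)).congr_deriv ?_
      rw [show 1 - p - 1 = -p by ring]
      simp only [Nat.cast_ofNat, Nat.add_one_sub_one, pow_one]
      field_simp
      ring
    have hmono : MonotoneOn (fun s => Y (s ^ 2) ^ (1 - p)
        - (p - 1) / (2 * (m + 3 : ℕ)) * s ^ 2) (Ici 0) := by
      refine monotoneOn_of_deriv_nonneg (convex_Ici 0) ?_ ?_ ?_
      · refine ContinuousOn.sub ?_ (by fun_prop)
        exact hY.continuous_sq.continuousOn.rpow_const fun s hs => Or.inl (hpos s hs).ne'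
      · rw [interior_Ici]
        exact fun s hs => (hd s hs).differentiableAt.differentiableWithinAt
      · rw [interior_Ici]
        intro s hs
        have hs' : 0 < s := hs
        rw [(hd s hs').deriv]
        have h1 := hY.rpow_le_radialMass hN1 (by linarith) hs'.le (hpos s hs'.le)
        have h2 : 0 < Y (s ^ 2) ^ (-p) := Real.rpow_pos_of_pos (hpos s hs'.le) _
        have h3 : Y (s ^ 2) ^ (-p) * Y (s ^ 2) ^ p = 1 := by
          rw [← Real.rpow_add (hpos s hs'.le)]; simp
        have h4 : s / (m + 3 : ℕ)
            ≤ Y (s ^ 2) ^ (-p) * (radialMass (m + 3) Y s / s ^ (m + 3 - 1)) := by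
          have h5 := pow_pos hs' (m + 2)
          calc s / (m + 3 : ℕ) = (Y (s ^ 2) ^ (-p) * Y (s ^ 2) ^ p) * (s / (m + 3 : ℕ)) := by
                rw [h3, one_mul]
            _ = Y (s ^ 2) ^ (-p)
                * ((Y (s ^ 2) ^ p * s ^ (m + 3) / (m + 3 : ℕ)) / s ^ (m + 3 - 1)) := by
                rw [show m + 3 - 1 = m + 2 by omega, show m + 3 = m + 2 + 1 by omega, pow_succ]
                field_simp
                ring
            _ ≤ _ := by
                rw [show m + 3 - 1 = m + 2 by omega]
                gcongr
        have h6 := mul_le_mul_of_nonneg_left h4 (by linarith : 0 ≤ p - 1)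
        have h7 : (p - 1) / (m + 3 : ℕ) * s = (p - 1) * (s / (m + 3 : ℕ)) := by ring
        rw [h7]
        linarith
    have h := hmono (mem_Ici.2 le_rfl) hr hr
    simp only [ne_eq, OfNat.ofNat_ne_zero, not_false_eq_true, zero_pow, hY.zero, Real.one_rpow,
      mul_zero, sub_zero] at h
    linarith
  -- decay of the profile from below
  set c := radialMass (m + 3) Y 1 / n with hc
  have hc0 : 0 < c := div_pos (hY.radialMass_pos hN1 one_pos) hn0
  have hlower : ∀ r, 1 ≤ r → c * (r ^ (m + 1))⁻¹ ≤ Y (r ^ 2) := by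
    have hd : ∀ s, 0 < s → HasDerivAt (fun s => Y (s ^ 2) - c * (s ^ (m + 1))⁻¹)
        (-((radialMass (m + 3) Y s - radialMass (m + 3) Y 1) / s ^ (m + 2))) s := fun s hs => by
      refine ((hY.hasDerivAt_sq' hN1 hs).sub (((hasDerivAt_pow (m + 1) s).inv
        (pow_pos hs _).ne').const_mul c)).congr_deriv ?_
      rw [show m + 3 - 1 = m + 2 by omega, hc, hn]
      push_cast
      have h1 : (s ^ (m + 1)) ^ 2 = s ^ m * s ^ (m + 2) := by ring
      rw [h1]
      have h2 := (pow_pos hs m).ne'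
      field_simp
      ring
    have hanti : AntitoneOn (fun s => Y (s ^ 2) - c * (s ^ (m + 1))⁻¹) (Ici 1) := by
      refine antitoneOn_of_deriv_nonpos (convex_Ici 1)
        (fun s hs => (hd s (one_pos.trans_le hs)).continuousAt.continuousWithinAt) ?_ ?_
      · rw [interior_Ici]
        exact fun s hs => (hd s (one_pos.trans hs)).differentiableAt.differentiableWithinAt
      · rw [interior_Ici]
        intro s hs
        have hs' : 0 < s := one_pos.trans hs
        rw [(hd s hs').deriv, neg_nonpos]
        have := hY.monotoneOn_radialMass hN1 (mem_Ici.2 zero_le_one) hs'.le (le_of_lt hs)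
        exact div_nonneg (by linarith) (pow_pos hs' _).le
    intro r hr
    have hlim : Tendsto (fun s : ℝ => -(c * (s ^ (m + 1))⁻¹)) atTop (𝓝 0) := by
      have h1 : Tendsto (fun s : ℝ => (s ^ (m + 1))⁻¹) atTop (𝓝 0) :=
        tendsto_inv_atTop_zero.comp (tendsto_pow_atTop (by omega))
      simpa using (h1.const_mul c).neg
    have h2 : 0 ≤ Y (r ^ 2) - c * (r ^ (m + 1))⁻¹ := by
      refine le_of_tendsto hlim ?_
      filter_upwards [eventually_ge_atTop r] with s hs
      have h3 := hanti hr (hr.trans hs) hs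
      have h4 := hpos s (by linarith)
      simp only at h3
      linarith
    linarith
  have hbd : ∀ r : ℝ, 1 ≤ r →
      r ^ (2 - n * (p - 1)) ≤ c ^ (1 - p) * (2 * (m + 3 : ℕ) / (p - 1)) := by
    intro r hr
    have hr0 : 0 < r := by linarith
    have h1 := hupper r hr0.le
    have h2 : Y (r ^ 2) ^ (1 - p) ≤ (c * (r ^ (m + 1))⁻¹) ^ (1 - p) :=
      Real.rpow_le_rpow_of_nonpos (by positivity) (hlower r hr) (by linarith)
    have h3 : (c * (r ^ (m + 1))⁻¹) ^ (1 - p) = c ^ (1 - p) * r ^ (n * (p - 1)) := by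
      rw [Real.mul_rpow hc0.le (by positivity), ← Real.rpow_natCast, ← Real.rpow_neg hr0.le,
        ← Real.rpow_mul hr0.le]
      congr 2
      rw [hn]
      push_cast
      ring
    rw [h3] at h2
    have h4 : r ^ (2 - n * (p - 1)) = r ^ 2 / r ^ (n * (p - 1)) := by
      rw [Real.rpow_sub hr0, Real.rpow_two]
    have h5 : 0 < r ^ (n * (p - 1)) := Real.rpow_pos_of_pos hr0 _
    rw [h4, div_le_iff₀ h5]
    have hp1 : 0 < p - 1 := by linarith
    have h6 : (0 : ℝ) < (m + 3 : ℕ) := by positivity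
    calc r ^ 2 = (2 * (m + 3 : ℕ) / (p - 1)) * ((p - 1) / (2 * (m + 3 : ℕ)) * r ^ 2) := by
          field_simp
      _ ≤ (2 * (m + 3 : ℕ) / (p - 1)) * (c ^ (1 - p) * r ^ (n * (p - 1))) :=
          mul_le_mul_of_nonneg_left (h1.trans h2) (by positivity)
      _ = _ := by ring
  have htop : Tendsto (fun r : ℝ => r ^ (2 - n * (p - 1))) atTop atTop :=
    tendsto_rpow_atTop (by linarith)
  obtain ⟨r, h1, h2⟩ := ((htop.eventually_gt_atTop
    (c ^ (1 - p) * (2 * (m + 3 : ℕ) / (p - 1)))).and (eventually_ge_atTop 1)).exists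
  exact absurd (hbd r h2) (not_le.2 h1)

theorem IsProfile.exists_zero (hY : IsProfile N p Y) (hN : 3 ≤ N) (hp : 1 < p)
    (hpN : p < criticalExponent N) : ∃ r, 0 < r ∧ Y (r ^ 2) = 0 := by
  obtain ⟨r, hr, hYr⟩ := hY.exists_nonpos hN hp hpN
  obtain ⟨s, hs, hYs⟩ := intermediate_value_Icc' hr.le hY.continuous_sq.continuousOn
    (show (0 : ℝ) ∈ Icc (Y (r ^ 2)) (Y (0 ^ 2)) from ⟨hYr, by simp [hY.zero]⟩)
  refine ⟨s, lt_of_le_of_ne hs.1 ?_, hYs⟩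
  rintro rfl
  simp [hY.zero] at hYs

/-- Beyond its zero the profile is a multiple of the fundamental solution, up to a constant. -/
theorem IsProfile.eq_of_zero_le (hY : IsProfile N p Y) (hN : 3 ≤ N) (hp : 1 < p) {r0 : ℝ}
    (hr0 : 0 < r0) (hzero : Y (r0 ^ 2) = 0) {r : ℝ} (hr : r0 ≤ r) :
    radialMass N Y r = radialMass N Y r0 ∧
    Y (r ^ 2) = radialMass N Y r0 / ((N : ℝ) - 2) * ((r ^ (N - 2))⁻¹ - (r0 ^ (N - 2))⁻¹) := by
  have hN1 : 1 ≤ N := by omega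
  have hneg : ∀ s, r0 ≤ s → Y (s ^ 2) ≤ 0 := fun s hs => by
    rw [← hzero]
    exact (hY.strictAntiOn hN1).antitoneOn hr0.le (hr0.le.trans hs) hs
  have hM : ∀ s, r0 ≤ s → radialMass N Y s = radialMass N Y r0 := fun s hs =>
    constant_of_has_deriv_right_zero (hY.continuous_radialMass hN1).continuousOn
      (fun t ht => by
        have h := hY.hasDerivAt_radialMass hN1 t
        rw [posPow_of_nonpos (by linarith) (hneg t ht.1), mul_zero] at h
        exact h.hasDerivWithinAt) s ⟨hs, le_rfl⟩
  refine ⟨hM r hr, ?_⟩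
  obtain ⟨m, rfl⟩ : ∃ m, N = m + 3 := ⟨N - 3, by omega⟩
  rw [show m + 3 - 2 = m + 1 by omega]
  have hm : ((m + 3 : ℕ) : ℝ) - 2 = (m : ℝ) + 1 := by push_cast; ring
  rw [hm]
  set c := radialMass (m + 3) Y r0 / ((m : ℝ) + 1) with hc
  have hd : ∀ s, r0 ≤ s → HasDerivAt (fun s => Y (s ^ 2) - c * (s ^ (m + 1))⁻¹) 0 s := by
    intro s hs
    have hs0 : 0 < s := hr0.trans_le hs
    refine ((hY.hasDerivAt_sq' hN1 hs0).sub (((hasDerivAt_pow (m + 1) s).inv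
      (pow_pos hs0 _).ne').const_mul c)).congr_deriv ?_
    rw [hM s hs, show m + 3 - 1 = m + 2 by omega, hc]
    push_cast
    have h1 : (s ^ (m + 1)) ^ 2 = s ^ m * s ^ (m + 2) := by ring
    rw [h1]
    have h2 := (pow_pos hs0 m).ne'
    have h3 : (m : ℝ) + 1 ≠ 0 := by positivity
    field_simp
    ring
  have h := constant_of_has_deriv_right_zero
    (fun t ht => (hd t ht.1).continuousAt.continuousWithinAt)
    (fun t ht => (hd t ht.1).hasDerivWithinAt) r (⟨hr, le_rfl⟩ : r ∈ Icc r0 r)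
  simp only [hzero] at h
  linarith

end ProfileAnalysis

/-! ### Bubbles: regularity, mass, and classification of solutions. -/

section Bubbles

open Filter Topology

/-- A `C³` function on the whole space is `C^{2,β}` up to the boundary of every ball. -/
theorem isC2Holder_ball_of_contDiff {N : ℕ} {β : ℝ≥0} (hβ : β ≤ 1) {R : ℝ} (hR : 0 < R)
    {v : E N → ℝ} (hv : ContDiff ℝ 3 v) : IsC2Holder β (ball 0 R) v := by
  refine ⟨(hv.of_le (by norm_num)).contDiffOn, ?_⟩
  rw [closure_ball _ hR.ne']
  have h1 : ContDiff ℝ 1 (iteratedFDeriv ℝ 2 v) := hv.iteratedFDeriv_right (by norm_num)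
  obtain ⟨K, hK⟩ := (h1.locallyLipschitz.locallyLipschitzOn
    (s := closedBall (0 : E N) R)).exists_lipschitzOnWith_of_compact (isCompact_closedBall _ _)
  have hu : UniqueDiffOn ℝ (closedBall (0 : E N) R) :=
    uniqueDiffOn_convex (convex_closedBall _ _)
      ⟨0, ball_subset_interior_closedBall (mem_ball_self hR)⟩
  have h2 : HolderOnWith K 1 (iteratedFDerivWithin ℝ 2 v (closedBall 0 R)) (closedBall 0 R) := by
    rw [holderOnWith_one]
    intro x hx y hy
    rw [iteratedFDerivWithin_eq_iteratedFDeriv hu (hv.of_le (by norm_num)).contDiffAt hx,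
      iteratedFDerivWithin_eq_iteratedFDeriv hu (hv.of_le (by norm_num)).contDiffAt hy]
    exact hK hx hy
  refine ⟨_, h2.of_le (D := Real.toNNReal (2 * R)) (fun x hx y hy => ?_) hβ⟩
  rw [edist_dist]
  refine ENNReal.ofReal_le_ofReal ?_
  have h3 : dist x 0 ≤ R := hx
  have h4 : dist y 0 ≤ R := hy
  linarith [dist_triangle_right x y 0]

/-- Both solutions are radial and `f` is Lipschitz on their ranges, so the difference is radial,
satisfies $|\Delta w|\le M|w|$ and vanishes at the centre. The boundary values need not agree
beforehand. -/
theorem IsPoissonSolution.eqOn_of_eq_center {F : Type*} [NormedAddCommGroup F]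
    [InnerProductSpace ℝ F] [FiniteDimensional ℝ F] {f : ℝ → ℝ} {R γ γ' : ℝ} {v v' : F → ℝ}
    (hdim : 2 ≤ Module.finrank ℝ F) (hv : IsPoissonSolution f R γ v)
    (hv' : IsPoissonSolution f R γ' v') (hR : 0 < R) (hmono : Monotone f) (hf0 : ∀ t, 0 ≤ f t)
    (hLip : ∀ A, ∃ M > 0, ∀ a b, a ≤ b → b ≤ A → f b - f a ≤ M * (b - a)) (h0 : v 0 = v' 0) :
    EqOn v v' (closedBall 0 R) := by
  obtain ⟨A, hA⟩ := (isCompact_closedBall (0 : F) R).bddAbove_image hv.continuousOn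
  obtain ⟨A', hA'⟩ := (isCompact_closedBall (0 : F) R).bddAbove_image hv'.continuousOn
  obtain ⟨M, hM, hML⟩ := hLip (max A A')
  have hball : EqOn v v' (ball 0 R) := by
    intro x hx
    have hxR : ‖x‖ < R := by simpa using hx
    refine sub_eq_zero.1 (eq_zero_of_radial (w := v - v') hdim
      (fun z hz => (hv.contDiffAt z hz).sub (hv'.contDiffAt z hz)) (fun z hz y hzy => ?_) hxR hM.le
      (fun z hz => ?_) (sub_eq_zero.2 h0) le_rfl)
    · have hz' := ball_subset_closedBall hz
      simp only [Pi.sub_apply]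
      rw [hv.radial hR hmono hf0 hLip hz' hzy, hv'.radial hR hmono hf0 hLip hz' hzy]
    · have hzb : z ∈ ball (0 : F) R := by
        rw [mem_ball_zero_iff]
        linarith
      have hz' := ball_subset_closedBall hzb
      have h1 : v z ≤ max A A' := (hA (mem_image_of_mem v hz')).trans (le_max_left _ _)
      have h2 : v' z ≤ max A A' := (hA' (mem_image_of_mem v' hz')).trans (le_max_right _ _)
      have h3 := hv.equation z hzb
      have h4 := hv'.equation z hzb
      rw [(hv.contDiffAt z hzb).laplacian_sub (hv'.contDiffAt z hzb), Pi.sub_apply]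
      have h5 : Laplacian.laplacian v z - Laplacian.laplacian v' z = f (v' z) - f (v z) := by
        linarith
      rw [h5]
      rcases le_total (v z) (v' z) with h | h
      · rw [abs_of_nonneg (sub_nonneg.2 (hmono h)), abs_sub_comm,
          abs_of_nonneg (sub_nonneg.2 h)]
        exact hML _ _ h h2
      · rw [abs_sub_comm, abs_of_nonneg (sub_nonneg.2 (hmono h)), abs_of_nonneg (sub_nonneg.2 h)]
        exact hML _ _ h h1
  rw [← closure_ball _ hR.ne']
  exact hball.of_subset_closure (by simpa only [closure_ball _ hR.ne'] using hv.continuousOn)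
    (by simpa only [closure_ball _ hR.ne'] using hv'.continuousOn) subset_closure subset_rfl

variable {N : ℕ} {p : ℝ} {Y : ℝ → ℝ}

/-- The rescaled profiles, which are the entire radial solutions with positive centre value. -/
noncomputable def bubble (N : ℕ) (p : ℝ) (Y : ℝ → ℝ) (k : ℝ) (x : E N) : ℝ :=
  k ^ (2 / (p - 1)) * Y ((k * ‖x‖) ^ 2)

theorem bubble_zero (hY : IsProfile N p Y) (k : ℝ) : bubble N p Y k 0 = k ^ (2 / (p - 1)) := by
  simp [bubble, hY.zero]

theorem contDiff_bubble (hY : IsProfile N p Y) (k : ℝ) : ContDiff ℝ 3 (bubble N p Y k) := by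
  refine contDiff_iff_contDiffAt.2 fun x => contDiffAt_const.mul ?_
  have h : ContDiff ℝ 3 fun x : E N => (k * ‖x‖) ^ 2 := by
    simp_rw [mul_pow]
    exact contDiff_const.mul (contDiff_norm_sq ℝ)
  exact ContDiffAt.comp (f := fun x : E N => (k * ‖x‖) ^ 2) x (hY.smooth _ (sq_nonneg _))
    h.contDiffAt

theorem laplacian_bubble (hY : IsProfile N p Y) (hp : 1 < p) {k : ℝ} (hk : 0 < k) (x : E N) :
    -(Laplacian.laplacian (bubble N p Y k) x) = posPow p (bubble N p Y k x) := by
  set c := k ^ (2 / (p - 1)) with hc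
  set W : ℝ → ℝ := fun τ => c * Y (k ^ 2 * τ) with hW
  have hWd : ∀ τ, 0 ≤ τ → HasDerivAt W (c * k ^ 2 * deriv Y (k ^ 2 * τ)) τ := fun τ hτ => by
    have h1 := ((hY.smooth _ (mul_nonneg (sq_nonneg k) hτ)).differentiableAt (by simp)).hasDerivAt
    have h2 := (HasDerivAt.comp (h := fun τ => k ^ 2 * τ) τ h1
      ((hasDerivAt_id' τ).const_mul (k ^ 2))).const_mul c
    exact h2.congr_deriv (by ring)
  have hsmooth : ∀ τ, 0 ≤ τ → ContDiffAt ℝ 3 W τ := fun τ hτ =>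
    contDiffAt_const.mul (ContDiffAt.comp (f := fun τ => k ^ 2 * τ) τ
      (hY.smooth _ (mul_nonneg (sq_nonneg k) hτ)) (contDiffAt_const.mul contDiffAt_id))
  have hτ : 0 ≤ ‖x‖ ^ 2 := sq_nonneg _
  have hdd : deriv (deriv W) (‖x‖ ^ 2) = c * k ^ 4 * deriv (deriv Y) (k ^ 2 * ‖x‖ ^ 2) := by
    have hev : deriv W =ᶠ[𝓝 (‖x‖ ^ 2)] fun τ => c * k ^ 2 * deriv Y (k ^ 2 * τ) := by
      have h1 := (hY.smooth _ (mul_nonneg (sq_nonneg k) hτ)).eventually (by simp)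
      have h2 : ContinuousAt (fun τ : ℝ => k ^ 2 * τ) (‖x‖ ^ 2) := by fun_prop
      filter_upwards [h2.eventually h1] with τ h3
      have h4 := (HasDerivAt.comp (h := fun τ => k ^ 2 * τ) τ
        (h3.differentiableAt (by simp)).hasDerivAt
        ((hasDerivAt_id' τ).const_mul (k ^ 2))).const_mul c
      rw [show deriv W τ = _ from h4.deriv]
      ring
    rw [hev.deriv_eq]
    have h1 : ContDiffAt ℝ 2 (deriv Y) (k ^ 2 * ‖x‖ ^ 2) :=
      ((hY.smooth _ (mul_nonneg (sq_nonneg k) hτ)).fderiv_right (m := 2)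
        (by norm_num)).clm_apply contDiffAt_const
    have h2 := (HasDerivAt.comp (h := fun τ => k ^ 2 * τ) (‖x‖ ^ 2)
      (h1.differentiableAt (by simp)).hasDerivAt
      ((hasDerivAt_id' (‖x‖ ^ 2)).const_mul (k ^ 2))).const_mul (c * k ^ 2)
    rw [show deriv (fun τ => c * k ^ 2 * deriv Y (k ^ 2 * τ)) (‖x‖ ^ 2) = _ from h2.deriv]
    ring
  have hbW : bubble N p Y k = fun z : E N => W (‖z‖ ^ 2) := by
    funext z
    simp only [bubble, hW, mul_pow, hc]
  have hL := laplacian_comp_norm_sq x ((hsmooth _ hτ).of_le (by norm_num))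
  have hode := hY.ode (k ^ 2 * ‖x‖ ^ 2) (mul_nonneg (sq_nonneg k) hτ)
  -- This scaling identity dictates the amplitude exponent $2/(p-1)$.
  have hcp : c ^ p = c * k ^ 2 := by
    rw [hc, ← Real.rpow_mul hk.le, ← Real.rpow_two, ← Real.rpow_add hk]
    congr 1
    have : p - 1 ≠ 0 := by linarith
    field_simp
    ring
  rw [hbW, hL, hdd, (hWd _ hτ).deriv, hW]
  simp only
  rw [posPow_mul (Real.rpow_nonneg hk.le _), hcp, finrank_euclideanSpace_fin]
  linear_combination (-(c * k ^ 2)) * hode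

theorem isPoissonSolution_bubble (hY : IsProfile N p Y) (hp : 1 < p) {k : ℝ} (hk : 0 < k) (R : ℝ) :
    IsPoissonSolution (posPow p) R (k ^ (2 / (p - 1)) * Y ((k * R) ^ 2)) (bubble N p Y k) where
  continuousOn := (contDiff_bubble hY k).continuous.continuousOn
  contDiffAt x _ := ((contDiff_bubble hY k).of_le (by norm_num)).contDiffAt
  equation x _ := laplacian_bubble hY hp hk x
  boundary x hx := by
    rw [mem_sphere_zero_iff_norm] at hx
    rw [bubble, hx]

/-- The mass of a bubble in the ball of radius `R`. -/
noncomputable def bubbleMass (N : ℕ) (p : ℝ) (Y : ℝ → ℝ) (R k : ℝ) : ℝ :=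
  N * omega N * (k ^ (2 / (p - 1) * p - N) * radialMass N Y (k * R))

/-- Polar coordinates, with the rescaled `radialMass` as antiderivative: amplitude contributes
$k^{2p/(p-1)}$ and volume $k^{-N}$. -/
theorem integral_bubble (hY : IsProfile N p Y) (hN : 1 ≤ N) (hp : 0 ≤ p) {k R : ℝ} (hk : 0 < k)
    (hR : 0 < R) : ∫ x in ball (0 : E N) R, posPow p (bubble N p Y k x) = bubbleMass N p Y R k := by
  set c := k ^ (2 / (p - 1)) with hc
  have hc0 : 0 ≤ c := Real.rpow_nonneg hk.le _
  set g : ℝ → ℝ := (Iio R).indicator fun r => posPow p (c * Y ((k * r) ^ 2)) with hg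
  have h1 : ∫ x in ball (0 : E N) R, posPow p (bubble N p Y k x) = ∫ x : E N, g ‖x‖ := by
    rw [← integral_indicator measurableSet_ball]
    congr 1
    funext x
    by_cases hx : ‖x‖ < R
    · rw [indicator_of_mem (by simpa using hx), hg, indicator_of_mem (by simpa using hx)]
      rfl
    · rw [indicator_of_notMem (by simpa using hx), hg, indicator_of_notMem (by simpa using hx)]
  have : Nontrivial (E N) := Module.nontrivial_of_finrank_pos (R := ℝ)
    (by rw [finrank_euclideanSpace_fin]; omega)
  rw [h1, integral_fun_norm_addHaar, finrank_euclideanSpace_fin]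
  have hd : ∀ r : ℝ, HasDerivAt
      (fun r => k ^ (2 / (p - 1) * p - N) * radialMass N Y (k * r))
      (r ^ (N - 1) * posPow p (c * Y ((k * r) ^ 2))) r := fun r => by
    have h2 := (HasDerivAt.comp (h := fun r => k * r) r (hY.hasDerivAt_radialMass hN (k * r))
      ((hasDerivAt_id' r).const_mul k)).const_mul (k ^ (2 / (p - 1) * p - N))
    refine h2.congr_deriv ?_
    rw [posPow_mul hc0, hc, ← Real.rpow_mul hk.le, Real.rpow_sub hk, Real.rpow_natCast]
    have h3 : k ^ N = k ^ (N - 1) * k := by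
      rw [← pow_succ]
      congr 1
      omega
    have h4 := (pow_pos hk (N - 1)).ne'
    rw [h3, mul_pow]
    field_simp
  have hcont : Continuous fun r : ℝ => r ^ (N - 1) * posPow p (c * Y ((k * r) ^ 2)) :=
    (continuous_pow _).mul ((continuous_posPow hp).comp
      (continuous_const.mul (hY.continuous_sq.comp (continuous_const.mul continuous_id))))
  have h2 : ∫ y in Ioi (0 : ℝ), y ^ (N - 1) • g y
      = ∫ y in (0 : ℝ)..R, y ^ (N - 1) * posPow p (c * Y ((k * y) ^ 2)) := by
    rw [intervalIntegral.integral_of_le hR.le, integral_Ioc_eq_integral_Ioo]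
    have h3 : (fun y : ℝ => y ^ (N - 1) • g y)
        = (Iio R).indicator fun y => y ^ (N - 1) * posPow p (c * Y ((k * y) ^ 2)) := by
      funext y
      by_cases hy : y < R
      · rw [indicator_of_mem (by exact hy), hg, indicator_of_mem (by exact hy), smul_eq_mul]
      · rw [indicator_of_notMem (by exact hy), hg, indicator_of_notMem (by exact hy), smul_zero]
    rw [h3, setIntegral_indicator measurableSet_Iio, Ioi_inter_Iio]
  rw [h2, intervalIntegral.integral_eq_sub_of_hasDerivAt (fun r _ => hd r)
    (hcont.intervalIntegrable _ _), mul_zero, radialMass_zero (by omega), bubbleMass, omega]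
  simp only [nsmul_eq_mul, smul_eq_mul]
  ring

/-- After clearing denominators both inequalities read $p(N-2)<N$. -/
theorem massExponent_pos (hN : 3 ≤ N) (hp : 1 < p) (hpN : p < criticalExponent N) :
    0 < 2 / (p - 1) * p - N := by
  have hN' : (3 : ℝ) ≤ N := by exact_mod_cast hN
  rw [criticalExponent, lt_div_iff₀ (by linarith)] at hpN
  rw [div_mul_eq_mul_div, sub_pos, lt_div_iff₀ (by linarith)]
  linarith

theorem strictMonoOn_bubbleMass (hY : IsProfile N p Y) (hN : 3 ≤ N) (hp : 1 < p)
    (hpN : p < criticalExponent N) {R : ℝ} (hR : 0 < R) :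
    StrictMonoOn (bubbleMass N p Y R) (Ioi 0) := by
  intro k hk l hl hkl
  have hk' : 0 < k := hk
  have hN1 : 1 ≤ N := by omega
  have h0 : (0 : ℝ) < N * omega N := mul_pos (by exact_mod_cast hN1) (omega_pos N)
  have h1 := Real.rpow_lt_rpow hk'.le hkl (massExponent_pos hN hp hpN)
  have h2 := hY.monotoneOn_radialMass hN1 (mul_pos hk' hR).le
    (mul_pos (hk'.trans hkl) hR).le (mul_le_mul_of_nonneg_right hkl.le hR.le)
  have h3 := hY.radialMass_pos hN1 (mul_pos hk' hR)
  refine mul_lt_mul_of_pos_left ?_ h0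
  exact mul_lt_mul h1 h2 h3 (Real.rpow_nonneg (hk'.trans hkl).le _)

/-- The mass vanishes at $k=0$ and, for $k\ge1$, is at least a positive multiple of a positive power
of $k$; intermediate values do the rest. -/
theorem exists_bubbleMass_eq (hY : IsProfile N p Y) (hN : 3 ≤ N) (hp : 1 < p)
    (hpN : p < criticalExponent N) {R I : ℝ} (hR : 0 < R) (hI : 0 < I) :
    ∃ k, 0 < k ∧ bubbleMass N p Y R k = I := by
  have hN1 : 1 ≤ N := by omega
  have hq := massExponent_pos hN hp hpN
  have h0 : (0 : ℝ) < N * omega N := mul_pos (by exact_mod_cast hN1) (omega_pos N)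
  have hM := hY.radialMass_pos hN1 hR
  have hzero : bubbleMass N p Y R 0 = 0 := by simp [bubbleMass, hq.ne']
  have hcont : ContinuousOn (bubbleMass N p Y R) (Ici 0) := by
    have h1 : Continuous fun k : ℝ => k ^ (2 / (p - 1) * p - N) :=
      continuous_id.rpow_const fun _ => Or.inr hq.le
    have h2 := (hY.continuous_radialMass hN1).comp (continuous_id.mul (continuous_const (y := R)))
    exact (continuous_const.mul (h1.mul h2)).continuousOn
  obtain ⟨l, hl1, hl2⟩ := (((tendsto_rpow_atTop hq).eventually_ge_atTop
    (I / (N * omega N * radialMass N Y R))).and (eventually_ge_atTop 1)).exists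
  have hl : I ≤ bubbleMass N p Y R l := by
    rw [div_le_iff₀ (mul_pos h0 hM)] at hl1
    have h1 := hY.monotoneOn_radialMass hN1 hR.le (by positivity : 0 ≤ l * R)
      (le_mul_of_one_le_left hR.le hl2)
    have h2 : 0 ≤ l ^ (2 / (p - 1) * p - N) := Real.rpow_nonneg (by linarith) _
    calc I ≤ l ^ (2 / (p - 1) * p - N) * (N * omega N * radialMass N Y R) := hl1
      _ = N * omega N * (l ^ (2 / (p - 1) * p - N) * radialMass N Y R) := by ring
      _ ≤ _ := mul_le_mul_of_nonneg_left (mul_le_mul_of_nonneg_left h1 h2) h0.le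
  obtain ⟨k, hk, hkI⟩ := intermediate_value_Icc (by linarith : (0 : ℝ) ≤ l)
    (hcont.mono Icc_subset_Ici_self) ⟨by rw [hzero]; exact hI.le, hl⟩
  refine ⟨k, lt_of_le_of_ne hk.1 ?_, hkI⟩
  rintro rfl
  linarith

theorem IsPoissonSolution.eqOn_bubble (hY : IsProfile N p Y) (hN : 3 ≤ N) (hp : 1 < p) {R γ : ℝ}
    {v : E N → ℝ} (hv : IsPoissonSolution (posPow p) R γ v) (hR : 0 < R) (h0 : 0 < v 0) :
    ∃ k, 0 < k ∧ EqOn v (bubble N p Y k) (closedBall 0 R) := by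
  have hk : 0 < v 0 ^ ((p - 1) / 2) := Real.rpow_pos_of_pos h0 _
  refine ⟨_, hk, hv.eqOn_of_eq_center (by rw [finrank_euclideanSpace_fin]; omega)
    (isPoissonSolution_bubble hY hp hk R) hR (monotone_posPow (by linarith)) (posPow_nonneg p)
    (posPow_sub_le hp) ?_⟩
  rw [bubble_zero hY, ← Real.rpow_mul h0.le]
  have : (p - 1) / 2 * (2 / (p - 1)) = 1 := by
    have : p - 1 ≠ 0 := by linarith
    field_simp
  rw [this, Real.rpow_one]

/-- If $v(0)\le0$, the constant $v(0)$ is a solution with the same centre value, so $v$ equals it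
and has no mass. -/
theorem IsPoissonSolution.center_pos (hN : 3 ≤ N) (hp : 1 < p) {R γ : ℝ} {v : E N → ℝ}
    (hv : IsPoissonSolution (posPow p) R γ v) (hR : 0 < R)
    (hmass : 0 < ∫ x in ball (0 : E N) R, posPow p (v x)) : 0 < v 0 := by
  by_contra! hneg
  have hconst : IsPoissonSolution (posPow p) R (v 0) (fun _ : E N => v 0) :=
    ⟨continuousOn_const, fun _ _ => contDiffAt_const, fun x _ => by
      rw [posPow_of_nonpos (by linarith) hneg]; simp, fun _ _ => rfl⟩
  have h := hv.eqOn_of_eq_center (by rw [finrank_euclideanSpace_fin]; omega) hconst hR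
    (monotone_posPow (by linarith)) (posPow_nonneg p) (posPow_sub_le hp) rfl
  have h2 : ∫ x in ball (0 : E N) R, posPow p (v x) = 0 := by
    refine setIntegral_eq_zero_of_forall_eq_zero fun x hx => ?_
    rw [h (ball_subset_closedBall hx)]
    exact posPow_of_nonpos (by linarith) hneg
  linarith

/-- Classification of the solutions with positive mass. -/
theorem IsPoissonSolution.exists_bubble (hY : IsProfile N p Y) (hN : 3 ≤ N) (hp : 1 < p)
    {R γ I : ℝ} {v : E N → ℝ} (hv : IsPoissonSolution (posPow p) R γ v) (hR : 0 < R) (hI : 0 < I)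
    (hmass : ∫ x in ball (0 : E N) R, posPow p (v x) = I) :
    ∃ k, 0 < k ∧ EqOn v (bubble N p Y k) (closedBall 0 R) ∧
      γ = k ^ (2 / (p - 1)) * Y ((k * R) ^ 2) ∧ bubbleMass N p Y R k = I := by
  obtain ⟨k, hk, hEq⟩ := hv.eqOn_bubble hY hN hp hR
    (hv.center_pos hN hp hR (by rw [hmass]; exact hI))
  refine ⟨k, hk, hEq, ?_, ?_⟩
  · have : Nontrivial (E N) := Module.nontrivial_of_finrank_pos (R := ℝ)
      (by rw [finrank_euclideanSpace_fin]; omega)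
    obtain ⟨x, hx⟩ := NormedSpace.sphere_nonempty (E := E N) (x := 0) (r := R) |>.2 hR.le
    rw [← hv.boundary x hx, hEq (sphere_subset_closedBall hx),
      (isPoissonSolution_bubble hY hp hk R).boundary x hx]
  · rw [← hmass, ← integral_bubble hY (by omega) (by linarith) hk hR]
    exact setIntegral_congr_fun measurableSet_ball fun x hx => by
      rw [hEq (ball_subset_closedBall hx)]

end Bubbles

/-! ### The two problems, the Emden solution, thresholds and free boundary. -/

section Problems

open Filter Topology

variable {N : ℕ} {p : ℝ} {Y : ℝ → ℝ} {β : ℝ≥0} {R : ℝ}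

theorem IsSolutionFB.isPoissonSolution {I γ : ℝ} {v : E N → ℝ} (hR : 0 < R)
    (h : IsSolutionFB (ball 0 R) p β I γ v) : IsPoissonSolution (posPow p) R γ v := by
  have hreg := h.regular.1
  have hb := h.boundary
  rw [closure_ball _ hR.ne'] at hreg
  rw [frontier_ball _ hR.ne'] at hb
  exact ⟨hreg.continuousOn, fun x hx => hreg.contDiffAt (closedBall_mem_nhds_of_mem hx),
    h.equation, hb⟩

/-- With $s=\lambda^{1/(p-1)}$, the first identity makes $s(\alpha+\lambda\psi)$ solve $-\Delta
v=f(v)$; the second gives its mass. -/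
theorem rpow_scale (hp : 1 < p) {lam : ℝ} (hlam : 0 < lam) :
    (lam ^ (1 / (p - 1))) ^ p = lam ^ (1 / (p - 1)) * lam ∧
    (lam ^ (1 / (p - 1))) ^ p = lam ^ (p / (p - 1)) := by
  have hp1 : p - 1 ≠ 0 := by linarith
  rw [← Real.rpow_mul hlam.le]
  constructor
  · nth_rewrite 3 [← Real.rpow_one lam]
    rw [← Real.rpow_add hlam]
    congr 1
    field_simp
    ring
  · congr 1
    field_simp

theorem laplacian_affine {F : Type*} [NormedAddCommGroup F] [InnerProductSpace ℝ F]
    [FiniteDimensional ℝ F] {w : F → ℝ} {x : F} (hw : ContDiffAt ℝ 2 w x) (a b : ℝ) :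
    Laplacian.laplacian (fun z => a + b * w z) x = b * Laplacian.laplacian w x := by
  have hb : ContDiffAt ℝ 2 (b • w) x := hw.const_smul b
  have h := (contDiffAt_const (c := a)).laplacian_add hb
  rw [InnerProductSpace.laplacian_smul b hw] at h
  have h' : Laplacian.laplacian (fun z => a + b * w z) x = _ := h
  rw [h']
  simp

/-- The correspondence between the two problems. -/
theorem IsSolutionP.isPoissonSolution {lam α : ℝ} {ψ : E N → ℝ} (hp : 1 < p) (hR : 0 < R)
    (hlam : 0 < lam) (h : IsSolutionP (ball 0 R) p β lam α ψ) :
    IsPoissonSolution (posPow p) R (lam ^ (1 / (p - 1)) * α)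
      (fun x => lam ^ (1 / (p - 1)) * (α + lam * ψ x)) ∧
    ∫ x in ball (0 : E N) R, posPow p (lam ^ (1 / (p - 1)) * (α + lam * ψ x))
      = lam ^ (p / (p - 1)) := by
  have hreg := h.regular.1
  have hb := h.boundary
  rw [closure_ball _ hR.ne'] at hreg
  rw [frontier_ball _ hR.ne'] at hb
  set s := lam ^ (1 / (p - 1)) with hs
  have hs0 : 0 < s := Real.rpow_pos_of_pos hlam _
  obtain ⟨h1, h2⟩ := rpow_scale hp hlam
  rw [← hs] at h1 h2
  have hcd : ∀ x ∈ ball (0 : E N) R, ContDiffAt ℝ 2 ψ x := fun x hx =>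
    hreg.contDiffAt (closedBall_mem_nhds_of_mem hx)
  refine ⟨⟨?_, fun x hx => ?_, fun x hx => ?_, fun x hx => ?_⟩, ?_⟩
  · exact continuousOn_const.mul (continuousOn_const.add
      (continuousOn_const.mul hreg.continuousOn))
  · exact contDiffAt_const.mul (contDiffAt_const.add (contDiffAt_const.mul (hcd x hx)))
  · have h3 : (fun x => s * (α + lam * ψ x)) = fun x => s * α + s * lam * ψ x := by
      funext x
      ring
    have h4 := h.equation x hx
    rw [posPow_mul hs0.le, h3, laplacian_affine (hcd x hx), h1, posPow, ← h4]
    ring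
  · rw [hb x hx]
    ring
  · simp_rw [posPow_mul hs0.le]
    rw [integral_const_mul]
    have h3 : ∫ x in ball (0 : E N) R, posPow p (α + lam * ψ x) = 1 := h.mass
    rw [h3, mul_one, h2]

theorem isSolutionFB_bubble (hY : IsProfile N p Y) (hN : 1 ≤ N) (hp : 1 < p) (hβ : β ≤ 1)
    (hR : 0 < R) {k : ℝ} (hk : 0 < k) :
    IsSolutionFB (ball 0 R) p β (bubbleMass N p Y R k)
      (k ^ (2 / (p - 1)) * Y ((k * R) ^ 2)) (bubble N p Y k) where
  regular := isC2Holder_ball_of_contDiff hβ hR (contDiff_bubble hY k)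
  equation x _ := laplacian_bubble hY hp hk x
  boundary x hx := by
    rw [frontier_ball _ hR.ne'] at hx
    exact (isPoissonSolution_bubble hY hp hk R).boundary x hx
  mass := integral_bubble hY hN (by linarith) hk hR

/-- The pair is obtained by solving $s(\alpha+\lambda\psi)=$ bubble, $\psi=0$ on the boundary. -/
theorem isSolutionP_bubble (hY : IsProfile N p Y) (hN : 1 ≤ N) (hp : 1 < p) (hβ : β ≤ 1)
    (hR : 0 < R) {k lam : ℝ} (hk : 0 < k) (hlam : 0 < lam)
    (hmass : bubbleMass N p Y R k = lam ^ (p / (p - 1))) :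
    IsSolutionP (ball 0 R) p β lam
      ((lam ^ (1 / (p - 1)))⁻¹ * (k ^ (2 / (p - 1)) * Y ((k * R) ^ 2)))
      (fun x => -((lam ^ (1 / (p - 1)))⁻¹ * (k ^ (2 / (p - 1)) * Y ((k * R) ^ 2)) / lam)
        + (lam ^ (1 / (p - 1)))⁻¹ / lam * bubble N p Y k x) := by
  obtain ⟨h1, h2⟩ := rpow_scale hp hlam
  set s := lam ^ (1 / (p - 1)) with hs
  have hs0 : 0 < s := Real.rpow_pos_of_pos hlam _
  set γ := k ^ (2 / (p - 1)) * Y ((k * R) ^ 2) with hγ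
  have hval : ∀ x : E N, s⁻¹ * γ + lam * (-(s⁻¹ * γ / lam) + s⁻¹ / lam * bubble N p Y k x)
      = s⁻¹ * bubble N p Y k x := fun x => by
    field_simp
    ring
  have hpow : ∀ t, posPow p (s⁻¹ * t) = (s * lam)⁻¹ * posPow p t := fun t => by
    rw [posPow_mul (inv_pos.2 hs0).le, Real.inv_rpow hs0.le, h1]
  refine ⟨isC2Holder_ball_of_contDiff hβ hR
    (contDiff_const.add (contDiff_const.mul (contDiff_bubble hY k))), fun x hx => ?_,
    fun x hx => ?_, ?_⟩
  · rw [hval, laplacian_affine ((contDiff_bubble hY k).of_le (by norm_num)).contDiffAt]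
    have h3 := laplacian_bubble hY hp hk x
    have h4 := hpow (bubble N p Y k x)
    rw [posPow] at h4
    rw [h4, ← h3]
    field_simp
  · rw [frontier_ball _ hR.ne'] at hx
    rw [(isPoissonSolution_bubble hY hp hk R).boundary x hx]
    ring
  · have h3 := integral_bubble hY hN (by linarith) hk hR
    have h4 : ∫ x in ball (0 : E N) R, posPow p (s⁻¹ * bubble N p Y k x) = 1 := by
      simp_rw [hpow]
      rw [integral_const_mul, h3, hmass, ← h2, h1]
      exact inv_mul_cancel₀ (mul_pos hs0 hlam).ne'
    simp_rw [hval]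
    exact h4

/-- A solution is determined by its mass. -/
theorem IsPoissonSolution.eqOn_bubble_of_mass (hY : IsProfile N p Y) (hN : 3 ≤ N) (hp : 1 < p)
    (hpN : p < criticalExponent N) {γ k : ℝ} {v : E N → ℝ}
    (hv : IsPoissonSolution (posPow p) R γ v) (hR : 0 < R) (hk : 0 < k)
    (hmass : ∫ x in ball (0 : E N) R, posPow p (v x) = bubbleMass N p Y R k)
    (hpos : 0 < bubbleMass N p Y R k) :
    EqOn v (bubble N p Y k) (closedBall 0 R) ∧ γ = k ^ (2 / (p - 1)) * Y ((k * R) ^ 2) := by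
  obtain ⟨l, hl, h1, h2, h3⟩ := hv.exists_bubble hY hN hp hR hpos hmass
  have : l = k := (strictMonoOn_bubbleMass hY hN hp hpN hR).injOn hl hk h3
  subst this
  exact ⟨h1, h2⟩

theorem isEmdenSolution_bubble (hY : IsProfile N p Y) (hN : 1 ≤ N) (hp : 1 < p) {r0 : ℝ}
    (hr0 : 0 < r0) (hzero : Y (r0 ^ 2) = 0) : IsEmdenSolution N p (bubble N p Y r0) := by
  have hpos : ∀ x ∈ ball (0 : E N) 1, 0 < bubble N p Y r0 x := fun x hx => by
    rw [mem_ball_zero_iff] at hx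
    refine mul_pos (Real.rpow_pos_of_pos hr0 _) ?_
    rw [← hzero]
    exact hY.strictAntiOn hN (mul_nonneg hr0.le (norm_nonneg x)) hr0.le
      (mul_lt_of_lt_one_right hr0 hx)
  refine ⟨((contDiff_bubble hY r0).of_le (by norm_num)).contDiffOn,
    ((contDiff_bubble hY r0).of_le (by norm_num)).contDiffOn, fun x hx => ?_, hpos, fun x hx => ?_⟩
  · rw [laplacian_bubble hY hp hr0, posPow_of_nonneg (hpos x hx).le]
  · rw [(isPoissonSolution_bubble hY hp hr0 1).boundary x hx, mul_one, hzero, mul_zero]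

/-- The solution is some bubble; its zero boundary value fixes `k`, since the strictly decreasing
profile has one zero. -/
theorem IsEmdenSolution.eqOn_bubble (hY : IsProfile N p Y) (hN : 3 ≤ N) (hp : 1 < p) {r0 : ℝ}
    (hr0 : 0 < r0) (hzero : Y (r0 ^ 2) = 0) {u : E N → ℝ} (hu : IsEmdenSolution N p u) :
    EqOn u (bubble N p Y r0) (closedBall 0 1) := by
  have hsol : IsPoissonSolution (posPow p) 1 0 u :=
    ⟨hu.regular_closure.continuousOn,
      fun x hx => hu.regular.contDiffAt (isOpen_ball.mem_nhds hx),
      fun x hx => by rw [hu.equation x hx, posPow_of_nonneg (hu.pos x hx).le], hu.boundary⟩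
  obtain ⟨k, hk, hEq⟩ := hsol.eqOn_bubble hY hN hp one_pos (hu.pos 0 (mem_ball_self one_pos))
  have : Nontrivial (E N) := Module.nontrivial_of_finrank_pos (R := ℝ)
    (by rw [finrank_euclideanSpace_fin]; omega)
  obtain ⟨x, hx⟩ := NormedSpace.sphere_nonempty (E := E N) (x := 0) (r := 1) |>.2 zero_le_one
  have h1 := hEq (sphere_subset_closedBall hx)
  rw [hu.boundary x hx, (isPoissonSolution_bubble hY hp hk 1).boundary x hx, mul_one] at h1
  have h2 : Y (k ^ 2) = 0 :=
    (mul_eq_zero.1 h1.symm).resolve_left (Real.rpow_pos_of_pos hk _).ne'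
  have h3 : k = r0 := (hY.strictAntiOn (by omega)).injOn hk.le hr0.le (h2.trans hzero.symm)
  rwa [h3] at hEq

/-- The exponent in $I^*$ equals $\frac{2p}{p-1}-N$, so $I^*$ is the mass of the bubble that
vanishes exactly on the boundary of the unit-volume ball. -/
theorem massThreshold_bubble (hY : IsProfile N p Y) (hN : 3 ≤ N) (hp : 1 < p) {r0 : ℝ}
    (hr0 : 0 < r0) (hzero : Y (r0 ^ 2) = 0) :
    massThreshold N p (bubble N p Y r0) = bubbleMass N p Y (unitRadius N) (r0 / unitRadius N) := by
  have hR := unitRadius_pos N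
  have hN' : (3 : ℝ) ≤ N := by exact_mod_cast hN
  have h1 : emdenMass N p (bubble N p Y r0) = bubbleMass N p Y 1 r0 := by
    rw [← integral_bubble hY (by omega) (by linarith) hr0 one_pos, emdenMass]
    exact setIntegral_congr_fun measurableSet_ball fun x hx => by
      rw [posPow_of_nonneg ((isEmdenSolution_bubble hY (by omega) hp hr0 hzero).pos x hx).le]
  have h2 : (N : ℝ) / (p - 1) * (1 - p / criticalExponent N) = 2 / (p - 1) * p - N := by
    have : (p - 1) ≠ 0 := by linarith
    have : (N : ℝ) - 2 ≠ 0 := by linarith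
    rw [criticalExponent]
    field_simp
    ring
  rw [massThreshold, h1, h2, bubbleMass, bubbleMass, Real.div_rpow hr0.le hR.le, mul_one,
    div_mul_cancel₀ _ hR.ne']
  ring

/-- The free boundary of a bubble is the sphere where it vanishes, if that lies in the ball. -/
theorem freeBoundary_bubble_nonempty_iff (hY : IsProfile N p Y) (hN : 1 ≤ N) {r0 k : ℝ}
    (hr0 : 0 < r0) (hzero : Y (r0 ^ 2) = 0) (hk : 0 < k) (hR : 0 < R) {v : E N → ℝ}
    (hv : EqOn v (bubble N p Y k) (closedBall 0 R)) :
    (freeBoundary (ball 0 R) v).Nonempty ↔ r0 < k * R := by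
  have hset : {x ∈ ball (0 : E N) R | 0 < v x} = ball 0 (min R (r0 / k)) := by
    ext x
    rw [mem_sep_iff, mem_ball_zero_iff, mem_ball_zero_iff, lt_min_iff]
    refine and_congr_right fun hx => ?_
    rw [hv (by rw [mem_closedBall_zero_iff]; exact hx.le), bubble,
      mul_pos_iff_of_pos_left (Real.rpow_pos_of_pos hk _), ← hzero,
      (hY.strictAntiOn hN).lt_iff_gt hr0.le (mul_nonneg hk.le (norm_nonneg x)), lt_div_iff₀ hk,
      mul_comm]
  have hmin : 0 < min R (r0 / k) := lt_min hR (div_pos hr0 hk)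
  have : Nontrivial (E N) := Module.nontrivial_of_finrank_pos (R := ℝ)
    (by rw [finrank_euclideanSpace_fin]; omega)
  rw [freeBoundary, hset, frontier_ball _ hmin.ne', ← div_lt_iff₀' hk]
  constructor
  · rintro ⟨x, hx1, hx2⟩
    rw [mem_sphere_zero_iff_norm] at hx1
    rw [mem_ball_zero_iff, hx1, min_lt_iff] at hx2
    exact hx2.resolve_left (lt_irrefl R)
  · intro h
    obtain ⟨x, hx⟩ := NormedSpace.sphere_nonempty (E := E N) (x := 0)
      (r := min R (r0 / k)) |>.2 hmin.le
    refine ⟨x, hx, ?_⟩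
    rw [mem_sphere_zero_iff_norm] at hx
    rw [mem_ball_zero_iff, hx]
    exact (min_le_right _ _).trans_lt h

/-- The boundary value of a bubble which changes sign, in terms of its mass. -/
theorem bubble_boundary_eq (hY : IsProfile N p Y) (hN : 3 ≤ N) (hp : 1 < p) {r0 k : ℝ}
    (hr0 : 0 < r0) (hzero : Y (r0 ^ 2) = 0) (hk : 0 < k) (hkR : r0 ≤ k * unitRadius N) :
    k ^ (2 / (p - 1)) * Y ((k * unitRadius N) ^ 2)
      = greenConstant N * bubbleMass N p Y (unitRadius N) k
        * (1 - (k * unitRadius N / r0) ^ (N - 2)) := by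
  have hR := unitRadius_pos N
  have hω := omega_pos N
  obtain ⟨h1, h2⟩ := hY.eq_of_zero_le hN hp hr0 hzero hkR
  have hN2 : ((N - 2 : ℕ) : ℝ) = (N : ℝ) - 2 := by
    rw [Nat.cast_sub (by omega)]
    norm_num
  have hN0 : (0 : ℝ) < N := by
    have : 0 < N := by omega
    exact_mod_cast this
  have hN2' : (N : ℝ) - 2 ≠ 0 := by
    rw [← hN2]
    have : N - 2 ≠ 0 := by omega
    exact_mod_cast this
  -- The first factor belongs to the mass; the second absorbs the $k$ in $(kR)^{-(N-2)}$.
  have h3 : k ^ (2 / (p - 1)) = k ^ (2 / (p - 1) * p - N) * k ^ (N - 2) := by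
    rw [← Real.rpow_natCast k (N - 2), ← Real.rpow_add hk, hN2]
    congr 1
    have : p - 1 ≠ 0 := by linarith
    field_simp
    ring
  have h4 : 0 < k ^ (2 / (p - 1) * p - N) := Real.rpow_pos_of_pos hk _
  rw [h2, greenConstant, bubbleMass, h1, h3, ← hN2, Real.rpow_natCast, hN2]
  have h5 := pow_pos hR (N - 2)
  have h6 := pow_pos hk (N - 2)
  have h7 := pow_pos hr0 (N - 2)
  rw [mul_pow, div_pow, mul_pow]
  field_simp

/-- Once $kR\ge r_0$ the factor $M(kR)$ is frozen at $M(r_0)$, leaving a pure power of $k$. -/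
theorem bubbleMass_div (hY : IsProfile N p Y) (hN : 3 ≤ N) (hp : 1 < p) {r0 k : ℝ} (hR : 0 < R)
    (hr0 : 0 < r0) (hzero : Y (r0 ^ 2) = 0) (hk : 0 < k) (hkR : r0 ≤ k * R) :
    bubbleMass N p Y R k / bubbleMass N p Y R (r0 / R)
      = (k * R / r0) ^ (2 / (p - 1) * p - N) := by
  obtain ⟨h1, -⟩ := hY.eq_of_zero_le hN hp hr0 hzero hkR
  have hN0 : (N : ℝ) ≠ 0 := by
    have : N ≠ 0 := by omega
    exact_mod_cast this
  have hω := omega_pos N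
  have hM := hY.radialMass_pos (by omega) hr0
  rw [bubbleMass, bubbleMass, h1, div_mul_cancel₀ _ hR.ne', Real.div_rpow hr0.le hR.le,
    Real.div_rpow (mul_pos hk hR).le hr0.le, Real.mul_rpow hk.le hR.le]
  have h2 := Real.rpow_pos_of_pos hR (2 / (p - 1) * p - N)
  have h3 := Real.rpow_pos_of_pos hr0 (2 / (p - 1) * p - N)
  field_simp

end Problems

end PlasmaBall

/-! ### The main theorem. -/

theorem mainTheorem11 (N : ℕ) (hN : 3 ≤ N) (p : ℝ) (hp : 1 < p)
    (hpN : p < PlasmaBall.criticalExponent N) (β : ℝ≥0) (hβ : 0 < β) (hβ' : β < 1) :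
    -- existence and uniqueness for `(FB_I)`
    (∀ I : ℝ, 0 < I → ∃ (γ : ℝ) (v : PlasmaBall.E N → ℝ),
      PlasmaBall.IsSolutionFB (PlasmaBall.unitVolumeBall N) p β I γ v ∧
      ∀ (γ' : ℝ) (v' : PlasmaBall.E N → ℝ),
        PlasmaBall.IsSolutionFB (PlasmaBall.unitVolumeBall N) p β I γ' v' →
          γ' = γ ∧ EqOn v' v (closure (PlasmaBall.unitVolumeBall N))) ∧
    -- existence and uniqueness for `(P_λ)`
    (∀ lam : ℝ, 0 < lam → ∃ (α : ℝ) (ψ : PlasmaBall.E N → ℝ),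
      PlasmaBall.IsSolutionP (PlasmaBall.unitVolumeBall N) p β lam α ψ ∧
      ∀ (α' : ℝ) (ψ' : PlasmaBall.E N → ℝ),
        PlasmaBall.IsSolutionP (PlasmaBall.unitVolumeBall N) p β lam α' ψ' →
          α' = α ∧ EqOn ψ' ψ (closure (PlasmaBall.unitVolumeBall N))) ∧
    -- the unique solution `u` of the Emden problem on the unit ball, which defines the thresholds
    (∃ u : PlasmaBall.E N → ℝ, PlasmaBall.IsEmdenSolution N p u ∧
      (∀ u' : PlasmaBall.E N → ℝ, PlasmaBall.IsEmdenSolution N p u' →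
        EqOn u' u (closedBall 0 1)) ∧
      ∀ I lam : ℝ, 0 < I → 0 < lam → I = lam ^ (p / (p - 1)) →
        ∀ (γ α : ℝ) (v ψ : PlasmaBall.E N → ℝ),
          PlasmaBall.IsSolutionFB (PlasmaBall.unitVolumeBall N) p β I γ v →
          PlasmaBall.IsSolutionP (PlasmaBall.unitVolumeBall N) p β lam α ψ →
          -- the two solutions correspond to each other
          (γ = lam ^ (1 / (p - 1)) * α ∧
            EqOn v (fun x => lam ^ (1 / (p - 1)) * (α + lam * ψ x))
              (closure (PlasmaBall.unitVolumeBall N))) ∧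
          -- positivity
          List.TFAE [0 < α,
            ∀ x ∈ closure (PlasmaBall.unitVolumeBall N), 0 < v x,
            0 < γ,
            I < PlasmaBall.massThreshold N p u,
            lam < PlasmaBall.lambdaThreshold N p u] ∧
          -- free boundary
          List.TFAE [(PlasmaBall.freeBoundary (PlasmaBall.unitVolumeBall N) v).Nonempty,
            α < 0,
            γ < 0,
            PlasmaBall.massThreshold N p u < I,
            PlasmaBall.lambdaThreshold N p u < lam] ∧
          (PlasmaBall.lambdaThreshold N p u < lam →
            α = PlasmaBall.greenConstant N * lam *
              (1 - (lam / PlasmaBall.lambdaThreshold N p u) ^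
                (p / (PlasmaBall.criticalExponent N - p))))) := by
  obtain ⟨Y, hY⟩ := PlasmaBall.exists_isProfile (N := N) (by omega) hp
  obtain ⟨r0, hr0, hzero⟩ := hY.exists_zero hN hp hpN
  set R := PlasmaBall.unitRadius N with hRdef
  have hR : 0 < R := PlasmaBall.unitRadius_pos N
  have hΩ : PlasmaBall.unitVolumeBall N = ball 0 R := rfl
  have hcl : closure (PlasmaBall.unitVolumeBall N) = closedBall 0 R := by
    rw [hΩ, closure_ball _ hR.ne']
  have hN1 : 1 ≤ N := by omega
  have hFB : ∀ {k γ I : ℝ} {v : PlasmaBall.E N → ℝ}, 0 < k → 0 < I →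
      PlasmaBall.bubbleMass N p Y R k = I →
      PlasmaBall.IsSolutionFB (PlasmaBall.unitVolumeBall N) p β I γ v →
      EqOn v (PlasmaBall.bubble N p Y k) (closedBall 0 R) ∧
        γ = k ^ (2 / (p - 1)) * Y ((k * R) ^ 2) := fun hk hI hkI h =>
    (h.isPoissonSolution hR).eqOn_bubble_of_mass hY hN hp hpN hR hk (by rw [hkI]; exact h.mass)
      (by rw [hkI]; exact hI)
  have hP : ∀ {k α lam : ℝ} {ψ : PlasmaBall.E N → ℝ}, 0 < k → 0 < lam →
      PlasmaBall.bubbleMass N p Y R k = lam ^ (p / (p - 1)) →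
      PlasmaBall.IsSolutionP (PlasmaBall.unitVolumeBall N) p β lam α ψ →
      EqOn (fun x => lam ^ (1 / (p - 1)) * (α + lam * ψ x)) (PlasmaBall.bubble N p Y k)
        (closedBall 0 R) ∧
        lam ^ (1 / (p - 1)) * α = k ^ (2 / (p - 1)) * Y ((k * R) ^ 2) := by
    intro k α lam ψ hk hlam hkI h
    obtain ⟨h1, h2⟩ := h.isPoissonSolution hp hR hlam
    exact h1.eqOn_bubble_of_mass hY hN hp hpN hR hk (by rw [hkI]; exact h2)
      (by rw [hkI]; exact Real.rpow_pos_of_pos hlam _)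
  refine ⟨fun I hI => ?_, fun lam hlam => ?_, PlasmaBall.bubble N p Y r0,
    PlasmaBall.isEmdenSolution_bubble hY hN1 hp hr0 hzero,
    fun u' hu' => hu'.eqOn_bubble hY hN hp hr0 hzero, ?_⟩
  · obtain ⟨k, hk, hkI⟩ := PlasmaBall.exists_bubbleMass_eq hY hN hp hpN hR hI
    refine ⟨_, _, hkI ▸ PlasmaBall.isSolutionFB_bubble hY hN1 hp hβ'.le hR hk,
      fun γ' v' h => ?_⟩
    obtain ⟨h1, h2⟩ := hFB hk hI hkI h
    rw [hcl]
    exact ⟨h2, h1⟩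
  · obtain ⟨k, hk, hkI⟩ := PlasmaBall.exists_bubbleMass_eq hY hN hp hpN hR
      (Real.rpow_pos_of_pos hlam (p / (p - 1)))
    have hsol := PlasmaBall.isSolutionP_bubble hY hN1 hp hβ'.le hR hk hlam hkI
    have hs : lam ^ (1 / (p - 1)) ≠ 0 := (Real.rpow_pos_of_pos hlam _).ne'
    refine ⟨_, _, hsol, fun α' ψ' h => ?_⟩
    obtain ⟨h1, h2⟩ := hP hk hlam hkI h
    obtain ⟨h3, h4⟩ := hP hk hlam hkI hsol
    have hα := mul_left_cancel₀ hs (h2.trans h4.symm)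
    refine ⟨hα, fun x hx => ?_⟩
    rw [hcl] at hx
    have h5 := mul_left_cancel₀ hs ((h1 hx).trans (h3 hx).symm)
    rw [hα] at h5
    exact mul_left_cancel₀ hlam.ne' (add_left_cancel h5)
  · intro I lam hI hlam hIlam γ α v ψ hv hψ
    obtain ⟨k, hk, hkI⟩ := PlasmaBall.exists_bubbleMass_eq hY hN hp hpN hR hI
    obtain ⟨hvk, hγ⟩ := hFB hk hI hkI hv
    obtain ⟨hψk, hα⟩ := hP hk hlam (hkI.trans hIlam) hψ
    set s := lam ^ (1 / (p - 1)) with hs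
    have hs0 : 0 < s := Real.rpow_pos_of_pos hlam _
    have hγα : γ = s * α := hγ.trans hα.symm
    have hkR : 0 < k * R := mul_pos hk hR
    have hck : 0 < k ^ (2 / (p - 1)) := Real.rpow_pos_of_pos hk _
    have hanti := hY.strictAntiOn hN1
    have hthr := PlasmaBall.massThreshold_bubble hY hN hp hr0 hzero
    rw [← hRdef] at hthr
    set Is := PlasmaBall.massThreshold N p (PlasmaBall.bubble N p Y r0) with hIs
    have hr0R : 0 < r0 / R := div_pos hr0 hR
    have hmono := PlasmaBall.strictMonoOn_bubbleMass hY hN hp hpN hR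
    have hp1 : 0 < p - 1 := by linarith
    have hIs0 : 0 < Is := by
      rw [hthr, PlasmaBall.bubbleMass, div_mul_cancel₀ _ hR.ne']
      have h1 := PlasmaBall.omega_pos N
      have h2 := hY.radialMass_pos hN1 hr0
      have h3 : (0 : ℝ) < N := by exact_mod_cast hN1
      have h4 := Real.rpow_pos_of_pos hr0R (2 / (p - 1) * p - N)
      positivity
    have hlam' : lam = I ^ ((p - 1) / p) := by
      rw [hIlam, ← Real.rpow_mul hlam.le]
      have : p / (p - 1) * ((p - 1) / p) = 1 := by field_simp
      rw [this, Real.rpow_one]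
    have hexp : 0 < (p - 1) / p := by positivity
    -- All the equivalences are reduced to the position of $kR$ relative to $r_0$: signs through the
    -- decreasing profile, thresholds through the increasing mass.
    have hγpos : 0 < γ ↔ k * R < r0 := by
      rw [hγ, mul_pos_iff_of_pos_left hck, ← hzero, hanti.lt_iff_gt hr0.le hkR.le]
    have hγneg : γ < 0 ↔ r0 < k * R := by
      rw [hγ, ← hanti.lt_iff_gt hkR.le hr0.le]
      simp only [hzero]
      exact ⟨fun h => neg_of_mul_neg_right h hck.le, fun h => mul_neg_of_pos_of_neg hck h⟩
    have hαpos : 0 < α ↔ 0 < γ := by rw [hγα, mul_pos_iff_of_pos_left hs0]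
    have hαneg : α < 0 ↔ γ < 0 := by
      rw [hγα]
      exact ⟨fun h => mul_neg_of_pos_of_neg hs0 h, fun h => neg_of_mul_neg_right h hs0.le⟩
    have hIlt : I < Is ↔ 0 < γ := by
      rw [hγpos, hthr, ← hkI, hmono.lt_iff_lt hk hr0R, lt_div_iff₀ hR]
    have hIgt : Is < I ↔ γ < 0 := by
      rw [hγneg, hthr, ← hkI, hmono.lt_iff_lt hr0R hk, div_lt_iff₀ hR]
    have hlamlt : lam < PlasmaBall.lambdaThreshold N p (PlasmaBall.bubble N p Y r0) ↔ I < Is := by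
      rw [PlasmaBall.lambdaThreshold, hlam', Real.rpow_lt_rpow_iff hI.le hIs0.le hexp]
    have hlamgt : PlasmaBall.lambdaThreshold N p (PlasmaBall.bubble N p Y r0) < lam ↔ Is < I := by
      rw [PlasmaBall.lambdaThreshold, hlam', Real.rpow_lt_rpow_iff hIs0.le hI.le hexp]
    have hvpos : (∀ x ∈ closure (PlasmaBall.unitVolumeBall N), 0 < v x) ↔ 0 < γ := by
      rw [hcl]
      constructor
      · intro h
        have : Nontrivial (PlasmaBall.E N) := Module.nontrivial_of_finrank_pos (R := ℝ)
          (by rw [finrank_euclideanSpace_fin]; omega)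
        obtain ⟨x, hx⟩ := NormedSpace.sphere_nonempty (E := PlasmaBall.E N) (x := 0)
          (r := R) |>.2 hR.le
        rw [← (hv.isPoissonSolution hR).boundary x hx]
        exact h x (sphere_subset_closedBall hx)
      · intro h x hx
        rw [hvk hx]
        rw [mem_closedBall_zero_iff] at hx
        refine mul_pos hck ?_
        rw [← hzero]
        exact hanti (mul_nonneg hk.le (norm_nonneg x)) hr0.le
          ((mul_le_mul_of_nonneg_left hx hk.le).trans_lt (hγpos.1 h))
    have hfb : (PlasmaBall.freeBoundary (PlasmaBall.unitVolumeBall N) v).Nonempty ↔ γ < 0 := by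
      rw [hγneg]
      exact PlasmaBall.freeBoundary_bubble_nonempty_iff hY hN1 hr0 hzero hk hR hvk
    refine ⟨⟨hγα, ?_⟩, ?_, ?_, fun hlt => ?_⟩
    · rw [hcl]
      exact fun x hx => (hvk hx).trans (hψk hx).symm
    · tfae_have 1 ↔ 3 := hαpos
      tfae_have 2 ↔ 3 := hvpos
      tfae_have 4 ↔ 3 := hIlt
      tfae_have 5 ↔ 4 := hlamlt
      tfae_finish
    · tfae_have 1 ↔ 3 := hfb
      tfae_have 2 ↔ 3 := hαneg
      tfae_have 4 ↔ 3 := hIgt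
      tfae_have 5 ↔ 4 := hlamgt
      tfae_finish
    · have hkr : r0 ≤ k * R := (hγneg.1 (hIgt.1 (hlamgt.1 hlt))).le
      have h1 := PlasmaBall.bubble_boundary_eq hY hN hp hr0 hzero hk hkr
      rw [← hRdef, ← hγ, hkI, hγα] at h1
      -- Dividing the formula for $\gamma=s\alpha$ by $s$ then replaces the mass by $\lambda$.
      have h2 : I = s * lam := by
        obtain ⟨h3, h4⟩ := PlasmaBall.rpow_scale hp hlam
        rw [hIlam, ← h4, h3]
      -- With $q=\frac{2p}{p-1}-N$ one has $\lambda/\lambda^*=(kR/r_0)^{q(p-1)/p}$, and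
      -- $q(p-1)=N-(N-2)p=(N-2)(p_N-p)$, so the exponents combine to $N-2$.
      have h3 : (lam / PlasmaBall.lambdaThreshold N p (PlasmaBall.bubble N p Y r0))
          ^ (p / (PlasmaBall.criticalExponent N - p)) = (k * R / r0) ^ (N - 2) := by
        have h4 := PlasmaBall.bubbleMass_div hY hN hp hR hr0 hzero hk hkr
        rw [← hthr, hkI] at h4
        have h5 : 0 < k * R / r0 := div_pos hkR hr0
        have hN' : (3 : ℝ) ≤ N := by exact_mod_cast hN
        rw [PlasmaBall.lambdaThreshold, ← hIs, hlam', ← Real.div_rpow hI.le hIs0.le, h4,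
          ← Real.rpow_mul h5.le, ← Real.rpow_mul h5.le, ← Real.rpow_natCast]
        congr 1
        rw [Nat.cast_sub (by omega)]
        have h6 : PlasmaBall.criticalExponent N - p ≠ 0 := by linarith
        rw [PlasmaBall.criticalExponent] at h6 ⊢
        have h7 : (N : ℝ) - 2 ≠ 0 := by linarith
        have h8 : (N : ℝ) / (N - 2) - p = (N - (N - 2) * p) / (N - 2) := by field_simp
        rw [h8] at h6 ⊢
        have h9 : (N : ℝ) - (N - 2) * p ≠ 0 := fun h => h6 (by rw [h, zero_div])
        have hq : 2 / (p - 1) * p - N = (N - (N - 2) * p) / (p - 1) := by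
          field_simp
          ring
        rw [hq]
        generalize (N : ℝ) - (N - 2) * p = D at h9
        push_cast
        field_simp
      rw [h3]
      refine mul_left_cancel₀ hs0.ne' ?_
      rw [h1, h2]
      ring
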